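/- **Proposition 2.3.** Let $d\ge 0$ and let $f(t,x,\xi)$, $t\in\mathbb R$, $(x,\xi)\in\mathbb R^{d}\times\mathbb R^d$, be a polynomial of degree at most $2$ in $(x,\xi)$ with real coefficients that are $C^1$ functions of $t$ (in particular this covers coefficients of class $C^\ell$, $\ell\ge 1$). For fixed $t$ let $\mathbf X_f^{\kappa}(t,\cdot)$ be the flow in $\kappa$ of Hamilton's equations $$\frac{dx}{d\kappa}=\frac{\partial f}{\partial \xi}(t,x,\xi),\qquad \frac{d\xi}{d\kappa}=-\frac{\partial f}{\partial x}(t,x,\xi),$$ and let $\phi(t,x,\xi)=\mathbf X_f^{1}(t,x,\xi)$. Let $h(t,x,\xi)$ be real and, for every $t$, a symbol: $h(t,\cdot)\in C^\infty(\mathbb R^{2d})$ and there is $m=m(t)\in\mathbb N$ such that every $(x,\xi)$-derivative of $h(t,\cdot)$ is $O((1+|(x,\xi)|)^m)$. Let $h'$ be the Hamiltonian into which the time-dependent canonical transformation $\phi$ transforms $h$, that is, $$h'(t,x,\xi)=h\bigl(t,\phi(t,x,\xi)\bigr)-\int_0^1\frac{\partial f}{\partial t}\bigl(t,\mathbf X_f^{\kappa}(t,x,\xi)\bigr)\,d\kappa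 .$$ For a symbol $a$ let $$a^w u(x)=\frac1{(2\pi)^d}\int_{\mathbb R^d}\!\int_{\mathbb R^d} e^{i(x-y)\cdot\xi}\,a\bigl(\tfrac{x+y}2,\xi\bigr)u(y)\,dy\,d\xi\qquad(u\in\mathcal S(\mathbb R^d))$$ be its Weyl quantization. Then: 1. For every $t$ there is exactly one strongly continuous one-parameter group $\kappa\mapsto e^{-i\kappa f^w(t,x,D)}$ of unitary operators of $L^2(\mathbb R^d)$ whose infinitesimal generator equals $-if^w(t,x,D)$ on $\mathcal S(\mathbb R^d)$. 2. The transformation $\psi(t)=e^{-if^w(t,x,D)}\psi'(t)$ transforms the quantum system with Hamiltonian $h^w$ exactly into the one with Hamiltonian $(h')^w$: for $\psi,\psi':\mathbb R\to L^2(\mathbb R^d)$ related in this way, $\psi$ is a solution of $i\dot\psi=h^w(t,x,D)\psi$ if and only if $\psi'$ is a solution of $i\dot\psi'=(h')^w(t,x,D)\psi'$. Here a solution of $i\dot\psi=g^w(t,x,D)\psi$ is a function $\psi\in C(\mathbb R;L^2(\mathbb R^d))$ such that for every $v\in\mathcal S(\mathbb R^d)$ the function $t\mapsto\langle v,\psi(t)\rangle$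 is differentiable at every $t\in\mathbb R$ with $i\frac{d}{dt}\langle v,\psi(t)\rangle=\langle g^w(t,x,D)v,\psi(t)\rangle$, where $\langle v,w\rangle=\int_{\mathbb R^d}\overline{v}\,w\,dx$. -/

import Mathlib

open MeasureTheory
open scoped SchwartzMap ContDiff

noncomputable section

/-- Configuration space `ℝᵈ` with its Euclidean structure and Lebesgue measure. -/
abbrev Conf (d : ℕ) : Type := EuclideanSpace ℝ (Fin d)

/-- The Hilbert space `L²(ℝᵈ; ℂ)`. -/
abbrev L2 (d : ℕ) : Type := Lp ℂ 2 (volume : Measure (Conf d))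

/-- `f(t,x,ξ)` is a real polynomial of degree at most `2` in `(x,ξ)`, whose coefficients are
continuously differentiable functions of `t`. -/
def IsQuadraticFamily {d : ℕ} (f : ℝ → Conf d → Conf d → ℝ) : Prop :=
  ∃ (A B C : ℝ → Fin d → Fin d → ℝ) (a b : ℝ → Fin d → ℝ) (c : ℝ → ℝ),
    (∀ i j, ContDiff ℝ 1 (fun t => A t i j)) ∧
    (∀ i j, ContDiff ℝ 1 (fun t => B t i j)) ∧
    (∀ i j, ContDiff ℝ 1 (fun t => C t i j)) ∧
    (∀ i, ContDiff ℝ 1 (fun t => a t i)) ∧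
    (∀ i, ContDiff ℝ 1 (fun t => b t i)) ∧
    ContDiff ℝ 1 c ∧
    ∀ t x ξ, f t x ξ =
      (∑ i, ∑ j, A t i j * x i * x j) + (∑ i, ∑ j, B t i j * x i * ξ j)
        + (∑ i, ∑ j, C t i j * ξ i * ξ j) + (∑ i, a t i * x i) + (∑ i, b t i * ξ i) + c t

/-- Smooth real symbols on phase space all of whose derivatives are `O((1 + |(x,ξ)|)^m)`
for one common exponent `m`. Polynomials are examples. -/
def IsSymbol {d : ℕ} (a : Conf d → Conf d → ℝ) : Prop :=
  ContDiff ℝ ∞ (fun z : Conf d × Conf d => a z.1 z.2) ∧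
  ∃ m : ℕ, ∀ k : ℕ, ∃ K : ℝ, ∀ z : Conf d × Conf d,
    ‖iteratedFDeriv ℝ k (fun z : Conf d × Conf d => a z.1 z.2) z‖ ≤ K * (1 + ‖z‖) ^ m

/-- The Weyl quantization
`Op^w(a) u (x) = (2π)^{-d} ∫ ( ∫ e^{i (x-y)·ξ} a((x+y)/2, ξ) u(y) dy ) dξ`.
For a symbol `a` in the sense of `IsSymbol` and a Schwartz function `u` both integrals, taken in
this order, converge absolutely. -/
def weylOp {d : ℕ} (a : Conf d → Conf d → ℝ) (u : Conf d → ℂ) (x : Conf d) : ℂ :=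
  ((2 * Real.pi) ^ d : ℝ)⁻¹ *
    ∫ ξ : Conf d, ∫ y : Conf d,
      Complex.exp (Complex.I * (inner ℝ (x - y) ξ : ℝ)) *
        (a ((1 / 2 : ℝ) • (x + y)) ξ : ℂ) * u y

/-- `X t κ z` is the flow, at parameter `κ` and started at `z`, of Hamilton's equations
`dx/dκ = ∂f/∂ξ (t,x,ξ)`, `dξ/dκ = -∂f/∂x (t,x,ξ)`, with `t` a frozen external parameter. -/
def IsHamiltonianFlow {d : ℕ} (f : ℝ → Conf d → Conf d → ℝ)
    (X : ℝ → ℝ → Conf d × Conf d → Conf d × Conf d) : Prop :=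
  ∀ t z, X t 0 z = z ∧ ∀ κ : ℝ,
    HasDerivAt (fun s => (X t s z).1)
      (gradient (fun ξ => f t (X t κ z).1 ξ) (X t κ z).2) κ ∧
    HasDerivAt (fun s => (X t s z).2)
      (-gradient (fun x => f t x (X t κ z).2) (X t κ z).1) κ

/-- The time-dependent canonical transformation `(x',ξ') = φ(t,x,ξ)`, where `φ(t,·)` is the
time-one flow of `f(t,·)`, transforms the classical Hamiltonian `h` into `h'`:
`h'(t,z) = h(t, φ(t,z)) - ∫₀¹ (∂f/∂t)(t, X^κ(t,z)) dκ`. -/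
def ClassicalTransforms {d : ℕ} (f h h' : ℝ → Conf d → Conf d → ℝ) : Prop :=
  ∃ X : ℝ → ℝ → Conf d × Conf d → Conf d × Conf d, IsHamiltonianFlow f X ∧
    ∀ t x ξ, h' t x ξ = h t (X t 1 (x, ξ)).1 (X t 1 (x, ξ)).2
      - ∫ κ in (0 : ℝ)..1, deriv (fun s => f s (X t κ (x, ξ)).1 (X t κ (x, ξ)).2) t

/-- `V κ = exp (-i κ a^w(x,D))`: `V` is a strongly continuous one-parameter group of unitary
operators of `L²(ℝᵈ)`, and its infinitesimal generator equals `-i a^w(x,D)` on Schwartz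
functions. -/
def IsWeylExp {d : ℕ} (a : Conf d → Conf d → ℝ) (V : ℝ → (L2 d ≃ₗᵢ[ℂ] L2 d)) : Prop :=
  (∀ κ κ' u, V (κ + κ') u = V κ (V κ' u)) ∧
  (∀ u, Continuous fun κ => V κ u) ∧
  ∀ u : 𝓢(Conf d, ℂ), ∃ w : L2 d, w =ᵐ[volume] weylOp a u ∧
    HasDerivAt (fun κ => V κ (u.toLp 2 volume)) (-Complex.I • w) 0

/-- `ψ ∈ C(ℝ; L²(ℝᵈ))` is a weak solution of `i ∂ψ/∂t = h^w(t,x,D) ψ`: for every Schwartz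
function `v`, the function `t ↦ ⟨v, ψ(t)⟩` is everywhere differentiable, and
`i d/dt ⟨v, ψ(t)⟩ = ⟨h^w(t,x,D) v, ψ(t)⟩`. (For real `h`, the operator `h^w` is symmetric.) -/
def IsSchrodingerSolution {d : ℕ} (h : ℝ → Conf d → Conf d → ℝ) (ψ : ℝ → L2 d) : Prop :=
  Continuous ψ ∧ ∀ (v : 𝓢(Conf d, ℂ)) (t : ℝ),
    HasDerivAt (fun s => ∫ x, starRingEnd ℂ (v x) * ψ s x)
      (-Complex.I * ∫ x, starRingEnd ℂ (weylOp (h t) v x) * ψ t x) t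

end

/-!
The proof rests on the parity operators `Π_z`, the unitary reflections about the points `z` of phase
space. The matrix elements of a Weyl operator are averages of parity operators,
`⟨v, a^w u⟩ = π⁻ᵈ ∫ a(z) ⟨v, Π_z u⟩ dz` (`IsSymbolOfOrder.integral_conj_mul_weylOp`), so statements
about general symbols reduce to statements about the `Π_z`.

*The unitary groups.* For a quadratic Hamiltonian the Schrödinger equation is solved for short times,
within the Schwartz space, by a Fourier multiplier followed by a linear substitution and a
multiplication with a Gaussian phase, whose parameters solve a Riccati equation
(`exists_local_propagator`). Weyl operators of real symbols are symmetric, hence solutions with values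
in the Schwartz space are unique and preserve norms; so the short-time propagators satisfy the group
law and generate a one-parameter group of the Schwartz space
(`IsSymbolOfOrder.exists_isSchwartzExp`), which extends to `L²`. A unitary group with the same
generator on Schwartz functions agrees with it there, which gives uniqueness (`IsWeylExp.unique`).

*Exact conjugation.* A quadratic polynomial reflected about `z` differs from itself by an affine
function, and the Weyl operator of this function is exactly the one that describes the motion of `Π_z`
when `z` moves along the Hamiltonian vector field (`QuadPoly.eval_reflect`, `hasDerivAt_parity`).
Therefore `⟨v, Π_z u⟩` is constant if `v` and `u` evolve by the quadratic Hamiltonian and `z` by its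
flow (`crossWigner_flow`). With the formula above this is Egorov's theorem without remainder,
`a^w V_κ = V_κ (a ∘ X^κ)^w` (`IsWeylExp.apply_weylLp`).

*Time dependence.* Duhamel's formula, with Egorov's theorem applied to its integrand, yields
`d/dt e^{-i f_t^w} v = -i e^{-i f_t^w} (∫₀¹ ∂_t f ∘ X^κ dκ)^w v` on Schwartz functions
(`hasDerivAt_weylExp`). The limit under the integral sign is unproblematic, as quadratic polynomials
form a finite-dimensional space.

The transformation of the Schrödinger equation is then the product rule for `⟨e^{-i f_t^w} v, ψ(t)⟩`,
where the first factor is strongly and the second weakly differentiable (`hasDerivAt_inner_of_weak`):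
the first contributes the average of `∂_t f`, the second `h ∘ φ` by Egorov's theorem. The converse
uses the inverse operators in the same way (`hasDerivAt_isometry_symm`).
-/

noncomputable section

/-! ### Symbols of a given order -/

/-- Symbols of order `m`: smooth functions on phase space all of whose derivatives are
`O((1 + |z|) ^ m)`. -/
def IsSymbolOfOrder {d : ℕ} (m : ℕ) (a : Conf d → Conf d → ℝ) : Prop :=
  ContDiff ℝ ∞ (fun z : Conf d × Conf d => a z.1 z.2) ∧
  ∀ k : ℕ, ∃ K : ℝ, ∀ z : Conf d × Conf d,
    ‖iteratedFDeriv ℝ k (fun z : Conf d × Conf d => a z.1 z.2) z‖ ≤ K * (1 + ‖z‖) ^ m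

theorem isSymbol_iff_exists_order {d : ℕ} {a : Conf d → Conf d → ℝ} :
    IsSymbol a ↔ ∃ m, IsSymbolOfOrder m a :=
  ⟨fun ⟨h, m, hm⟩ => ⟨m, h, hm⟩, fun ⟨m, h, hm⟩ => ⟨h, m, hm⟩⟩

namespace IsSymbolOfOrder

variable {d m : ℕ} {a b : Conf d → Conf d → ℝ}

theorem contDiff (ha : IsSymbolOfOrder m a) :
    ContDiff ℝ ∞ (fun z : Conf d × Conf d => a z.1 z.2) := ha.1

theorem continuous (ha : IsSymbolOfOrder m a) :
    Continuous (fun z : Conf d × Conf d => a z.1 z.2) := ha.1.continuous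

theorem differentiable (ha : IsSymbolOfOrder m a) :
    Differentiable ℝ (fun z : Conf d × Conf d => a z.1 z.2) :=
  ha.1.differentiable (by simp)

/-- The derivative of `a` in the phase space direction `w`. -/
def _root_.symbolDeriv (w : Conf d × Conf d) (a : Conf d → Conf d → ℝ) : Conf d → Conf d → ℝ :=
  fun x ξ => fderiv ℝ (fun z : Conf d × Conf d => a z.1 z.2) (x, ξ) w

theorem deriv (ha : IsSymbolOfOrder m a) (w : Conf d × Conf d) :
    IsSymbolOfOrder m (symbolDeriv w a) := by
  have h1 : ContDiff ℝ ∞ (fderiv ℝ (fun z : Conf d × Conf d => a z.1 z.2)) :=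
    ha.1.fderiv_right (by simp)
  refine ⟨h1.clm_apply contDiff_const, fun k => ?_⟩
  obtain ⟨K, hK⟩ := ha.2 (k + 1)
  refine ⟨‖w‖ * K, fun z => ?_⟩
  refine (norm_iteratedFDeriv_clm_apply_const (c := w) (h1.contDiffAt (x := z)) (n := k)
    (by exact_mod_cast le_top)).trans ?_
  rw [mul_assoc, norm_iteratedFDeriv_fderiv]
  exact mul_le_mul_of_nonneg_left (hK z) (norm_nonneg _)

theorem norm_le (ha : IsSymbolOfOrder m a) :
    ∃ K : ℝ, 0 ≤ K ∧ ∀ x ξ, ‖a x ξ‖ ≤ K * (1 + ‖x‖) ^ m * (1 + ‖ξ‖) ^ m := by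
  obtain ⟨K, hK⟩ := ha.2 0
  have hK0 : 0 ≤ K := by
    have := (norm_nonneg _).trans (hK 0)
    simpa using this
  refine ⟨K, hK0, fun x ξ => ?_⟩
  have := hK (x, ξ)
  rw [norm_iteratedFDeriv_zero] at this
  refine this.trans ?_
  rw [mul_assoc, ← mul_pow]
  gcongr
  have : ‖((x, ξ) : Conf d × Conf d)‖ ≤ ‖x‖ + ‖ξ‖ := by
    rw [Prod.norm_def]; exact max_le_add_of_nonneg (norm_nonneg _) (norm_nonneg _)
  nlinarith [norm_nonneg x, norm_nonneg ξ]

theorem add (ha : IsSymbolOfOrder m a) (hb : IsSymbolOfOrder m b) :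
    IsSymbolOfOrder m (fun x ξ => a x ξ + b x ξ) := by
  refine ⟨ha.1.add hb.1, fun k => ?_⟩
  obtain ⟨K, hK⟩ := ha.2 k
  obtain ⟨K', hK'⟩ := hb.2 k
  refine ⟨K + K', fun z => ?_⟩
  have := iteratedFDeriv_add_apply (x := z) (ha.1.of_le (by exact_mod_cast le_top) : ContDiff ℝ k _).contDiffAt
    (hb.1.of_le (by exact_mod_cast le_top) : ContDiff ℝ k _).contDiffAt
  have h2 : (fun z : Conf d × Conf d => a z.1 z.2 + b z.1 z.2)
    = (fun z : Conf d × Conf d => a z.1 z.2) + (fun z : Conf d × Conf d => b z.1 z.2) := rfl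
  rw [h2, this, add_mul]
  exact (norm_add_le _ _).trans (add_le_add (hK z) (hK' z))

theorem const_mul (ha : IsSymbolOfOrder m a) (c : ℝ) :
    IsSymbolOfOrder m (fun x ξ => c * a x ξ) := by
  refine ⟨contDiff_const.mul ha.1, fun k => ?_⟩
  obtain ⟨K, hK⟩ := ha.2 k
  refine ⟨|c| * K, fun z => ?_⟩
  have := iteratedFDeriv_const_smul_apply (x := z) (a := c)
    (ha.1.of_le (by exact_mod_cast le_top) : ContDiff ℝ k _).contDiffAt
  have h2 : (fun z : Conf d × Conf d => c * a z.1 z.2)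
    = c • (fun z : Conf d × Conf d => a z.1 z.2) := rfl
  rw [h2, this, norm_smul, mul_assoc]
  exact mul_le_mul_of_nonneg_left (hK z) (norm_nonneg _)

theorem mono (ha : IsSymbolOfOrder m a) {n : ℕ} (h : m ≤ n) : IsSymbolOfOrder n a := by
  refine ⟨ha.1, fun k => ?_⟩
  obtain ⟨K, hK⟩ := ha.2 k
  have hK0 : 0 ≤ K := by simpa using (norm_nonneg _).trans (hK 0)
  refine ⟨K, fun z => (hK z).trans ?_⟩
  gcongr
  linarith [norm_nonneg z]

end IsSymbolOfOrder

/-! ### The inner integral of the Weyl quantization -/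

/-- A function with integrable line derivative in direction `v` integrates that derivative to
zero. -/
theorem integral_fderiv_apply_eq_zero {E : Type*} [NormedAddCommGroup E] [NormedSpace ℝ E]
    [MeasurableSpace E] [BorelSpace E] [FiniteDimensional ℝ E] {μ : Measure E}
    [μ.IsAddHaarMeasure] {f : E → ℂ} {f' : E → E →L[ℝ] ℂ} {v : E}
    (hf : ∀ x, HasFDerivAt f (f' x) x) (hi : Integrable f μ)
    (hi' : Integrable (fun x => f' x v) μ) : ∫ x, f' x v ∂μ = 0 := by
  have := integral_bilinear_hasFDerivAt_right_eq_neg_left_of_integrable (μ := μ) (f := f)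
    (f' := f') (g := fun _ => (1 : ℂ)) (g' := fun _ => 0) (v := v)
    (B := ContinuousLinearMap.mul ℝ ℂ) (by simpa using hi') (by simp) (by simpa using hi)
    (fun x _ => hf x) (fun x _ => hasFDerivAt_const _ _)
  simpa using this.symm

theorem SchwartzMap.integrable_one_add_norm_pow_mul {d : ℕ} (u : 𝓢(Conf d, ℂ)) (k : ℕ) :
    Integrable (fun x => (1 + ‖x‖) ^ k * ‖u x‖) := by
  have : (fun x => (1 + ‖x‖) ^ k * ‖u x‖)
      = fun x => ∑ j ∈ Finset.range (k + 1), (k.choose j : ℝ) * (‖x‖ ^ (k - j) * ‖u x‖) := by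
    ext x
    rw [add_pow, Finset.sum_mul]
    exact Finset.sum_congr rfl fun j _ => by simp; ring
  rw [this]
  exact integrable_finsetSum _ fun j _ => (u.integrable_pow_mul _ _).const_mul _

theorem SchwartzMap.exists_one_add_norm_pow_mul_le {d : ℕ} (u : 𝓢(Conf d, ℂ)) (k : ℕ) :
    ∃ C, 0 ≤ C ∧ ∀ x, (1 + ‖x‖) ^ k * ‖u x‖ ≤ C := by
  have h := u.one_add_le_sup_seminorm_apply (𝕜 := ℂ) (m := (k, 0)) (k := k) (n := 0) le_rfl le_rfl
  simp only [norm_iteratedFDeriv_zero] at h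
  exact ⟨_, le_trans (by positivity) (h 0), h⟩

theorem integrable_one_add_norm_neg_pow (d : ℕ) :
    Integrable (fun x : Conf d => ((1 + ‖x‖) ^ (d + 1))⁻¹) := by
  have := integrable_one_add_norm (E := Conf d) (μ := volume) (r := (d + 1 : ℕ)) (by simp)
  refine this.congr (Filter.Eventually.of_forall fun x => ?_)
  simp only
  rw [Real.rpow_neg (by positivity), Real.rpow_natCast]

/-- The inner integral in the definition of the Weyl quantization. -/
def weylInner {d : ℕ} (a : Conf d → Conf d → ℝ) (u : Conf d → ℂ) (x ξ : Conf d) : ℂ :=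
  ∫ y : Conf d, Complex.exp (Complex.I * (inner ℝ (x - y) ξ : ℝ)) *
        (a ((1 / 2 : ℝ) • (x + y)) ξ : ℂ) * u y

theorem norm_exp_I_mul_ofReal_eq_one (r : ℝ) : ‖Complex.exp (Complex.I * (r : ℂ))‖ = 1 := by
  rw [mul_comm]; exact Complex.norm_exp_ofReal_mul_I r

section WeylInner

variable {d m : ℕ} {a b : Conf d → Conf d → ℝ}

/-- The symbol at the midpoint is bounded by a product of powers of `1 + ‖x‖`, `1 + ‖ξ‖` and
`1 + ‖y‖`, so that the factor depending on `y` can be absorbed by a Schwartz function. -/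
theorem IsSymbolOfOrder.norm_midpoint_le (ha : IsSymbolOfOrder m a) :
    ∃ K : ℝ, 0 ≤ K ∧ ∀ x y ξ, ‖a ((1 / 2 : ℝ) • (x + y)) ξ‖
      ≤ K * (1 + ‖x‖) ^ m * (1 + ‖ξ‖) ^ m * (1 + ‖y‖) ^ m := by
  obtain ⟨K, hK0, hK⟩ := ha.norm_le
  refine ⟨K, hK0, fun x y ξ => (hK _ _).trans ?_⟩
  have : 1 + ‖(1 / 2 : ℝ) • (x + y)‖ ≤ (1 + ‖x‖) * (1 + ‖y‖) := by
    rw [norm_smul]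
    have := norm_add_le x y
    norm_num
    nlinarith [norm_nonneg x, norm_nonneg y]
  calc K * (1 + ‖(1 / 2 : ℝ) • (x + y)‖) ^ m * (1 + ‖ξ‖) ^ m
      ≤ K * ((1 + ‖x‖) * (1 + ‖y‖)) ^ m * (1 + ‖ξ‖) ^ m := by gcongr
    _ = _ := by rw [mul_pow]; ring

theorem IsSymbolOfOrder.continuous_weylIntegrand (ha : IsSymbolOfOrder m a) (u : 𝓢(Conf d, ℂ)) :
    Continuous (fun p : (Conf d × Conf d) × Conf d =>
      Complex.exp (Complex.I * (inner ℝ (p.1.1 - p.2) p.1.2 : ℝ)) *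
        (a ((1 / 2 : ℝ) • (p.1.1 + p.2)) p.1.2 : ℂ) * u p.2) := by
  have h1 : Continuous (fun p : (Conf d × Conf d) × Conf d =>
      a ((1 / 2 : ℝ) • (p.1.1 + p.2)) p.1.2) :=
    ha.continuous.comp (f := fun p : (Conf d × Conf d) × Conf d =>
      ((1 / 2 : ℝ) • (p.1.1 + p.2), p.1.2)) (by fun_prop)
  have h2 : Continuous (fun p : (Conf d × Conf d) × Conf d => u p.2) :=
    u.continuous.comp continuous_snd
  refine ((Complex.continuous_exp.comp (f := fun p : (Conf d × Conf d) × Conf d =>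
    Complex.I * (inner ℝ (p.1.1 - p.2) p.1.2 : ℝ)) ?_).mul
      (Complex.continuous_ofReal.comp h1)).mul h2
  exact continuous_const.mul (Complex.continuous_ofReal.comp (by fun_prop))

theorem IsSymbolOfOrder.integrable_weylIntegrand (ha : IsSymbolOfOrder m a) (u : 𝓢(Conf d, ℂ))
    (x ξ : Conf d) : Integrable (fun y => Complex.exp (Complex.I * (inner ℝ (x - y) ξ : ℝ)) *
        (a ((1 / 2 : ℝ) • (x + y)) ξ : ℂ) * u y) := by
  obtain ⟨K, hK0, hK⟩ := ha.norm_midpoint_le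
  refine ((u.integrable_one_add_norm_pow_mul m).const_mul
    (K * (1 + ‖x‖) ^ m * (1 + ‖ξ‖) ^ m)).mono' ?_ (Filter.Eventually.of_forall fun y => ?_)
  · exact ((ha.continuous_weylIntegrand u).comp (f := fun y => ((x, ξ), y))
      (by fun_prop)).aestronglyMeasurable
  · rw [norm_mul, norm_mul, norm_exp_I_mul_ofReal_eq_one, one_mul, Complex.norm_real, ← mul_assoc]
    exact mul_le_mul_of_nonneg_right (hK x y ξ) (norm_nonneg _)

theorem IsSymbolOfOrder.stronglyMeasurable_weylInner (ha : IsSymbolOfOrder m a)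
    (u : 𝓢(Conf d, ℂ)) :
    StronglyMeasurable (fun p : Conf d × Conf d => weylInner a u p.1 p.2) :=
  (ha.continuous_weylIntegrand u).stronglyMeasurable.integral_prod_right'

theorem IsSymbolOfOrder.norm_weylInner_le (ha : IsSymbolOfOrder m a) (u : 𝓢(Conf d, ℂ)) :
    ∃ C, 0 ≤ C ∧ ∀ x ξ, ‖weylInner a u x ξ‖ ≤ C * (1 + ‖x‖) ^ m * (1 + ‖ξ‖) ^ m := by
  obtain ⟨K, hK0, hK⟩ := ha.norm_midpoint_le
  refine ⟨K * ∫ y, (1 + ‖y‖) ^ m * ‖u y‖, by positivity, fun x ξ => ?_⟩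
  refine (norm_integral_le_of_norm_le ((u.integrable_one_add_norm_pow_mul m).const_mul
    (K * (1 + ‖x‖) ^ m * (1 + ‖ξ‖) ^ m)) (Filter.Eventually.of_forall fun y => ?_)).trans ?_
  · rw [norm_mul, norm_mul, norm_exp_I_mul_ofReal_eq_one, one_mul, Complex.norm_real, ← mul_assoc]
    exact mul_le_mul_of_nonneg_right (hK x y ξ) (norm_nonneg _)
  · rw [integral_const_mul]
    exact le_of_eq (by ring)

theorem weylInner_add_symbol (ha : IsSymbolOfOrder m a) (hb : IsSymbolOfOrder m b)
    (u : 𝓢(Conf d, ℂ)) (x ξ : Conf d) :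
    weylInner (fun x ξ => a x ξ + b x ξ) u x ξ = weylInner a u x ξ + weylInner b u x ξ := by
  unfold weylInner
  rw [← integral_add (ha.integrable_weylIntegrand u x ξ) (hb.integrable_weylIntegrand u x ξ)]
  congr 1; ext y; push_cast; ring

theorem weylInner_const_mul_symbol (c : ℝ) (a : Conf d → Conf d → ℝ) (u : Conf d → ℂ)
    (x ξ : Conf d) :
    weylInner (fun x ξ => c * a x ξ) u x ξ = c * weylInner a u x ξ := by
  unfold weylInner
  rw [← integral_const_mul]
  congr 1; ext y; push_cast; ring

open LineDeriv in
/-- Integration by parts in `y` trades a factor `⟨ξ, h⟩` for derivatives of the symbol and of the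
function. -/
theorem IsSymbolOfOrder.inner_mul_weylInner (ha : IsSymbolOfOrder m a) (u : 𝓢(Conf d, ℂ))
    (h x ξ : Conf d) :
    (inner ℝ ξ h : ℝ) * weylInner a u x ξ
      = -Complex.I * ((1 / 2) * weylInner (symbolDeriv (h, 0) a) u x ξ
          + weylInner a (∂_{h} u : 𝓢(Conf d, ℂ)) x ξ) := by
  let F : Conf d → ℂ := fun y => Complex.exp (Complex.I * (inner ℝ (x - y) ξ : ℝ)) *
        (a ((1 / 2 : ℝ) • (x + y)) ξ : ℂ) * u y
  let F' : Conf d → Conf d →L[ℝ] ℂ := fderiv ℝ F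
  have hA : ∀ y, HasFDerivAt (fun y : Conf d => a ((1 / 2 : ℝ) • (x + y)) ξ)
      ((fderiv ℝ (fun z : Conf d × Conf d => a z.1 z.2) ((1 / 2 : ℝ) • (x + y), ξ)).comp
        (((1 / 2 : ℝ) • ContinuousLinearMap.id ℝ (Conf d)).prod 0)) y := by
    intro y
    have h1 := (ha.differentiable ((1 / 2 : ℝ) • (x + y), ξ)).hasFDerivAt
    refine h1.comp (f := fun y : Conf d => ((1 / 2 : ℝ) • (x + y), ξ)) y ?_
    refine HasFDerivAt.prodMk ?_ (hasFDerivAt_const _ _)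
    exact ((hasFDerivAt_id y).const_add x).const_smul (1 / 2 : ℝ)
  have hE : ∀ y, HasFDerivAt (fun y : Conf d => Complex.exp (Complex.I * (inner ℝ (x - y) ξ : ℝ)))
      ((Complex.exp (Complex.I * (inner ℝ (x - y) ξ : ℝ))) •
        (-Complex.I • (Complex.ofRealCLM.comp (innerSL ℝ ξ)))) y := by
    intro y
    have h1 : HasFDerivAt (fun y : Conf d => ((inner ℝ (x - y) ξ : ℝ)))
        (-(innerSL ℝ ξ)) y := by
      have := ((innerSL ℝ ξ).hasFDerivAt (x := x - y)).comp y ((hasFDerivAt_id y).const_sub x)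
      refine (this.congr_of_eventuallyEq (Filter.Eventually.of_forall fun y => ?_)).congr_fderiv ?_
      · simp [real_inner_comm]
      · ext; simp
    have h2 := ((Complex.ofRealCLM.hasFDerivAt.comp y h1).const_mul Complex.I).cexp
    refine h2.congr_fderiv ?_
    ext; simp
  have hF : ∀ y, HasFDerivAt F _ y := fun y =>
    ((hE y).mul (Complex.ofRealCLM.hasFDerivAt.comp y (hA y))).mul (u.hasFDerivAt y)
  have key : ∀ y, F' y h = -Complex.I * (inner ℝ ξ h : ℝ) * (Complex.exp (Complex.I * (inner ℝ (x - y) ξ : ℝ)) *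
        (a ((1 / 2 : ℝ) • (x + y)) ξ : ℂ) * u y)
      + (1 / 2) * (Complex.exp (Complex.I * (inner ℝ (x - y) ξ : ℝ)) *
        (symbolDeriv (h, 0) a ((1 / 2 : ℝ) • (x + y)) ξ : ℂ) * u y)
      + Complex.exp (Complex.I * (inner ℝ (x - y) ξ : ℝ)) *
        (a ((1 / 2 : ℝ) • (x + y)) ξ : ℂ) * (∂_{h} u : 𝓢(Conf d, ℂ)) y := by
    intro y
    simp only [F', (hF y).fderiv, F]
    simp [symbolDeriv, SchwartzMap.lineDerivOp_apply_eq_fderiv]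
    rw [show ((2⁻¹ : ℝ) • h, (0 : Conf d)) = (2⁻¹ : ℝ) • ((h, 0) : Conf d × Conf d) by simp, map_smul]
    simp
    ring
  have i1 := ha.integrable_weylIntegrand u x ξ
  have i2 := (ha.deriv (h, 0)).integrable_weylIntegrand u x ξ
  have i3 := ha.integrable_weylIntegrand (∂_{h} u : 𝓢(Conf d, ℂ)) x ξ
  have hz := integral_fderiv_apply_eq_zero (μ := volume) (v := h)
    (fun y => (hF y).differentiableAt.hasFDerivAt) i1 (by
      refine Integrable.congr (((i1.const_mul (-Complex.I * (inner ℝ ξ h : ℝ))).add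
        (i2.const_mul (1 / 2))).add i3) (Filter.Eventually.of_forall fun y => ?_)
      exact (key y).symm)
  have hz2 : ∫ y, F' y h = 0 := hz
  simp_rw [key] at hz2
  have s1 := integral_add ((i1.const_mul (-Complex.I * (inner ℝ ξ h : ℝ))).add
    (i2.const_mul (1 / 2))) i3
  have s2 := integral_add (i1.const_mul (-Complex.I * (inner ℝ ξ h : ℝ))) (i2.const_mul (1 / 2))
  simp only [Pi.add_apply] at s1
  rw [s1, s2, integral_const_mul, integral_const_mul] at hz2
  change -Complex.I * (inner ℝ ξ h : ℝ) * weylInner a u x ξ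
    + 1 / 2 * weylInner (symbolDeriv (h, 0) a) u x ξ
    + weylInner a (∂_{h} u : 𝓢(Conf d, ℂ)) x ξ = 0 at hz2
  linear_combination (Complex.I) * hz2 + (inner ℝ ξ h : ℝ) * weylInner a u x ξ * Complex.I_sq

end WeylInner

/-! ### Decay of Weyl operators applied to Schwartz functions -/

theorem Conf.norm_le_sum_abs_inner {d : ℕ} (ξ : Conf d) :
    ‖ξ‖ ≤ ∑ i, |(inner ℝ ξ (EuclideanSpace.basisFun (Fin d) ℝ i) : ℝ)| := by
  have := (EuclideanSpace.basisFun (Fin d) ℝ).sum_repr' ξ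
  conv_lhs => rw [← this]
  refine (norm_sum_le _ _).trans (Finset.sum_le_sum fun i _ => ?_)
  rw [norm_smul, (EuclideanSpace.basisFun (Fin d) ℝ).norm_eq_one, mul_one, real_inner_comm,
    Real.norm_eq_abs]

/-- Multiplication of a Schwartz function by the coordinate `⟨·, h⟩`. -/
def SchwartzMap.posMul {d : ℕ} (h : Conf d) (u : 𝓢(Conf d, ℂ)) : 𝓢(Conf d, ℂ) :=
  SchwartzMap.smulLeftCLM ℂ (fun y : Conf d => (inner ℝ y h : ℝ)) u

theorem SchwartzMap.posMul_apply {d : ℕ} (h : Conf d) (u : 𝓢(Conf d, ℂ)) (y : Conf d) :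
    u.posMul h y = (inner ℝ y h : ℝ) * u y := by
  rw [SchwartzMap.posMul, SchwartzMap.smulLeftCLM_apply_apply (by fun_prop)]
  simp

section WeylInner

variable {d m : ℕ} {a b : Conf d → Conf d → ℝ}

open LineDeriv in
/-- Each power of `1 + ‖ξ‖` is traded, by integration by parts in `y`, for one derivative of the
symbol or of the function. Differentiation keeps the order `m` of the symbol, so the loss
`(1 + ‖ξ‖)^m` does not grow with `k`. -/
theorem IsSymbolOfOrder.pow_mul_norm_weylInner_le_aux (k : ℕ) :
    ∀ {a : Conf d → Conf d → ℝ}, IsSymbolOfOrder m a → ∀ u : 𝓢(Conf d, ℂ),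
    ∃ C, 0 ≤ C ∧ ∀ x ξ, (1 + ‖ξ‖) ^ k * ‖weylInner a u x ξ‖
      ≤ C * (1 + ‖x‖) ^ m * (1 + ‖ξ‖) ^ m := by
  induction k with
  | zero => intro a ha u; simpa using ha.norm_weylInner_le u
  | succ k ih =>
    intro a ha u
    let e := EuclideanSpace.basisFun (Fin d) ℝ
    obtain ⟨C, hC0, hC⟩ := ih ha u
    choose C1 hC10 hC1 using fun i => ih (ha.deriv (e i, 0)) u
    choose C2 hC20 hC2 using fun i => ih ha (∂_{e i} u : 𝓢(Conf d, ℂ))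
    refine ⟨C + ∑ i, (C1 i + C2 i), add_nonneg hC0 (Finset.sum_nonneg fun i _ =>
      add_nonneg (hC10 i) (hC20 i)), fun x ξ => ?_⟩
    have h1 : ∀ i, |(inner ℝ ξ (e i) : ℝ)| * ‖weylInner a u x ξ‖
        ≤ ‖weylInner (symbolDeriv (e i, 0) a) u x ξ‖
          + ‖weylInner a (∂_{e i} u : 𝓢(Conf d, ℂ)) x ξ‖ := fun i => by
      have := congrArg norm (ha.inner_mul_weylInner u (e i) x ξ)
      rw [norm_mul, Complex.norm_real, Real.norm_eq_abs] at this
      rw [this, norm_mul]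
      simp only [norm_neg, Complex.norm_I, one_mul]
      refine (norm_add_le _ _).trans (add_le_add ?_ le_rfl)
      rw [norm_mul]
      refine mul_le_of_le_one_left (norm_nonneg _) ?_
      norm_num
    calc (1 + ‖ξ‖) ^ (k + 1) * ‖weylInner a u x ξ‖
        = (1 + ‖ξ‖) ^ k * ((1 + ‖ξ‖) * ‖weylInner a u x ξ‖) := by ring
      _ ≤ (1 + ‖ξ‖) ^ k * (‖weylInner a u x ξ‖
          + ∑ i, (‖weylInner (symbolDeriv (e i, 0) a) u x ξ‖
            + ‖weylInner a (∂_{e i} u : 𝓢(Conf d, ℂ)) x ξ‖)) := by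
        gcongr
        rw [add_mul, one_mul]
        gcongr
        calc ‖ξ‖ * ‖weylInner a u x ξ‖ ≤ (∑ i, |(inner ℝ ξ (e i) : ℝ)|) * ‖weylInner a u x ξ‖ := by
              gcongr; exact Conf.norm_le_sum_abs_inner ξ
          _ ≤ _ := by rw [Finset.sum_mul]; exact Finset.sum_le_sum fun i _ => h1 i
      _ = (1 + ‖ξ‖) ^ k * ‖weylInner a u x ξ‖
          + ∑ i, ((1 + ‖ξ‖) ^ k * ‖weylInner (symbolDeriv (e i, 0) a) u x ξ‖
            + (1 + ‖ξ‖) ^ k * ‖weylInner a (∂_{e i} u : 𝓢(Conf d, ℂ)) x ξ‖) := by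
        rw [mul_add, Finset.mul_sum]; simp only [mul_add]
      _ ≤ C * (1 + ‖x‖) ^ m * (1 + ‖ξ‖) ^ m
          + ∑ i, (C1 i * (1 + ‖x‖) ^ m * (1 + ‖ξ‖) ^ m
            + C2 i * (1 + ‖x‖) ^ m * (1 + ‖ξ‖) ^ m) :=
        add_le_add (hC x ξ) (Finset.sum_le_sum fun i _ => add_le_add (hC1 i x ξ) (hC2 i x ξ))
      _ = _ := by simp only [← add_mul]; rw [← Finset.sum_mul, ← Finset.sum_mul]; ring

/-- The inner integral decays rapidly in `ξ`, which makes the outer one converge. -/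
theorem IsSymbolOfOrder.pow_mul_norm_weylInner_le (ha : IsSymbolOfOrder m a) (u : 𝓢(Conf d, ℂ))
    (k : ℕ) : ∃ C, 0 ≤ C ∧ ∀ x ξ, ‖weylInner a u x ξ‖ ≤ C * (1 + ‖x‖) ^ m * ((1 + ‖ξ‖) ^ k)⁻¹ := by
  obtain ⟨C, hC0, hC⟩ := IsSymbolOfOrder.pow_mul_norm_weylInner_le_aux (k + m) ha u
  refine ⟨C, hC0, fun x ξ => ?_⟩
  have := hC x ξ
  rw [← div_eq_mul_inv, le_div_iff₀ (by positivity)]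
  rw [pow_add] at this
  have h2 : (0 : ℝ) < (1 + ‖ξ‖) ^ m := by positivity
  nlinarith

theorem IsSymbolOfOrder.integrable_weylInner (ha : IsSymbolOfOrder m a) (u : 𝓢(Conf d, ℂ))
    (x : Conf d) : Integrable (fun ξ => weylInner a u x ξ) := by
  obtain ⟨C, hC0, hC⟩ := ha.pow_mul_norm_weylInner_le u (d + 1)
  refine ((integrable_one_add_norm_neg_pow d).const_mul (C * (1 + ‖x‖) ^ m)).mono' ?_
    (Filter.Eventually.of_forall fun ξ => hC x ξ)
  exact ((ha.stronglyMeasurable_weylInner u).comp_measurable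
    (measurable_prodMk_left (x := x))).aestronglyMeasurable

theorem weylOp_eq_integral_weylInner (a : Conf d → Conf d → ℝ) (u : Conf d → ℂ) (x : Conf d) :
    weylOp a u x = ((2 * Real.pi) ^ d : ℝ)⁻¹ * ∫ ξ, weylInner a u x ξ := rfl

theorem weylOp_add_symbol (ha : IsSymbolOfOrder m a) (hb : IsSymbolOfOrder m b)
    (u : 𝓢(Conf d, ℂ)) (x : Conf d) :
    weylOp (fun x ξ => a x ξ + b x ξ) u x = weylOp a u x + weylOp b u x := by
  simp only [weylOp_eq_integral_weylInner]
  rw [← mul_add, ← integral_add (ha.integrable_weylInner u x) (hb.integrable_weylInner u x)]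
  simp only [weylInner_add_symbol ha hb]

theorem weylOp_const_mul_symbol (c : ℝ) (a : Conf d → Conf d → ℝ) (u : Conf d → ℂ) (x : Conf d) :
    weylOp (fun x ξ => c * a x ξ) u x = c * weylOp a u x := by
  simp only [weylOp_eq_integral_weylInner, weylInner_const_mul_symbol, integral_const_mul]
  ring

theorem weylOp_sum_symbol {ι : Type*} (s : Finset ι) {a : ι → Conf d → Conf d → ℝ}
    (ha : ∀ i ∈ s, IsSymbolOfOrder m (a i)) (u : 𝓢(Conf d, ℂ)) (x : Conf d) :
    IsSymbolOfOrder m (fun x ξ => ∑ i ∈ s, a i x ξ) ∧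
    weylOp (fun x ξ => ∑ i ∈ s, a i x ξ) u x = ∑ i ∈ s, weylOp (a i) u x := by
  classical
  induction s using Finset.induction_on with
  | empty =>
    refine ⟨⟨by simpa using contDiff_const, fun k => ⟨0, fun z => ?_⟩⟩, ?_⟩
    · simp only [Finset.sum_empty]
      rw [iteratedFDeriv_fun_zero]
      simp
    · simp [weylOp]
  | insert i s hi ih =>
    have ih' := ih fun j hj => ha j (Finset.mem_insert_of_mem hj)
    have hi' := ha i (Finset.mem_insert_self i s)
    simp only [Finset.sum_insert hi]
    exact ⟨hi'.add ih'.1, by rw [weylOp_add_symbol hi' ih'.1, ih'.2]⟩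

open LineDeriv in
/-- `a(x,ξ)⟨ξ, h⟩` quantizes to `a^w ⟨D, h⟩ - (i/2) (∂_{x,h} a)^w`. -/
theorem IsSymbolOfOrder.weylOp_inner_mul (ha : IsSymbolOfOrder m a) (u : 𝓢(Conf d, ℂ))
    (h x : Conf d) :
    weylOp (fun x ξ => (inner ℝ ξ h : ℝ) * a x ξ) u x
      = -Complex.I * ((1 / 2) * weylOp (symbolDeriv (h, 0) a) u x
          + weylOp a (∂_{h} u : 𝓢(Conf d, ℂ)) x) := by
  have e : ∀ ξ, weylInner (fun x ξ => (inner ℝ ξ h : ℝ) * a x ξ) u x ξ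
      = -Complex.I * ((1 / 2) * weylInner (symbolDeriv (h, 0) a) u x ξ
          + weylInner a (∂_{h} u : 𝓢(Conf d, ℂ)) x ξ) := fun ξ => by
    rw [← ha.inner_mul_weylInner u h x ξ]
    unfold weylInner
    rw [← integral_const_mul]
    congr 1; ext y; push_cast; ring
  simp only [weylOp_eq_integral_weylInner, e]
  rw [integral_const_mul, integral_add (((ha.deriv (h, 0)).integrable_weylInner u x).const_mul _)
    (ha.integrable_weylInner _ x), integral_const_mul]
  ring

/-- The integrand of `weylInner`. -/
def weylIntegrand (a : Conf d → Conf d → ℝ) (u : Conf d → ℂ) (x ξ y : Conf d) : ℂ :=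
  Complex.exp (Complex.I * (inner ℝ (x - y) ξ : ℝ)) * (a ((1 / 2 : ℝ) • (x + y)) ξ : ℂ) * u y

theorem hasDerivAt_weylIntegrand (ha : IsSymbolOfOrder m a) (u : 𝓢(Conf d, ℂ))
    (h x ξ y : Conf d) (s : ℝ) :
    HasDerivAt (fun s : ℝ => weylIntegrand a u x (ξ + s • h) y)
      (Complex.I * (inner ℝ x h : ℝ) * weylIntegrand a u x (ξ + s • h) y
        - Complex.I * weylIntegrand a (u.posMul h) x (ξ + s • h) y
        + weylIntegrand (symbolDeriv (0, h) a) u x (ξ + s • h) y) s := by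
  have hl : HasDerivAt (fun s : ℝ => ξ + s • h) h s := by
    simpa using ((hasDerivAt_id s).smul_const h).const_add ξ
  have h1 : HasDerivAt (fun s : ℝ => (inner ℝ (x - y) (ξ + s • h) : ℝ)) (inner ℝ (x - y) h) s :=
    (innerSL ℝ (x - y)).hasFDerivAt.comp_hasDerivAt s hl
  have h2 := (h1.ofReal_comp.const_mul Complex.I).cexp
  have h3 : HasDerivAt (fun s : ℝ => a ((1 / 2 : ℝ) • (x + y)) (ξ + s • h))
      (symbolDeriv (0, h) a ((1 / 2 : ℝ) • (x + y)) (ξ + s • h)) s := by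
    have h1 := (ha.differentiable ((1 / 2 : ℝ) • (x + y), ξ + s • h)).hasFDerivAt
    have hp : HasDerivAt (fun s : ℝ => (((1 / 2 : ℝ) • (x + y), ξ + s • h) : Conf d × Conf d))
      (0, h) s := (hasDerivAt_const s _).prodMk hl
    exact HasFDerivAt.comp_hasDerivAt (l := fun z : Conf d × Conf d => a z.1 z.2)
      (f := fun s : ℝ => (((1 / 2 : ℝ) • (x + y), ξ + s • h) : Conf d × Conf d)) s h1 hp
  refine ((h2.mul h3.ofReal_comp).mul_const (u y)).congr_deriv ?_
  simp only [weylIntegrand, SchwartzMap.posMul_apply, inner_sub_left]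
  push_cast
  ring

theorem norm_weylIntegrand_add_smul_le {K : ℝ} (hK0 : 0 ≤ K) (hK : ∀ x y ξ,
    ‖a ((1 / 2 : ℝ) • (x + y)) ξ‖ ≤ K * (1 + ‖x‖) ^ m * (1 + ‖ξ‖) ^ m * (1 + ‖y‖) ^ m)
    (u : 𝓢(Conf d, ℂ)) {s : ℝ} (hs : s ∈ Metric.ball (0 : ℝ) 1) (x ξ h y : Conf d) :
    ‖weylIntegrand a u x (ξ + s • h) y‖
      ≤ (K * (1 + ‖x‖) ^ m * (1 + (‖ξ‖ + ‖h‖)) ^ m) * ((1 + ‖y‖) ^ m * ‖u y‖) := by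
  rw [weylIntegrand, norm_mul, norm_mul, norm_exp_I_mul_ofReal_eq_one, one_mul,
    Complex.norm_real, ← mul_assoc]
  refine mul_le_mul_of_nonneg_right ((hK x y (ξ + s • h)).trans ?_) (norm_nonneg _)
  gcongr
  refine (norm_add_le _ _).trans (add_le_add le_rfl ?_)
  rw [norm_smul]
  refine mul_le_of_le_one_left (norm_nonneg _) ?_
  simpa using (mem_ball_zero_iff.1 hs).le

/-- Differentiation of the inner integral in `ξ`. The factor `i⟨x - y, h⟩` that comes from the
exponential is split into a multiplication from outside and one of the function `u`. -/
theorem IsSymbolOfOrder.hasLineDerivAt_weylInner (ha : IsSymbolOfOrder m a) (u : 𝓢(Conf d, ℂ))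
    (h x ξ : Conf d) :
    HasLineDerivAt ℝ (fun ξ => weylInner a u x ξ)
      (Complex.I * ((inner ℝ x h : ℝ) * weylInner a u x ξ - weylInner a (u.posMul h) x ξ)
        + weylInner (symbolDeriv (0, h) a) u x ξ) ξ h := by
  obtain ⟨K1, hK10, hK1⟩ := ha.norm_midpoint_le
  obtain ⟨K2, hK20, hK2⟩ := (ha.deriv (0, h)).norm_midpoint_le
  have ig : ∀ {a : Conf d → Conf d → ℝ}, IsSymbolOfOrder m a → ∀ (u : 𝓢(Conf d, ℂ)) ξ,
    Integrable (weylIntegrand a u x ξ) := fun ha u ξ => ha.integrable_weylIntegrand u x ξ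
  let F' : ℝ → Conf d → ℂ := fun s y =>
    Complex.I * (inner ℝ x h : ℝ) * weylIntegrand a u x (ξ + s • h) y
      - Complex.I * weylIntegrand a (u.posMul h) x (ξ + s • h) y
      + weylIntegrand (symbolDeriv (0, h) a) u x (ξ + s • h) y
  have iF' : ∀ s, Integrable (F' s) := fun s =>
    (((ig ha u _).const_mul _).sub ((ig ha (u.posMul h) _).const_mul _)).add
      (ig (ha.deriv (0, h)) u _)
  have hval : ∫ y, F' 0 y = Complex.I * ((inner ℝ x h : ℝ) * weylInner a u x ξ
      - weylInner a (u.posMul h) x ξ) + weylInner (symbolDeriv (0, h) a) u x ξ := by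
    have j1 := (ig ha u (ξ + (0 : ℝ) • h)).const_mul (Complex.I * (inner ℝ x h : ℝ))
    have j2 := (ig ha (u.posMul h) (ξ + (0 : ℝ) • h)).const_mul Complex.I
    have s1 := integral_add (j1.sub j2) (ig (ha.deriv (0, h)) u (ξ + (0 : ℝ) • h))
    have s2 := integral_sub j1 j2
    simp only [Pi.sub_apply] at s1
    rw [s2, integral_const_mul, integral_const_mul] at s1
    refine s1.trans ?_
    simp only [zero_smul, add_zero]
    change Complex.I * (inner ℝ x h : ℝ) * weylInner a u x ξ
      - Complex.I * weylInner a (u.posMul h) x ξ + weylInner (symbolDeriv (0, h) a) u x ξ = _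
    ring
  rw [HasLineDerivAt, ← hval]
  let bound : Conf d → ℝ := fun y =>
    |(inner ℝ x h : ℝ)| * ((K1 * (1 + ‖x‖) ^ m * (1 + (‖ξ‖ + ‖h‖)) ^ m)
        * ((1 + ‖y‖) ^ m * ‖u y‖)) + (K1 * (1 + ‖x‖) ^ m * (1 + (‖ξ‖ + ‖h‖)) ^ m)
        * ((1 + ‖y‖) ^ m * ‖u.posMul h y‖) + (K2 * (1 + ‖x‖) ^ m * (1 + (‖ξ‖ + ‖h‖)) ^ m)
        * ((1 + ‖y‖) ^ m * ‖u y‖)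
  have hb : Integrable bound := ((((u.integrable_one_add_norm_pow_mul m).const_mul _).const_mul
      _).add (((u.posMul h).integrable_one_add_norm_pow_mul m).const_mul _)).add
      ((u.integrable_one_add_norm_pow_mul m).const_mul _)
  have hF' : ∀ y, ∀ s ∈ Metric.ball (0 : ℝ) 1, ‖F' s y‖ ≤ bound y := fun y s hs => by
    refine (norm_add_le _ _).trans (add_le_add ((norm_sub_le _ _).trans (add_le_add ?_ ?_)) ?_)
    · rw [norm_mul, norm_mul, Complex.norm_I, one_mul, Complex.norm_real, Real.norm_eq_abs]
      exact mul_le_mul_of_nonneg_left (norm_weylIntegrand_add_smul_le hK10 hK1 u hs x ξ h y)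
        (abs_nonneg _)
    · rw [norm_mul, Complex.norm_I, one_mul]
      exact norm_weylIntegrand_add_smul_le hK10 hK1 (u.posMul h) hs x ξ h y
    · exact norm_weylIntegrand_add_smul_le hK20 hK2 u hs x ξ h y
  exact (hasDerivAt_integral_of_dominated_loc_of_deriv_le (μ := volume)
    (F := fun s y => weylIntegrand a u x (ξ + s • h) y) (F' := F') (x₀ := (0 : ℝ))
    (Metric.ball_mem_nhds 0 one_pos)
    (Filter.Eventually.of_forall fun s => (ig ha u _).aestronglyMeasurable)
    (ig ha u _) (iF' 0).aestronglyMeasurable (Filter.Eventually.of_forall hF') hb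
    (Filter.Eventually.of_forall fun y s _ => hasDerivAt_weylIntegrand ha u h x ξ y s)).2

/-- The commutator of `a^w` with the coordinate `⟨x, h⟩` is `i (∂_{ξ,h} a)^w`. -/
theorem IsSymbolOfOrder.inner_mul_weylOp (ha : IsSymbolOfOrder m a) (u : 𝓢(Conf d, ℂ))
    (h x : Conf d) :
    (inner ℝ x h : ℝ) * weylOp a u x = weylOp a (u.posMul h) x
      + Complex.I * weylOp (symbolDeriv (0, h) a) u x := by
  have i1 := ha.integrable_weylInner u x
  have i2 := ha.integrable_weylInner (u.posMul h) x
  have i3 := (ha.deriv (0, h)).integrable_weylInner u x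
  have i4 := ((i1.const_mul ((inner ℝ x h : ℝ) : ℂ)).sub i2).const_mul Complex.I
  have hz := integral_bilinear_hasLineDerivAt_right_eq_neg_left_of_integrable (μ := volume)
    (f := fun ξ => weylInner a u x ξ) (f' := fun ξ => Complex.I * ((inner ℝ x h : ℝ)
      * weylInner a u x ξ - weylInner a (u.posMul h) x ξ) + weylInner (symbolDeriv (0, h) a) u x ξ)
    (g := fun _ => (1 : ℂ)) (g' := fun _ => 0) (v := h)
    (B := ContinuousLinearMap.mul ℝ ℂ) (by simp only [ContinuousLinearMap.mul_apply', mul_one]; exact i4.add i3)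
    (by simp) (by simpa using i1)
    (fun ξ _ => ha.hasLineDerivAt_weylInner u h x ξ) (fun x _ => (hasFDerivAt_const _ _).hasLineDerivAt _)
  simp only [ContinuousLinearMap.mul_apply', mul_zero, integral_zero, mul_one] at hz
  have s1 := integral_add i4 i3
  simp only [Pi.sub_apply] at s1
  have s2 := integral_sub (i1.const_mul ((inner ℝ x h : ℝ) : ℂ)) i2
  rw [s1, integral_const_mul, s2, integral_const_mul] at hz
  simp only [weylOp_eq_integral_weylInner]
  generalize (((((2 * Real.pi) ^ d : ℝ)⁻¹ : ℝ)) : ℂ) = c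
  linear_combination (-Complex.I * c) * hz
     + c * (((inner ℝ x h : ℝ) : ℂ) * (∫ ξ, weylInner a u x ξ)
       - ∫ ξ, weylInner a (u.posMul h) x ξ) * Complex.I_sq

/-- Each power of `1 + ‖x‖` is traded, through the commutator with a coordinate, for a derivative
of the symbol in `ξ` or a coordinate factor on the function. -/
theorem IsSymbolOfOrder.pow_mul_norm_weylOp_le_aux (k : ℕ) :
    ∀ {a : Conf d → Conf d → ℝ}, IsSymbolOfOrder m a → ∀ u : 𝓢(Conf d, ℂ),
    ∃ C, 0 ≤ C ∧ ∀ x, (1 + ‖x‖) ^ k * ‖weylOp a u x‖ ≤ C * (1 + ‖x‖) ^ m := by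
  induction k with
  | zero =>
    intro a ha u
    obtain ⟨C, hC0, hC⟩ := ha.pow_mul_norm_weylInner_le u (d + 1)
    refine ⟨‖((((2 * Real.pi) ^ d : ℝ)⁻¹ : ℝ) : ℂ)‖ * (C * ∫ ξ : Conf d, ((1 + ‖ξ‖) ^ (d + 1))⁻¹),
      by positivity, fun x => ?_⟩
    rw [pow_zero, one_mul, weylOp_eq_integral_weylInner, norm_mul, mul_assoc]
    refine mul_le_mul_of_nonneg_left ?_ (norm_nonneg _)
    refine (norm_integral_le_of_norm_le ((integrable_one_add_norm_neg_pow d).const_mul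
      (C * (1 + ‖x‖) ^ m)) (Filter.Eventually.of_forall fun ξ => hC x ξ)).trans ?_
    rw [integral_const_mul]
    exact le_of_eq (by ring)
  | succ k ih =>
    intro a ha u
    let e := EuclideanSpace.basisFun (Fin d) ℝ
    obtain ⟨C, hC0, hC⟩ := ih ha u
    choose C1 hC10 hC1 using fun i => ih (ha.deriv (0, e i)) u
    choose C2 hC20 hC2 using fun i => ih ha (u.posMul (e i))
    refine ⟨C + ∑ i, (C2 i + C1 i), add_nonneg hC0 (Finset.sum_nonneg fun i _ =>
      add_nonneg (hC20 i) (hC10 i)), fun x => ?_⟩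
    have h1 : ∀ i, |(inner ℝ x (e i) : ℝ)| * ‖weylOp a u x‖
        ≤ ‖weylOp a (u.posMul (e i)) x‖ + ‖weylOp (symbolDeriv (0, e i) a) u x‖ := fun i => by
      have := congrArg norm (ha.inner_mul_weylOp u (e i) x)
      rw [norm_mul, Complex.norm_real, Real.norm_eq_abs] at this
      rw [this]
      refine (norm_add_le _ _).trans (add_le_add le_rfl ?_)
      simp
    calc (1 + ‖x‖) ^ (k + 1) * ‖weylOp a u x‖
        = (1 + ‖x‖) ^ k * ((1 + ‖x‖) * ‖weylOp a u x‖) := by ring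
      _ ≤ (1 + ‖x‖) ^ k * (‖weylOp a u x‖
          + ∑ i, (‖weylOp a (u.posMul (e i)) x‖ + ‖weylOp (symbolDeriv (0, e i) a) u x‖)) := by
        gcongr
        rw [add_mul, one_mul]
        gcongr
        calc ‖x‖ * ‖weylOp a u x‖ ≤ (∑ i, |(inner ℝ x (e i) : ℝ)|) * ‖weylOp a u x‖ := by
              gcongr; exact Conf.norm_le_sum_abs_inner x
          _ ≤ _ := by rw [Finset.sum_mul]; exact Finset.sum_le_sum fun i _ => h1 i
      _ = (1 + ‖x‖) ^ k * ‖weylOp a u x‖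
          + ∑ i, ((1 + ‖x‖) ^ k * ‖weylOp a (u.posMul (e i)) x‖
            + (1 + ‖x‖) ^ k * ‖weylOp (symbolDeriv (0, e i) a) u x‖) := by
        rw [mul_add, Finset.mul_sum]; simp only [mul_add]
      _ ≤ C * (1 + ‖x‖) ^ m + ∑ i, (C2 i * (1 + ‖x‖) ^ m + C1 i * (1 + ‖x‖) ^ m) :=
        add_le_add (hC x) (Finset.sum_le_sum fun i _ => add_le_add (hC2 i x) (hC1 i x))
      _ = _ := by simp only [← add_mul]; rw [← Finset.sum_mul]; ring

/-- `a^w u` decays rapidly. -/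
theorem IsSymbolOfOrder.norm_weylOp_le (ha : IsSymbolOfOrder m a) (u : 𝓢(Conf d, ℂ))
    (k : ℕ) : ∃ C, 0 ≤ C ∧ ∀ x, ‖weylOp a u x‖ ≤ C * ((1 + ‖x‖) ^ k)⁻¹ := by
  obtain ⟨C, hC0, hC⟩ := IsSymbolOfOrder.pow_mul_norm_weylOp_le_aux (k + m) ha u
  refine ⟨C, hC0, fun x => ?_⟩
  have := hC x
  rw [← div_eq_mul_inv, le_div_iff₀ (by positivity)]
  rw [pow_add] at this
  have h2 : (0 : ℝ) < (1 + ‖x‖) ^ m := by positivity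
  nlinarith

theorem IsSymbolOfOrder.stronglyMeasurable_weylOp (ha : IsSymbolOfOrder m a) (u : 𝓢(Conf d, ℂ)) :
    StronglyMeasurable (weylOp a u) :=
  (StronglyMeasurable.integral_prod_right' (ν := volume)
    (ha.stronglyMeasurable_weylInner u)).const_mul _

/-- Functions that decay like `(1 + |x|)^{-(d+1)}` are square integrable. -/
theorem memLp_two_of_norm_le {g : Conf d → ℂ} {C : ℝ} (hg : AEStronglyMeasurable g volume)
    (h : ∀ x, ‖g x‖ ≤ C * ((1 + ‖x‖) ^ (d + 1))⁻¹) : MemLp g 2 := by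
  rw [memLp_two_iff_integrable_sq_norm hg]
  refine ((integrable_one_add_norm_neg_pow d).const_mul (C ^ 2)).mono' (hg.norm.pow 2)
    (Filter.Eventually.of_forall fun x => ?_)
  have h1 : (1 : ℝ) ≤ (1 + ‖x‖) ^ (d + 1) := one_le_pow₀ (by linarith [norm_nonneg x])
  have h2 : ((1 + ‖x‖) ^ (d + 1))⁻¹ ≤ 1 := inv_le_one_of_one_le₀ h1
  have h3 : 0 ≤ ((1 + ‖x‖) ^ (d + 1))⁻¹ := by positivity
  rw [Real.norm_of_nonneg (by positivity)]
  calc ‖g x‖ ^ 2 ≤ (C * ((1 + ‖x‖) ^ (d + 1))⁻¹) ^ 2 := by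
        gcongr; exact h x
    _ = C ^ 2 * (((1 + ‖x‖) ^ (d + 1))⁻¹ * ((1 + ‖x‖) ^ (d + 1))⁻¹) := by ring
    _ ≤ C ^ 2 * ((1 + ‖x‖) ^ (d + 1))⁻¹ := by
        gcongr; exact mul_le_of_le_one_left h3 h2

theorem IsSymbolOfOrder.memLp_weylOp (ha : IsSymbolOfOrder m a) (u : 𝓢(Conf d, ℂ)) :
    MemLp (weylOp a u) 2 := by
  obtain ⟨C, -, hC⟩ := ha.norm_weylOp_le u (d + 1)
  exact memLp_two_of_norm_le (ha.stronglyMeasurable_weylOp u).aestronglyMeasurable hC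

end WeylInner

/-! ### Weyl quantization of quadratic polynomials -/

section Quantization

variable {d m : ℕ}

open FourierTransform Real in
/-- Functions of position quantize to multiplication operators (Fourier inversion). -/
theorem weylOp_position {b : Conf d → ℝ} (hb : IsSymbolOfOrder m (fun x (_ : Conf d) => b x))
    (u : 𝓢(Conf d, ℂ)) (x : Conf d) : weylOp (fun x _ => b x) u x = b x * u x := by
  let g : Conf d → ℂ := fun y => (b ((1 / 2 : ℝ) • (x + y)) : ℂ) * u y
  have hbc : Continuous b := by
    exact hb.continuous.comp (f := fun x : Conf d => (x, (0 : Conf d))) (by fun_prop)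
  have hgc : Continuous g := by
    have := u.continuous
    fun_prop
  have hgi : Integrable g := by
    have := hb.integrable_weylIntegrand u x 0
    simpa [g] using this
  have hW : ∀ η : Conf d, weylInner (fun x _ => b x) u x ((2 * π) • η)
      = Complex.exp (((2 * π * inner ℝ η x : ℝ) : ℂ) * Complex.I) • 𝓕 g η := by
    intro η
    rw [fourier_eq', weylInner, ← integral_smul]
    congr 1; ext y
    simp only [g, smul_eq_mul, ← mul_assoc]
    rw [← Complex.exp_add]
    congr 3
    rw [real_inner_comm, inner_smul_left, inner_sub_right, real_inner_comm η y]
    push_cast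
    simp only [conj_trivial]
    push_cast
    ring
  have hint : Integrable (𝓕 g) := by
    have h1 := (hb.integrable_weylInner u x).comp_smul (R := 2 * π) (by positivity)
    simp_rw [hW] at h1
    have h2 : Continuous (𝓕 g) := VectorFourier.fourierIntegral_continuous
      Real.continuous_fourierChar (innerSL ℝ).continuous₂ hgi
    refine h1.mono h2.aestronglyMeasurable (Filter.Eventually.of_forall fun η => ?_)
    rw [norm_smul, Complex.norm_exp_ofReal_mul_I, one_mul]
  have hinv := hgi.fourierInv_fourier_eq hint (hgc.continuousAt (x := x))
  rw [fourierInv_eq'] at hinv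
  have hs := Measure.integral_comp_smul volume (weylInner (fun x _ => b x) u x) (2 * π)
  simp_rw [hW] at hs
  rw [weylOp_eq_integral_weylInner]
  have hpos : (0 : ℝ) < ((2 * π) ^ d)⁻¹ := by positivity
  rw [finrank_euclideanSpace_fin, abs_of_pos hpos, Complex.real_smul, hinv] at hs
  rw [← hs]
  simp only [g]
  congr 3
  rw [← two_smul ℝ x, smul_smul]
  norm_num

/-- Real polynomials of degree at most two on phase space, given by a bilinear form `B`, a linear
form `ℓ` and a constant `c`. The bilinear form is not required to be symmetric, so that a
polynomial function has several representations; only the finite-dimensional linear structure of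
the coefficients matters. -/
abbrev QuadPoly (d : ℕ) : Type :=
  ((Conf d × Conf d) →L[ℝ] (Conf d × Conf d) →L[ℝ] ℝ) × ((Conf d × Conf d) →L[ℝ] ℝ) × ℝ

/-- The polynomial function `z ↦ B(z,z) + ℓ(z) + c`. -/
def QuadPoly.eval (q : QuadPoly d) (x ξ : Conf d) : ℝ :=
  q.1 (x, ξ) (x, ξ) + q.2.1 (x, ξ) + q.2.2

theorem QuadPoly.hasFDerivAt_eval (q : QuadPoly d) (z : Conf d × Conf d) :
    HasFDerivAt (fun z : Conf d × Conf d => q.eval z.1 z.2)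
      ((q.1 + q.1.flip) z + q.2.1) z := by
  have h1 : HasFDerivAt (fun z : Conf d × Conf d => q.1 z z) ((q.1 + q.1.flip) z) z := by
    refine (q.1.hasFDerivAt.clm_apply (hasFDerivAt_id z)).congr_fderiv ?_
    ext w <;> simp
  exact (h1.add q.2.1.hasFDerivAt).add_const _

/-- Quadratic polynomials are symbols of order two: their derivatives beyond the second vanish,
and the lower ones grow at most quadratically. -/
theorem QuadPoly.isSymbolOfOrder (q : QuadPoly d) : IsSymbolOfOrder 2 q.eval := by
  have hf : fderiv ℝ (fun z : Conf d × Conf d => q.eval z.1 z.2)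
      = fun z => (q.1 + q.1.flip) z + q.2.1 := funext fun z => (q.hasFDerivAt_eval z).fderiv
  have hf2 : fderiv ℝ (fun z => (q.1 + q.1.flip) z + q.2.1) = fun _ => q.1 + q.1.flip := by
    funext z
    exact ((q.1 + q.1.flip).hasFDerivAt.add_const _).fderiv
  refine ⟨?_, fun k => ?_⟩
  · unfold QuadPoly.eval
    have h1 : ContDiff ℝ ∞ (fun z : Conf d × Conf d => q.1 z z) :=
      q.1.contDiff.clm_apply contDiff_id
    exact (h1.add q.2.1.contDiff).add contDiff_const
  · have hpow : ∀ z : Conf d × Conf d, 1 ≤ (1 + ‖z‖) := fun z => by linarith [norm_nonneg z]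
    rcases k with _ | _ | _ | k
    · refine ⟨‖q.1‖ + ‖q.2.1‖ + ‖q.2.2‖, fun z => ?_⟩
      rw [norm_iteratedFDeriv_zero]
      have h1 : ‖q.1 z z‖ ≤ ‖q.1‖ * ‖z‖ * ‖z‖ := q.1.le_opNorm₂ z z
      have h2 : ‖q.2.1 z‖ ≤ ‖q.2.1‖ * ‖z‖ := q.2.1.le_opNorm z
      refine (norm_add_le _ _).trans ((add_le_add ((norm_add_le _ _).trans
        (add_le_add h1 h2)) le_rfl).trans ?_)
      nlinarith [norm_nonneg z, norm_nonneg q.1, norm_nonneg q.2.1, norm_nonneg q.2.2,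
        mul_nonneg (norm_nonneg q.1) (norm_nonneg z), mul_nonneg (norm_nonneg q.2.1) (norm_nonneg z),
        mul_nonneg (norm_nonneg q.2.2) (norm_nonneg z), mul_nonneg (norm_nonneg q.2.1)
          (sq_nonneg ‖z‖), mul_nonneg (norm_nonneg q.2.2) (sq_nonneg ‖z‖)]
    · refine ⟨‖q.1 + q.1.flip‖ + ‖q.2.1‖, fun z => ?_⟩
      rw [← norm_iteratedFDeriv_fderiv, norm_iteratedFDeriv_zero, hf]
      have h1 := (q.1 + q.1.flip).le_opNorm z
      refine (norm_add_le _ _).trans ((add_le_add h1 le_rfl).trans ?_)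
      have h3 := norm_nonneg (q.1 + q.1.flip)
      nlinarith [norm_nonneg z, norm_nonneg q.2.1, mul_nonneg h3 (norm_nonneg z),
        mul_nonneg (norm_nonneg q.2.1) (norm_nonneg z), mul_nonneg h3 (sq_nonneg ‖z‖),
        mul_nonneg (norm_nonneg q.2.1) (sq_nonneg ‖z‖)]
    · refine ⟨‖q.1 + q.1.flip‖, fun z => ?_⟩
      rw [← norm_iteratedFDeriv_fderiv, ← norm_iteratedFDeriv_fderiv, hf, hf2,
        norm_iteratedFDeriv_zero]
      exact le_mul_of_one_le_right (norm_nonneg _) (one_le_pow₀ (hpow z))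
    · refine ⟨0, fun z => ?_⟩
      rw [← norm_iteratedFDeriv_fderiv, ← norm_iteratedFDeriv_fderiv, hf, hf2,
        iteratedFDeriv_succ_const]
      simp

/-- The quadratic Hamiltonian `⟨x,Ax⟩ + ⟨Bx,ξ⟩ + ⟨ξ,Cξ⟩ + ⟨a,x⟩ + ⟨b,ξ⟩ + c`. -/
def quadHam (A B C : Conf d →L[ℝ] Conf d) (a b : Conf d) (c : ℝ) (x ξ : Conf d) : ℝ :=
  inner ℝ x (A x) + inner ℝ (B x) ξ + inner ℝ ξ (C ξ) + inner ℝ a x + inner ℝ b ξ + c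

/-- `quadHam` in the coordinates `QuadPoly`. -/
def quadHamPoly (A B C : Conf d →L[ℝ] Conf d) (a b : Conf d) (c : ℝ) : QuadPoly d :=
  let p1 := ContinuousLinearMap.fst ℝ (Conf d) (Conf d)
  let p2 := ContinuousLinearMap.snd ℝ (Conf d) (Conf d)
  ((innerSL ℝ).bilinearComp p1 (A.comp p1) + (innerSL ℝ).bilinearComp (B.comp p1) p2
    + (innerSL ℝ).bilinearComp p2 (C.comp p2), (innerSL ℝ a).comp p1 + (innerSL ℝ b).comp p2, c)

theorem quadHamPoly_eval (A B C : Conf d →L[ℝ] Conf d) (a b : Conf d) (c : ℝ) :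
    (quadHamPoly A B C a b c).eval = quadHam A B C a b c := by
  ext x ξ
  simp [quadHamPoly, QuadPoly.eval, quadHam]
  ring

open LineDeriv in
/-- The Weyl quantization of a quadratic Hamiltonian is a second order differential operator. The
symmetric ordering shows in the term with the trace of `B`. -/
theorem weylOp_quadHam (A B C : Conf d →L[ℝ] Conf d) (a b : Conf d) (c : ℝ) (u : 𝓢(Conf d, ℂ))
    (x : Conf d) :
    weylOp (quadHam A B C a b c) u x
      = ((inner ℝ x (A x) + inner ℝ a x + c : ℝ) : ℂ) * u x
        - Complex.I * fderiv ℝ u x (B x + b)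
        - Complex.I / 2 * (∑ i, (inner ℝ (B (EuclideanSpace.basisFun (Fin d) ℝ i))
            (EuclideanSpace.basisFun (Fin d) ℝ i) : ℝ)) * u x
        - ∑ i, (∂_{EuclideanSpace.basisFun (Fin d) ℝ i}
            (∂_{C (EuclideanSpace.basisFun (Fin d) ℝ i)} u : 𝓢(Conf d, ℂ)) : 𝓢(Conf d, ℂ)) x := by
  set e := EuclideanSpace.basisFun (Fin d) ℝ with he
  -- the symbols involved
  have s0 : IsSymbolOfOrder 2 (fun x (_ : Conf d) => inner ℝ x (A x) + inner ℝ a x + c) := by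
    convert (quadHamPoly A 0 0 a 0 c).isSymbolOfOrder using 1
    rw [quadHamPoly_eval]; ext x ξ; simp [quadHam]
  have s1 : IsSymbolOfOrder 2 (fun (_ _ : Conf d) => (1 : ℝ)) := by
    convert (quadHamPoly (0 : Conf d →L[ℝ] Conf d) 0 0 0 0 1).isSymbolOfOrder using 1
    rw [quadHamPoly_eval]; ext x ξ; simp [quadHam]
  have sx : ∀ g : Conf d, IsSymbolOfOrder 2 (fun (x _ : Conf d) => (inner ℝ x g : ℝ)) := fun g => by
    convert (quadHamPoly (0 : Conf d →L[ℝ] Conf d) 0 0 g 0 0).isSymbolOfOrder using 1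
    rw [quadHamPoly_eval]; ext x ξ; simp [quadHam, real_inner_comm]
  have sξ : ∀ g : Conf d, IsSymbolOfOrder 2 (fun (_ ξ : Conf d) => (inner ℝ ξ g : ℝ)) := fun g => by
    convert (quadHamPoly (0 : Conf d →L[ℝ] Conf d) 0 0 0 g 0).isSymbolOfOrder using 1
    rw [quadHamPoly_eval]; ext x ξ; simp [quadHam, real_inner_comm]
  have sxξ : ∀ g h : Conf d, IsSymbolOfOrder 2
      (fun (x ξ : Conf d) => (inner ℝ ξ h : ℝ) * inner ℝ x g) := fun g h => by
    convert (quadHamPoly (0 : Conf d →L[ℝ] Conf d) ((innerSL ℝ g).smulRight h) 0 0 0 0).isSymbolOfOrder using 1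
    rw [quadHamPoly_eval]; ext x ξ
    simp [quadHam, real_inner_comm, inner_smul_left]; ring
  have sξξ : ∀ g h : Conf d, IsSymbolOfOrder 2
      (fun (_ ξ : Conf d) => (inner ℝ ξ h : ℝ) * inner ℝ ξ g) := fun g h => by
    convert (quadHamPoly (0 : Conf d →L[ℝ] Conf d) 0 ((innerSL ℝ g).smulRight h) 0 0 0).isSymbolOfOrder using 1
    rw [quadHamPoly_eval]; ext x ξ
    simp [quadHam, real_inner_comm, inner_smul_right]; ring
  -- their quantizations
  have w1 : ∀ (v : 𝓢(Conf d, ℂ)), weylOp (fun _ _ => 1) v x = v x := fun v => by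
    simpa using weylOp_position (b := fun _ => (1 : ℝ)) s1 v x
  have d0 : ∀ (w : Conf d × Conf d) (r : ℝ), symbolDeriv w (fun _ _ : Conf d => r) = fun _ _ => 0 := by
    intro w r; ext x ξ; simp [symbolDeriv]
  have wz : ∀ (v : 𝓢(Conf d, ℂ)), weylOp (fun _ _ => 0) v x = 0 := fun v => by simp [weylOp]
  have wξ : ∀ (h : Conf d) (v : 𝓢(Conf d, ℂ)), weylOp (fun _ ξ => (inner ℝ ξ h : ℝ)) v x
      = -Complex.I * (∂_{h} v : 𝓢(Conf d, ℂ)) x := fun h v => by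
    have := s1.weylOp_inner_mul v h x
    simp only [mul_one] at this
    rw [this, d0, wz, w1]; ring
  have wxξ : ∀ (g h : Conf d), weylOp (fun x ξ => (inner ℝ ξ h : ℝ) * inner ℝ x g) u x
      = -Complex.I * ((inner ℝ h g : ℝ) / 2 * u x
        + (inner ℝ x g : ℝ) * (∂_{h} u : 𝓢(Conf d, ℂ)) x) := fun g h => by
    rw [(sx g).weylOp_inner_mul u h x]
    have : symbolDeriv (h, 0) (fun (x _ : Conf d) => (inner ℝ x g : ℝ))
        = fun _ _ => (inner ℝ h g : ℝ) * 1 := by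
      ext x ξ
      have := ((innerSL ℝ g).comp (ContinuousLinearMap.fst ℝ (Conf d) (Conf d))).hasFDerivAt
        (x := (x, ξ))
      rw [symbolDeriv, HasFDerivAt.fderiv (f' := (innerSL ℝ g).comp
        (ContinuousLinearMap.fst ℝ (Conf d) (Conf d)))]
      · simp [real_inner_comm]
      · refine this.congr_of_eventuallyEq (Filter.Eventually.of_forall fun z => ?_)
        simp [real_inner_comm]
    rw [this, weylOp_const_mul_symbol, w1, weylOp_position (b := fun x => (inner ℝ x g : ℝ)) (sx g)]
    ring
  have wξξ : ∀ (g h : Conf d), weylOp (fun _ ξ => (inner ℝ ξ h : ℝ) * inner ℝ ξ g) u x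
      = - (∂_{g} (∂_{h} u : 𝓢(Conf d, ℂ)) : 𝓢(Conf d, ℂ)) x := fun g h => by
    rw [(sξ g).weylOp_inner_mul u h x]
    have : symbolDeriv (h, 0) (fun (_ ξ : Conf d) => (inner ℝ ξ g : ℝ)) = fun _ _ => 0 := by
      ext x ξ
      have := ((innerSL ℝ g).comp (ContinuousLinearMap.snd ℝ (Conf d) (Conf d))).hasFDerivAt
        (x := (x, ξ))
      rw [symbolDeriv, HasFDerivAt.fderiv (f' := (innerSL ℝ g).comp
        (ContinuousLinearMap.snd ℝ (Conf d) (Conf d)))]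
      · simp
      · refine this.congr_of_eventuallyEq (Filter.Eventually.of_forall fun z => ?_)
        simp [real_inner_comm]
    rw [this, wz, wξ]
    linear_combination ((∂_{g} (∂_{h} u : 𝓢(Conf d, ℂ)) : 𝓢(Conf d, ℂ)) x) * Complex.I_sq
  -- decomposition of the Hamiltonian
  have hdec : quadHam A B C a b c = fun x ξ => (((inner ℝ x (A x) + inner ℝ a x + c)
      + (inner ℝ ξ b : ℝ)) + ∑ i, (inner ℝ ξ (B (e i)) : ℝ) * inner ℝ x (e i))
      + ∑ i, (inner ℝ ξ (C (e i)) : ℝ) * inner ℝ ξ (e i) := by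
    ext x ξ
    have hB : (inner ℝ (B x) ξ : ℝ) = ∑ i, (inner ℝ ξ (B (e i)) : ℝ) * inner ℝ x (e i) := by
      conv_lhs => rw [← e.sum_repr' x, map_sum, sum_inner]
      refine Finset.sum_congr rfl fun i _ => ?_
      rw [map_smul, inner_smul_left, real_inner_comm (B (e i)), real_inner_comm x]; simp; ring
    have hC : (inner ℝ ξ (C ξ) : ℝ) = ∑ i, (inner ℝ ξ (C (e i)) : ℝ) * inner ℝ ξ (e i) := by
      have : C ξ = ∑ i, (inner ℝ (e i) ξ : ℝ) • C (e i) := by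
        conv_lhs => rw [← e.sum_repr' ξ, map_sum]
        simp only [map_smul]
      rw [this, inner_sum]
      refine Finset.sum_congr rfl fun i _ => ?_
      rw [inner_smul_right, real_inner_comm ξ]; ring
    rw [quadHam, hB, hC, real_inner_comm ξ b]; ring
  have tB := weylOp_sum_symbol Finset.univ (fun i _ => sxξ (e i) (B (e i))) u x
  have tC := weylOp_sum_symbol Finset.univ (fun i _ => sξξ (e i) (C (e i))) u x
  have hDu : fderiv ℝ u x (B x) = ∑ i, (inner ℝ x (e i) : ℝ) * (∂_{B (e i)} u : 𝓢(Conf d, ℂ)) x := by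
    conv_lhs => rw [← e.sum_repr' x, map_sum, map_sum]
    refine Finset.sum_congr rfl fun i _ => ?_
    rw [map_smul, map_smul, real_inner_comm, e.sum_repr' x,
      SchwartzMap.lineDerivOp_apply_eq_fderiv]; simp
  rw [hdec, weylOp_add_symbol ((s0.add (sξ b)).add tB.1) tC.1, weylOp_add_symbol (s0.add (sξ b)) tB.1,
    weylOp_add_symbol s0 (sξ b), tB.2, tC.2, weylOp_position s0, wξ, map_add, hDu]
  simp only [wxξ, wξξ, SchwartzMap.lineDerivOp_apply_eq_fderiv b u x]
  rw [← Finset.mul_sum, Finset.sum_add_distrib, ← Finset.sum_mul, ← Finset.sum_div,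
    Finset.sum_neg_distrib]
  push_cast
  ring

end Quantization

/-! ### Chirped affine substitutions -/

/-- The embedding of the Schwartz space in `L²`. -/
abbrev toL2 {d : ℕ} : 𝓢(Conf d, ℂ) →L[ℂ] L2 d := SchwartzMap.toLpCLM ℂ ℂ 2 volume

theorem HasDerivAt.prod_fst {E F : Type*} [NormedAddCommGroup E] [NormedSpace ℝ E]
    [NormedAddCommGroup F] [NormedSpace ℝ F] {f : ℝ → E × F} {f' : E × F} {t : ℝ}
    (h : HasDerivAt f f' t) : HasDerivAt (fun t => (f t).1) f'.1 t :=
  (ContinuousLinearMap.fst ℝ E F).hasFDerivAt.comp_hasDerivAt t h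

theorem HasDerivAt.prod_snd {E F : Type*} [NormedAddCommGroup E] [NormedSpace ℝ E]
    [NormedAddCommGroup F] [NormedSpace ℝ F] {f : ℝ → E × F} {f' : E × F} {t : ℝ}
    (h : HasDerivAt f f' t) : HasDerivAt (fun t => (f t).2) f'.2 t :=
  (ContinuousLinearMap.snd ℝ E F).hasFDerivAt.comp_hasDerivAt t h

section Oscillatory

variable {d : ℕ}

theorem hasTemperateGrowth_exp_neg_I_mul :
    Function.HasTemperateGrowth (fun r : ℝ => Complex.exp (-Complex.I * (r : ℂ))) := by
  have hd : ∀ r : ℝ, HasDerivAt (fun r : ℝ => Complex.exp (-Complex.I * (r : ℂ)))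
      (-Complex.I * Complex.exp (-Complex.I * (r : ℂ))) r := fun r => by
    have h1 : HasDerivAt (fun r : ℝ => -Complex.I * (r : ℂ)) (-Complex.I) r := by
      simpa using (Complex.ofRealCLM.hasDerivAt (x := r)).const_mul (-Complex.I)
    simpa [mul_comm] using h1.cexp
  have hi : ∀ n, iteratedDeriv n (fun r : ℝ => Complex.exp (-Complex.I * (r : ℂ)))
      = fun r : ℝ => (-Complex.I) ^ n * Complex.exp (-Complex.I * (r : ℂ)) := fun n => by
    induction n with
    | zero => simp
    | succ n ih =>
      rw [iteratedDeriv_succ, ih]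
      funext r
      rw [((hd r).const_mul _).deriv]; ring
  refine ⟨?_, fun n => ⟨0, 1, fun r => ?_⟩⟩
  · exact Complex.contDiff_exp.comp (contDiff_const.mul Complex.ofRealCLM.contDiff)
  · rw [norm_iteratedFDeriv_eq_norm_iteratedDeriv, hi, norm_mul, norm_pow]
    have : -Complex.I * (r : ℂ) = ((-r : ℝ) : ℂ) * Complex.I := by push_cast; ring
    rw [this, Complex.norm_exp_ofReal_mul_I]
    simp

/-- The exponential `exp(-i(⟨x,Qx⟩ + ⟨q,x⟩ + c))` of a quadratic polynomial. -/
def chirp (Q : Conf d →L[ℝ] Conf d) (q : Conf d) (c : ℂ) (x : Conf d) : ℂ :=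
  Complex.exp (-Complex.I * (((inner ℝ x (Q x) + inner ℝ q x : ℝ) : ℂ) + c))

theorem chirp_hasTemperateGrowth (Q : Conf d →L[ℝ] Conf d) (q : Conf d) (c : ℂ) :
    (chirp Q q c).HasTemperateGrowth := by
  have h1 : Function.HasTemperateGrowth (fun x : Conf d => (inner ℝ x (Q x) + inner ℝ q x : ℝ)) := by
    refine Function.HasTemperateGrowth.add ?_ (Function.hasTemperateGrowth_inner_right q)
    have := ContinuousLinearMap.bilinear_hasTemperateGrowth (𝕜 := ℝ) (innerSL ℝ (E := Conf d))
      (Function.HasTemperateGrowth.id' (E := Conf d)) Q.hasTemperateGrowth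
    exact this
  have h2 := (hasTemperateGrowth_exp_neg_I_mul.comp h1).mul
    (Function.HasTemperateGrowth.const (E := Conf d) (Complex.exp (-Complex.I * c)))
  have h3 : chirp Q q c = ((fun r : ℝ => Complex.exp (-Complex.I * (r : ℂ))) ∘ fun x : Conf d =>
      (inner ℝ x (Q x) + inner ℝ q x : ℝ)) * fun _ => Complex.exp (-Complex.I * c) := by
    funext x
    simp only [chirp, Pi.mul_apply, Function.comp]
    rw [mul_add, Complex.exp_add]
  rw [h3]
  exact h2

theorem norm_chirp (Q : Conf d →L[ℝ] Conf d) (q : Conf d) (c : ℂ) (x : Conf d) :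
    ‖chirp Q q c x‖ = Real.exp c.im := by
  rw [chirp, Complex.norm_exp]
  simp

/-- Linear maps that are bounded below, i.e. invertible ones, in a form that is convenient for
substitutions in Schwartz functions. -/
def BoundedBelow (L : Conf d →L[ℝ] Conf d) : Prop := ∃ K : ℝ, ∀ x, ‖x‖ ≤ K * ‖L x‖

theorem BoundedBelow.exists_one_le {L : Conf d →L[ℝ] Conf d} (h : BoundedBelow L) :
    ∃ K : ℝ, 1 ≤ K ∧ ∀ x, ‖x‖ ≤ K * ‖L x‖ := by
  obtain ⟨K, hK⟩ := h
  exact ⟨max K 1, le_max_right _ _, fun x => (hK x).trans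
    (mul_le_mul_of_nonneg_right (le_max_left _ _) (norm_nonneg _))⟩

open Classical in
/-- The substitution `v ↦ v(L · + l)` on Schwartz functions (zero if `L` is not invertible). -/
def affineComp (L : Conf d →L[ℝ] Conf d) (l : Conf d) : 𝓢(Conf d, ℂ) →L[ℂ] 𝓢(Conf d, ℂ) :=
  if h : BoundedBelow L then
    SchwartzMap.compCLM ℂ (g := fun x => L x + l)
      (L.hasTemperateGrowth.add (Function.HasTemperateGrowth.const l)) (by
        obtain ⟨K, hK1, hK⟩ := h.exists_one_le
        refine ⟨1, K * (1 + ‖l‖), fun x => (hK x).trans ?_⟩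
        rw [mul_assoc]
        refine mul_le_mul_of_nonneg_left ?_ (by linarith)
        have : ‖L x‖ ≤ ‖L x + l‖ + ‖l‖ := by
          simpa using norm_sub_le (L x + l) l
        nlinarith [norm_nonneg l, norm_nonneg (L x + l), mul_nonneg (norm_nonneg l) (norm_nonneg (L x + l))])
  else 0

theorem affineComp_apply {L : Conf d →L[ℝ] Conf d} (hL : BoundedBelow L) (l : Conf d)
    (v : 𝓢(Conf d, ℂ)) (x : Conf d) : affineComp L l v x = v (L x + l) := by
  rw [affineComp, dif_pos hL]; rfl

/-- Parameters of a chirped affine substitution. -/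
abbrev ChirpParam (d : ℕ) : Type :=
  (Conf d →L[ℝ] Conf d) × Conf d × ℂ × (Conf d →L[ℝ] Conf d) × Conf d

/-- The operator `v ↦ exp(-i(⟨x,Qx⟩ + ⟨q,x⟩ + c)) v(Lx + l)` with `θ = (Q, q, c, L, l)`. -/
def chirpOp (θ : ChirpParam d) : 𝓢(Conf d, ℂ) →L[ℂ] 𝓢(Conf d, ℂ) :=
  (SchwartzMap.smulLeftCLM ℂ (chirp θ.1 θ.2.1 θ.2.2.1)).comp (affineComp θ.2.2.2.1 θ.2.2.2.2)

theorem chirpOp_apply {θ : ChirpParam d} (hL : BoundedBelow θ.2.2.2.1) (v : 𝓢(Conf d, ℂ))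
    (x : Conf d) :
    chirpOp θ v x = chirp θ.1 θ.2.1 θ.2.2.1 x * v (θ.2.2.2.1 x + θ.2.2.2.2) := by
  rw [chirpOp, ContinuousLinearMap.comp_apply,
    SchwartzMap.smulLeftCLM_apply_apply (chirp_hasTemperateGrowth _ _ _), affineComp_apply hL,
    smul_eq_mul]

/-- The pointwise derivative of `chirpOp θ v` along a curve `θ` of parameters with velocity
`θ'`. -/
def chirpOpDeriv (θ θ' : ChirpParam d) (v : 𝓢(Conf d, ℂ)) (x : Conf d) : ℂ :=
  chirp θ.1 θ.2.1 θ.2.2.1 x *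
    (-Complex.I * (((inner ℝ x (θ'.1 x) + inner ℝ θ'.2.1 x : ℝ) : ℂ) + θ'.2.2.1)
        * v (θ.2.2.2.1 x + θ.2.2.2.2)
      + fderiv ℝ v (θ.2.2.2.1 x + θ.2.2.2.2) (θ'.2.2.2.1 x + θ'.2.2.2.2))

theorem hasDerivAt_chirp_mul {θ : ℝ → ChirpParam d} {θ' : ChirpParam d} {κ : ℝ}
    (h : HasDerivAt θ θ' κ) (v : 𝓢(Conf d, ℂ)) (x : Conf d) :
    HasDerivAt (fun κ => chirp (θ κ).1 (θ κ).2.1 (θ κ).2.2.1 x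
      * v ((θ κ).2.2.2.1 x + (θ κ).2.2.2.2)) (chirpOpDeriv (θ κ) θ' v x) κ := by
  have h1 : HasDerivAt (fun κ => (θ κ).1) θ'.1 κ := h.prod_fst
  have h1' : HasDerivAt (fun κ => (θ κ).2) θ'.2 κ := h.prod_snd
  have h2 : HasDerivAt (fun κ => (θ κ).2.1) θ'.2.1 κ := h1'.prod_fst
  have h2' : HasDerivAt (fun κ => (θ κ).2.2) θ'.2.2 κ := h1'.prod_snd
  have h3 : HasDerivAt (fun κ => (θ κ).2.2.1) θ'.2.2.1 κ := h2'.prod_fst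
  have h3' : HasDerivAt (fun κ => (θ κ).2.2.2) θ'.2.2.2 κ := h2'.prod_snd
  have h4 : HasDerivAt (fun κ => (θ κ).2.2.2.1) θ'.2.2.2.1 κ := h3'.prod_fst
  have h5 : HasDerivAt (fun κ => (θ κ).2.2.2.2) θ'.2.2.2.2 κ := h3'.prod_snd
  have hQ : HasDerivAt (fun κ => (inner ℝ x ((θ κ).1 x) : ℝ)) (inner ℝ x (θ'.1 x)) κ := by
    have := h1.clm_apply (hasDerivAt_const κ x)
    simp only [map_zero, add_zero] at this
    exact (innerSL ℝ x).hasFDerivAt.comp_hasDerivAt κ this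
  have hq : HasDerivAt (fun κ => (inner ℝ ((θ κ).2.1) x : ℝ)) (inner ℝ θ'.2.1 x) κ := by
    have := (innerSL ℝ x).hasFDerivAt.comp_hasDerivAt κ h2
    simp only [innerSL_apply_apply] at this
    rw [real_inner_comm]
    exact this.congr_of_eventuallyEq (Filter.Eventually.of_forall fun s => real_inner_comm _ _)
  have hL : HasDerivAt (fun κ => (θ κ).2.2.2.1 x + (θ κ).2.2.2.2) (θ'.2.2.2.1 x + θ'.2.2.2.2) κ := by
    have := (h4.clm_apply (hasDerivAt_const κ x)).add h5
    simp only [map_zero, add_zero] at this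
    exact this
  have hv := (v.hasFDerivAt ((θ κ).2.2.2.1 x + (θ κ).2.2.2.2)).comp_hasDerivAt κ hL
  have he := ((((hQ.add hq).ofReal_comp).add h3).const_mul (-Complex.I)).cexp
  refine (he.mul hv).congr_deriv ?_
  simp only [chirpOpDeriv, chirp, Pi.add_apply, Function.comp]
  ring

/-- Differentiability in `L²` from pointwise differentiability, by dominated convergence. -/
theorem hasDerivAt_L2_of_dominated {G : ℝ → L2 d} {w : L2 d} {F F' : ℝ → Conf d → ℂ} {κ₀ ε C : ℝ}
    (hε : 0 < ε) (hG : ∀ κ ∈ Metric.ball κ₀ ε, G κ =ᵐ[volume] F κ) (hw : w =ᵐ[volume] F' κ₀)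
    (hF : ∀ κ ∈ Metric.ball κ₀ ε, ∀ x, HasDerivAt (fun κ => F κ x) (F' κ x) κ)
    (hb : ∀ κ ∈ Metric.ball κ₀ ε, ∀ x, ‖F' κ x‖ ≤ C * ((1 + ‖x‖) ^ (d + 1))⁻¹) :
    HasDerivAt G w κ₀ := by
  have h0 : κ₀ ∈ Metric.ball κ₀ ε := Metric.mem_ball_self hε
  have hball : ∀ᶠ κ in nhdsWithin κ₀ {κ₀}ᶜ, κ ∈ Metric.ball κ₀ ε :=
    nhdsWithin_le_nhds (Metric.ball_mem_nhds κ₀ hε)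
  rw [hasDerivAt_iff_tendsto_slope, tendsto_iff_norm_sub_tendsto_zero]
  let D : ℝ → Conf d → ℂ := fun κ x => slope (fun κ => F κ x) κ₀ κ - F' κ₀ x
  have hD : ∀ κ ∈ Metric.ball κ₀ ε, (slope G κ₀ κ - w : L2 d) =ᵐ[volume] D κ := by
    intro κ hκ
    rw [slope_def_module]
    filter_upwards [hG κ hκ, hG κ₀ h0, hw, Lp.coeFn_sub ((κ - κ₀)⁻¹ • (G κ - G κ₀)) w,
      Lp.coeFn_smul (κ - κ₀)⁻¹ (G κ - G κ₀), Lp.coeFn_sub (G κ) (G κ₀)] with x h1 h2 h3 h4 h5 h6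
    simp only [D]
    rw [h4, Pi.sub_apply, h5, Pi.smul_apply, h6, Pi.sub_apply, h1, h2, h3, slope_def_module]
  have hnorm : ∀ κ ∈ Metric.ball κ₀ ε, ‖slope G κ₀ κ - w‖ ^ 2 = ∫ x, ‖D κ x‖ ^ 2 := by
    intro κ hκ
    have h1 : ((‖slope G κ₀ κ - w‖ ^ 2 : ℝ) : ℂ) = ((∫ x, ‖D κ x‖ ^ 2 : ℝ) : ℂ) := by
      have h2 := inner_self_eq_norm_sq_to_K (𝕜 := ℂ) (slope G κ₀ κ - w)
      push_cast
      rw [← integral_complex_ofReal]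
      refine h2.symm.trans ?_
      rw [L2.inner_def]
      refine integral_congr_ae ?_
      filter_upwards [hD κ hκ] with x hx
      rw [hx, inner_self_eq_norm_sq_to_K]
      simp
    exact_mod_cast h1
  have hDb : ∀ κ ∈ Metric.ball κ₀ ε, κ ≠ κ₀ → ∀ x, ‖D κ x‖ ≤ 2 * C * ((1 + ‖x‖) ^ (d + 1))⁻¹ := by
    intro κ hκ hne x
    have hmv := (convex_ball κ₀ ε).norm_image_sub_le_of_norm_hasDerivWithin_le
      (fun s hs => (hF s hs x).hasDerivWithinAt) (fun s hs => hb s hs x) h0 hκ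
    have h1 : ‖slope (fun κ => F κ x) κ₀ κ‖ ≤ C * ((1 + ‖x‖) ^ (d + 1))⁻¹ := by
      rw [slope_def_module, norm_smul, norm_inv, inv_mul_le_iff₀ (norm_pos_iff.2 (sub_ne_zero.2 hne)),
        mul_comm]
      exact hmv
    calc ‖D κ x‖ ≤ _ := norm_sub_le _ _
      _ ≤ C * ((1 + ‖x‖) ^ (d + 1))⁻¹ + C * ((1 + ‖x‖) ^ (d + 1))⁻¹ := add_le_add h1 (hb κ₀ h0 x)
      _ = _ := by ring
  have hlim : Filter.Tendsto (fun κ => ∫ x, ‖D κ x‖ ^ 2) (nhdsWithin κ₀ {κ₀}ᶜ)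
      (nhds (∫ x : Conf d, (0 : ℝ))) := by
    refine tendsto_integral_filter_of_dominated_convergence
      (fun x => (2 * C) ^ 2 * ((1 + ‖x‖) ^ (d + 1))⁻¹) ?_ ?_ ?_ ?_
    · filter_upwards [hball] with κ hκ
      exact (((Lp.aestronglyMeasurable (slope G κ₀ κ - w)).congr (hD κ hκ)).norm.pow 2)
    · filter_upwards [hball, self_mem_nhdsWithin] with κ hκ hne
      refine Filter.Eventually.of_forall fun x => ?_
      have h1 : (1 : ℝ) ≤ (1 + ‖x‖) ^ (d + 1) := one_le_pow₀ (by linarith [norm_nonneg x])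
      have h2 : ((1 + ‖x‖) ^ (d + 1))⁻¹ ≤ 1 := inv_le_one_of_one_le₀ h1
      have h3 : 0 ≤ ((1 + ‖x‖) ^ (d + 1))⁻¹ := by positivity
      rw [Real.norm_of_nonneg (by positivity)]
      calc ‖D κ x‖ ^ 2 ≤ (2 * C * ((1 + ‖x‖) ^ (d + 1))⁻¹) ^ 2 := by
            gcongr; exact hDb κ hκ hne x
        _ = (2 * C) ^ 2 * (((1 + ‖x‖) ^ (d + 1))⁻¹ * ((1 + ‖x‖) ^ (d + 1))⁻¹) := by ring
        _ ≤ (2 * C) ^ 2 * ((1 + ‖x‖) ^ (d + 1))⁻¹ := by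
            gcongr; exact mul_le_of_le_one_left h3 h2
    · exact (integrable_one_add_norm_neg_pow d).const_mul _
    · refine Filter.Eventually.of_forall fun x => ?_
      have h1 := (hasDerivAt_iff_tendsto_slope.1 (hF κ₀ h0 x)).sub_const (F' κ₀ x)
      rw [sub_self] at h1
      simpa using (h1.norm.pow 2)
  have hsq : Filter.Tendsto (fun κ => ‖slope G κ₀ κ - w‖ ^ 2) (nhdsWithin κ₀ {κ₀}ᶜ) (nhds 0) := by
    rw [integral_zero] at hlim
    refine hlim.congr' ?_
    filter_upwards [hball] with κ hκ
    exact (hnorm κ hκ).symm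
  have := hsq.sqrt
  simpa using this

/-- Uniform decay of the pointwise derivative of `chirpOp` over bounded sets of parameters. The
inverse of the substitution is controlled by `K`, since boundedness of the parameters alone would
allow it to degenerate. -/
theorem norm_chirpOpDeriv_le (v : 𝓢(Conf d, ℂ)) {R K : ℝ} (hR : 0 ≤ R) (hK1 : 1 ≤ K) :
    ∃ C : ℝ, 0 ≤ C ∧ ∀ θ θ' : ChirpParam d, ‖θ‖ ≤ R → ‖θ'‖ ≤ R → (∀ x, ‖x‖ ≤ K * ‖θ.2.2.2.1 x‖) →
      ∀ x, ‖chirpOpDeriv θ θ' v x‖ ≤ C * ((1 + ‖x‖) ^ (d + 1))⁻¹ := by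
  -- of the `d + 3` powers, two absorb the quadratic factor and `d + 1` are left for integrability
  obtain ⟨C0, hC00, hC0⟩ := v.exists_one_add_norm_pow_mul_le (d + 3)
  obtain ⟨C1, hC1⟩ : ∃ C1 : ℝ, ∀ y, (1 + ‖y‖) ^ (d + 3) * ‖fderiv ℝ v y‖ ≤ C1 := by
    have h1 := SchwartzMap.one_add_le_sup_seminorm_apply (𝕜 := ℂ) (m := (d + 3, 1))
      (k := d + 3) (n := 1) le_rfl le_rfl v
    simp only [norm_iteratedFDeriv_one] at h1
    exact ⟨_, h1⟩
  have hC10 : 0 ≤ C1 := le_trans (by positivity) (hC1 0)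
  refine ⟨Real.exp R * (3 * R * C0 + 2 * R * C1) * (K * (1 + R)) ^ (d + 3), by positivity,
    fun θ θ' hθ hθ' hL x => ?_⟩
  obtain ⟨Q, q, c, L, l⟩ := θ
  obtain ⟨Q', q', c', L', l'⟩ := θ'
  simp only [Prod.norm_def, max_le_iff] at hθ hθ'
  obtain ⟨-, -, hc, hLR, hl⟩ := hθ
  obtain ⟨hQ', hq', hc', hL', hl'⟩ := hθ'
  simp only at hL
  set y := L x + l with hy
  have hxy : 1 + ‖x‖ ≤ K * (1 + R) * (1 + ‖y‖) := by
    have e1 : ‖L x‖ ≤ ‖y‖ + R := by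
      have : L x = y - l := by simp [hy]
      rw [this]; exact (norm_sub_le _ _).trans (by linarith)
    have e2 : ‖x‖ ≤ K * (‖y‖ + R) := (hL x).trans (by gcongr)
    have e3 : 0 ≤ K * R * ‖y‖ := by positivity
    nlinarith
  have hx0 : 1 ≤ 1 + ‖x‖ := by linarith [norm_nonneg x]
  have hchirp : ‖chirp Q q c x‖ ≤ Real.exp R := by
    rw [norm_chirp]
    exact Real.exp_le_exp.2 ((Complex.abs_im_le_norm c |> le_trans (le_abs_self _)).trans hc)
  have hpoly : ‖-Complex.I * (((inner ℝ x (Q' x) + inner ℝ q' x : ℝ) : ℂ) + c')‖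
      ≤ 3 * R * (1 + ‖x‖) ^ 2 := by
    rw [norm_mul, norm_neg, Complex.norm_I, one_mul]
    have t1 : |(inner ℝ x (Q' x) : ℝ)| ≤ ‖x‖ * (R * ‖x‖) :=
      (abs_real_inner_le_norm _ _).trans (by gcongr; exact Q'.le_of_opNorm_le hQ' x)
    have t2 : |(inner ℝ q' x : ℝ)| ≤ R * ‖x‖ :=
      (abs_real_inner_le_norm _ _).trans (by gcongr)
    refine (norm_add_le _ _).trans ?_
    rw [Complex.norm_real, Real.norm_eq_abs]
    have t3 := abs_add_le (inner ℝ x (Q' x) : ℝ) (inner ℝ q' x : ℝ)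
    have : 0 ≤ R * ‖x‖ := by positivity
    have : 0 ≤ R * ‖x‖ ^ 2 := by positivity
    nlinarith
  have hvec : ‖L' x + l'‖ ≤ 2 * R * (1 + ‖x‖) ^ 2 := by
    have t1 : ‖L' x‖ ≤ R * ‖x‖ := L'.le_of_opNorm_le hL' x
    refine (norm_add_le _ _).trans ?_
    have : 0 ≤ R * ‖x‖ := by positivity
    have : 0 ≤ R * ‖x‖ ^ 2 := by positivity
    nlinarith
  have hypos : 0 < (1 + ‖y‖) ^ (d + 3) := by positivity
  have hvy : ‖v y‖ ≤ C0 * ((1 + ‖y‖) ^ (d + 3))⁻¹ := by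
    rw [← div_eq_mul_inv, le_div_iff₀ hypos, mul_comm]; exact hC0 y
  have hdvy : ‖fderiv ℝ v y‖ ≤ C1 * ((1 + ‖y‖) ^ (d + 3))⁻¹ := by
    rw [← div_eq_mul_inv, le_div_iff₀ hypos, mul_comm]; exact hC1 y
  have hinv : ((1 + ‖y‖) ^ (d + 3))⁻¹ ≤ (K * (1 + R)) ^ (d + 3) * ((1 + ‖x‖) ^ (d + 3))⁻¹ := by
    rw [← div_eq_mul_inv, le_div_iff₀ (by positivity), inv_mul_le_iff₀ hypos, mul_comm, ← mul_pow]
    gcongr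
  have hfin : (1 + ‖x‖) ^ 2 * ((1 + ‖x‖) ^ (d + 3))⁻¹ = ((1 + ‖x‖) ^ (d + 1))⁻¹ := by
    rw [show d + 3 = (d + 1) + 2 by ring, pow_add]
    field_simp
  change ‖chirp Q q c x * (-Complex.I * (((inner ℝ x (Q' x) + inner ℝ q' x : ℝ) : ℂ) + c') * v y
    + fderiv ℝ v y (L' x + l'))‖ ≤ _
  calc _ ≤ Real.exp R * (3 * R * (1 + ‖x‖) ^ 2 * (C0 * ((1 + ‖y‖) ^ (d + 3))⁻¹)
        + C1 * ((1 + ‖y‖) ^ (d + 3))⁻¹ * (2 * R * (1 + ‖x‖) ^ 2)) := by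
        rw [norm_mul]
        refine mul_le_mul hchirp ((norm_add_le _ _).trans (add_le_add ?_ ?_)) (norm_nonneg _)
          (Real.exp_pos _).le
        · rw [norm_mul]
          exact mul_le_mul hpoly hvy (norm_nonneg _) (by positivity)
        · exact (ContinuousLinearMap.le_opNorm _ _).trans
            (mul_le_mul hdvy hvec (norm_nonneg _) (by positivity))
    _ = Real.exp R * (3 * R * C0 + 2 * R * C1) * (1 + ‖x‖) ^ 2 * ((1 + ‖y‖) ^ (d + 3))⁻¹ := by ring
    _ ≤ Real.exp R * (3 * R * C0 + 2 * R * C1) * (1 + ‖x‖) ^ 2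
        * ((K * (1 + R)) ^ (d + 3) * ((1 + ‖x‖) ^ (d + 3))⁻¹) := by gcongr
    _ = Real.exp R * (3 * R * C0 + 2 * R * C1) * (K * (1 + R)) ^ (d + 3)
        * ((1 + ‖x‖) ^ 2 * ((1 + ‖x‖) ^ (d + 3))⁻¹) := by ring
    _ = _ := by rw [hfin]

theorem continuous_chirpOpDeriv (θ θ' : ChirpParam d) (v : 𝓢(Conf d, ℂ)) :
    Continuous (chirpOpDeriv θ θ' v) := by
  have h1 := v.continuous
  have h2 : Continuous (fderiv ℝ v) := (v.smooth 1).continuous_fderiv (by simp)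
  unfold chirpOpDeriv chirp
  fun_prop

theorem memLp_chirpOpDeriv {θ : ChirpParam d} (hL : BoundedBelow θ.2.2.2.1) (θ' : ChirpParam d)
    (v : 𝓢(Conf d, ℂ)) : MemLp (chirpOpDeriv θ θ' v) 2 := by
  obtain ⟨K, hK1, hK⟩ := hL.exists_one_le
  obtain ⟨C, -, hC⟩ := norm_chirpOpDeriv_le v (R := max ‖θ‖ ‖θ'‖) (by positivity) hK1
  exact memLp_two_of_norm_le (continuous_chirpOpDeriv θ θ' v).aestronglyMeasurable
    (hC θ θ' (le_max_left _ _) (le_max_right _ _) hK)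

/-- Invertibility is an open condition, with a locally uniform bound for the inverse. -/
theorem BoundedBelow.eventually {L₀ : Conf d →L[ℝ] Conf d} (h : BoundedBelow L₀) :
    ∃ K : ℝ, 1 ≤ K ∧ ∀ᶠ L in nhds L₀, ∀ x, ‖x‖ ≤ K * ‖L x‖ := by
  obtain ⟨K, hK1, hK⟩ := h.exists_one_le
  refine ⟨2 * K, by linarith, ?_⟩
  have hpos : 0 < 1 / (2 * K) := by positivity
  filter_upwards [Metric.ball_mem_nhds L₀ hpos] with L hLb x
  have h1 : ‖L₀ x - L x‖ ≤ 1 / (2 * K) * ‖x‖ := by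
    have := (L₀ - L).le_opNorm x
    rw [sub_apply] at this
    refine this.trans (mul_le_mul_of_nonneg_right ?_ (norm_nonneg _))
    rw [norm_sub_rev, ← dist_eq_norm]
    exact (Metric.mem_ball.1 hLb).le
  have h2 : ‖L₀ x‖ ≤ ‖L x‖ + 1 / (2 * K) * ‖x‖ := by
    have := norm_add_le (L x) (L₀ x - L x)
    rw [add_sub_cancel] at this
    linarith
  have h3 := hK x
  have h4 : K * ‖L₀ x‖ ≤ K * ‖L x‖ + ‖x‖ / 2 := by
    calc K * ‖L₀ x‖ ≤ K * (‖L x‖ + 1 / (2 * K) * ‖x‖) := by gcongr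
      _ = _ := by field_simp
  linarith

/-- `L²`-differentiability of chirped substitutions of a Schwartz function along a `C¹` curve of
parameters. -/
theorem hasDerivAt_chirpOp {θ θ' : ℝ → ChirpParam d} {κ₀ : ℝ}
    (hθ : ∀ᶠ κ in nhds κ₀, HasDerivAt θ (θ' κ) κ) (hθ' : ContinuousAt θ' κ₀)
    (hL : BoundedBelow (θ κ₀).2.2.2.1) (v : 𝓢(Conf d, ℂ)) :
    HasDerivAt (fun κ => toL2 (chirpOp (θ κ) v)) (memLp_chirpOpDeriv hL (θ' κ₀) v).toLp κ₀ := by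
  obtain ⟨K, hK1, hK⟩ := hL.eventually
  have hc : ContinuousAt θ κ₀ := hθ.self_of_nhds.continuousAt
  have hcL : ContinuousAt (fun κ => (θ κ).2.2.2.1) κ₀ := by fun_prop
  let R := max ‖θ κ₀‖ ‖θ' κ₀‖ + 1
  have hR1 : ‖θ κ₀‖ < R := lt_of_le_of_lt (le_max_left _ _) (lt_add_one _)
  have hR2 : ‖θ' κ₀‖ < R := lt_of_le_of_lt (le_max_right _ _) (lt_add_one _)
  have hall : ∀ᶠ κ in nhds κ₀, HasDerivAt θ (θ' κ) κ ∧ ‖θ κ‖ ≤ R ∧ ‖θ' κ‖ ≤ R ∧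
      ∀ x, ‖x‖ ≤ K * ‖(θ κ).2.2.2.1 x‖ := by
    filter_upwards [hθ, hc.norm.eventually (gt_mem_nhds hR1), hθ'.norm.eventually (gt_mem_nhds hR2),
      hcL.eventually hK] with κ h1 h2 h3 h4
    exact ⟨h1, h2.le, h3.le, h4⟩
  obtain ⟨ε, hε, hball⟩ := Metric.eventually_nhds_iff_ball.1 hall
  obtain ⟨C, -, hC⟩ := norm_chirpOpDeriv_le v (R := R) (by positivity) hK1
  refine hasDerivAt_L2_of_dominated (C := C) hε
    (F := fun κ x => chirp (θ κ).1 (θ κ).2.1 (θ κ).2.2.1 x * v ((θ κ).2.2.2.1 x + (θ κ).2.2.2.2))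
    (F' := fun κ x => chirpOpDeriv (θ κ) (θ' κ) v x) (fun κ hκ => ?_) (MemLp.coeFn_toLp _)
    (fun κ hκ x => hasDerivAt_chirp_mul (hball κ hκ).1 v x)
    (fun κ hκ x => hC _ _ (hball κ hκ).2.1 (hball κ hκ).2.2.1 (hball κ hκ).2.2.2 x)
  refine (SchwartzMap.coeFn_toLp _ 2 volume).trans (Filter.Eventually.of_forall fun x => ?_)
  exact chirpOp_apply ⟨K, (hball κ hκ).2.2.2⟩ v x

end Oscillatory

/-! ### Parity operators and cross-Wigner functions -/

section Parity

variable {d : ℕ}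

/-- The parameters of the phase space reflection about `z`. -/
def parityParam (z : Conf d × Conf d) : ChirpParam d :=
  (0, (-2 : ℝ) • z.2, ((2 * inner ℝ z.1 z.2 : ℝ) : ℂ), -ContinuousLinearMap.id ℝ (Conf d),
    (2 : ℝ) • z.1)

/-- The parity operator about the phase space point `z = (p, ξ)`:
`u ↦ e^{2i⟨x-p,ξ⟩} u(2p - x)`. -/
def parity (z : Conf d × Conf d) : 𝓢(Conf d, ℂ) →L[ℂ] 𝓢(Conf d, ℂ) := chirpOp (parityParam z)

theorem boundedBelow_parityParam (z : Conf d × Conf d) : BoundedBelow (parityParam z).2.2.2.1 :=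
  ⟨1, fun x => by simp [parityParam]⟩

theorem parity_apply (z : Conf d × Conf d) (u : 𝓢(Conf d, ℂ)) (x : Conf d) :
    parity z u x = Complex.exp (Complex.I * ((2 * inner ℝ (x - z.1) z.2 : ℝ) : ℂ))
      * u ((2 : ℝ) • z.1 - x) := by
  rw [parity, chirpOp_apply (boundedBelow_parityParam z)]
  congr 1
  · simp only [parityParam, chirp, zero_apply, inner_zero_right, inner_smul_left, inner_sub_left,
      real_inner_comm x z.2]
    congr 1
    simp only [conj_trivial]
    push_cast
    ring
  · simp only [parityParam, neg_apply, ContinuousLinearMap.id_apply]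
    congr 1
    abel

theorem parity_parity (z : Conf d × Conf d) (u : 𝓢(Conf d, ℂ)) : parity z (parity z u) = u := by
  ext x
  rw [parity_apply, parity_apply, sub_sub_cancel, ← mul_assoc, ← Complex.exp_add]
  have : (2 : ℝ) • z.1 - x - z.1 = -(x - z.1) := by rw [two_smul]; abel
  rw [this, inner_neg_left]
  push_cast
  rw [show Complex.I * (2 * ((inner ℝ (x - z.1) z.2 : ℝ) : ℂ))
    + Complex.I * (2 * -((inner ℝ (x - z.1) z.2 : ℝ) : ℂ)) = 0 by ring, Complex.exp_zero, one_mul]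

theorem inner_toL2_eq_integral (v : 𝓢(Conf d, ℂ)) {w : L2 d} {g : Conf d → ℂ}
    (h : w =ᵐ[volume] g) : inner ℂ (toL2 v) w = ∫ x, starRingEnd ℂ (v x) * g x := by
  rw [L2.inner_def]
  refine integral_congr_ae ?_
  filter_upwards [h, SchwartzMap.coeFn_toLp v 2 volume] with x h1 h2
  rw [SchwartzMap.toLpCLM_apply, h1, h2, RCLike.inner_apply, mul_comm]

theorem inner_toL2_toL2 (v u : 𝓢(Conf d, ℂ)) :
    inner ℂ (toL2 v) (toL2 u) = ∫ x, starRingEnd ℂ (v x) * u x :=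
  inner_toL2_eq_integral v (SchwartzMap.coeFn_toLp u 2 volume)

theorem inner_toL2_parity (z : Conf d × Conf d) (v u : 𝓢(Conf d, ℂ)) :
    inner ℂ (toL2 v) (toL2 (parity z u)) = inner ℂ (toL2 (parity z v)) (toL2 u) := by
  rw [inner_toL2_toL2, inner_toL2_toL2,
    ← integral_sub_left_eq_self (fun x => starRingEnd ℂ (v x) * parity z u x) volume
      ((2 : ℝ) • z.1)]
  congr 1; ext x
  rw [parity_apply, parity_apply, sub_sub_cancel, map_mul, ← Complex.exp_conj]
  have : (2 : ℝ) • z.1 - x - z.1 = -(x - z.1) := by rw [two_smul]; abel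
  rw [this, inner_neg_left]
  simp only [map_mul, Complex.conj_I, Complex.conj_ofReal]
  push_cast
  rw [show Complex.I * (2 * -((inner ℝ (x - z.1) z.2 : ℝ) : ℂ))
    = -Complex.I * (2 * ((inner ℝ (x - z.1) z.2 : ℝ) : ℂ)) by ring]
  ring

theorem inner_toL2_parity_parity (z : Conf d × Conf d) (v u : 𝓢(Conf d, ℂ)) :
    inner ℂ (toL2 (parity z v)) (toL2 (parity z u)) = inner ℂ (toL2 v) (toL2 u) := by
  rw [inner_toL2_parity, parity_parity]

theorem norm_toL2_parity (z : Conf d × Conf d) (u : 𝓢(Conf d, ℂ)) :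
    ‖toL2 (parity z u)‖ = ‖toL2 u‖ := by
  rw [norm_eq_sqrt_re_inner (𝕜 := ℂ), norm_eq_sqrt_re_inner (𝕜 := ℂ), inner_toL2_parity_parity]

/-- The cross-Wigner function of `v` and `u`, up to normalization: the matrix element
`⟨v, Π_z u⟩` of the parity operator. -/
def crossWigner (v u : 𝓢(Conf d, ℂ)) (z : Conf d × Conf d) : ℂ :=
  ∫ x, starRingEnd ℂ (v x) * parity z u x

theorem inner_toL2_parity_eq_crossWigner (v u : 𝓢(Conf d, ℂ)) (z : Conf d × Conf d) :
    inner ℂ (toL2 v) (toL2 (parity z u)) = crossWigner v u z := inner_toL2_toL2 _ _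

theorem continuous_crossWigner_integrand (v u : 𝓢(Conf d, ℂ)) :
    Continuous (fun p : (Conf d × Conf d) × Conf d => starRingEnd ℂ (v p.2) * parity p.1 u p.2) := by
  simp only [parity_apply]
  have h1 : Continuous (fun p : (Conf d × Conf d) × Conf d => v p.2) :=
    v.continuous.comp continuous_snd
  have h2 : Continuous (fun p : (Conf d × Conf d) × Conf d => u ((2 : ℝ) • p.1.1 - p.2)) :=
    u.continuous.comp (by fun_prop)
  refine (Complex.continuous_conj.comp h1).mul (Continuous.mul ?_ h2)
  refine Complex.continuous_exp.comp (continuous_const.mul (Complex.continuous_ofReal.comp ?_))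
  fun_prop

theorem stronglyMeasurable_crossWigner (v u : 𝓢(Conf d, ℂ)) :
    StronglyMeasurable (crossWigner v u) :=
  (continuous_crossWigner_integrand v u).stronglyMeasurable.integral_prod_right'

theorem one_add_norm_center_le (p x : Conf d) :
    1 + ‖p‖ ≤ (1 + ‖x‖) * (1 + ‖(2 : ℝ) • p - x‖) := by
  have h1 : ‖(2 : ℝ) • p‖ ≤ ‖(2 : ℝ) • p - x‖ + ‖x‖ := by
    simpa using norm_add_le ((2 : ℝ) • p - x) x
  rw [norm_smul, Real.norm_of_nonneg (by norm_num)] at h1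
  nlinarith [norm_nonneg x, norm_nonneg ((2 : ℝ) • p - x), norm_nonneg p,
    mul_nonneg (norm_nonneg x) (norm_nonneg ((2 : ℝ) • p - x))]

theorem norm_parity_apply (z : Conf d × Conf d) (u : 𝓢(Conf d, ℂ)) (x : Conf d) :
    ‖parity z u x‖ = ‖u ((2 : ℝ) • z.1 - x)‖ := by
  rw [parity_apply, norm_mul, norm_exp_I_mul_ofReal_eq_one, one_mul]

/-- Decay in the position of the centre: at each `x` one of the points `x` and `2p - x` is at least
as far from the origin as `p`. -/
theorem norm_crossWigner_le_position (N : ℕ) (v u : 𝓢(Conf d, ℂ)) :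
    ∃ C, 0 ≤ C ∧ ∀ z : Conf d × Conf d, (1 + ‖z.1‖) ^ N * ‖crossWigner v u z‖ ≤ C := by
  obtain ⟨C, hC0, hC⟩ := u.exists_one_add_norm_pow_mul_le N
  refine ⟨∫ x, C * ((1 + ‖x‖) ^ N * ‖v x‖), by positivity, fun z => ?_⟩
  have : (1 + ‖z.1‖) ^ N * ‖crossWigner v u z‖
      = ‖∫ x, (((1 + ‖z.1‖) ^ N : ℝ) : ℂ) * (starRingEnd ℂ (v x) * parity z u x)‖ := by
    rw [integral_const_mul, norm_mul, Complex.norm_real, Real.norm_of_nonneg (by positivity)]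
    rfl
  rw [this]
  refine norm_integral_le_of_norm_le ((v.integrable_one_add_norm_pow_mul N).const_mul C)
    (Filter.Eventually.of_forall fun x => ?_)
  rw [norm_mul, norm_mul, Complex.norm_real, Real.norm_of_nonneg (by positivity),
    RCLike.norm_conj, norm_parity_apply]
  calc (1 + ‖z.1‖) ^ N * (‖v x‖ * ‖u ((2 : ℝ) • z.1 - x)‖)
      ≤ ((1 + ‖x‖) * (1 + ‖(2 : ℝ) • z.1 - x‖)) ^ N * (‖v x‖ * ‖u ((2 : ℝ) • z.1 - x)‖) := by
        gcongr; exact one_add_norm_center_le _ _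
    _ = ((1 + ‖(2 : ℝ) • z.1 - x‖) ^ N * ‖u ((2 : ℝ) • z.1 - x)‖) * ((1 + ‖x‖) ^ N * ‖v x‖) := by
        rw [mul_pow]; ring
    _ ≤ C * ((1 + ‖x‖) ^ N * ‖v x‖) := by gcongr; exact hC _

open LineDeriv in
theorem lineDeriv_parity (z : Conf d × Conf d) (u : 𝓢(Conf d, ℂ)) (h : Conf d) :
    (∂_{h} (parity z u) : 𝓢(Conf d, ℂ))
      = (2 * Complex.I * (inner ℝ z.2 h : ℝ)) • parity z u - parity z (∂_{h} u : 𝓢(Conf d, ℂ)) := by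
  ext x
  rw [SchwartzMap.lineDerivOp_apply_eq_fderiv]
  have h1 : HasFDerivAt (fun x : Conf d => (2 * inner ℝ (x - z.1) z.2 : ℝ))
      ((2 : ℝ) • innerSL ℝ z.2) x := by
    have := ((innerSL ℝ z.2).hasFDerivAt.comp x ((hasFDerivAt_id x).sub_const z.1)).const_smul (2 : ℝ)
    refine (this.congr_of_eventuallyEq (Filter.Eventually.of_forall fun y => ?_)).congr_fderiv ?_
    · simp [real_inner_comm]
    · ext; simp
  have h2 := ((Complex.ofRealCLM.hasFDerivAt.comp x h1).const_mul Complex.I).cexp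
  have h3 := (u.hasFDerivAt ((2 : ℝ) • z.1 - x)).comp x ((hasFDerivAt_id x).const_sub ((2 : ℝ) • z.1))
  have h4 := h2.mul h3
  have h5 : (parity z u : Conf d → ℂ) = (fun x => Complex.exp (Complex.I *
      ((2 * inner ℝ (x - z.1) z.2 : ℝ) : ℂ))) * (u ∘ fun x => (2 : ℝ) • z.1 - x) := by
    funext x; rw [parity_apply]; rfl
  have h6 := HasFDerivAt.fderiv (h4.congr_of_eventuallyEq (f₁ := parity z u)
    (Filter.Eventually.of_forall fun x => by rw [h5]; rfl))
  rw [h6]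
  simp [parity_apply, SchwartzMap.lineDerivOp_apply_eq_fderiv]
  ring

open LineDeriv in
theorem inner_toL2_lineDeriv (v u : 𝓢(Conf d, ℂ)) (h : Conf d) :
    inner ℂ (toL2 v) (toL2 (∂_{h} u : 𝓢(Conf d, ℂ)))
      = - inner ℂ (toL2 (∂_{h} v : 𝓢(Conf d, ℂ))) (toL2 u) := by
  have := SchwartzMap.integral_bilinear_lineDerivOp_right_eq_neg_left
    (μ := volume) v u
    ((ContinuousLinearMap.mul ℝ ℂ).comp (Complex.conjCLE : ℂ →L[ℝ] ℂ)) h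
  rw [inner_toL2_toL2, inner_toL2_toL2]
  simpa using this

open LineDeriv in
/-- Momentum factors in front of a cross-Wigner function are derivatives of its arguments, which
gives decay in the momentum of the centre. -/
theorem inner_mul_crossWigner (v u : 𝓢(Conf d, ℂ)) (z : Conf d × Conf d) (h : Conf d) :
    (inner ℝ z.2 h : ℝ) * crossWigner v u z = -Complex.I / 2 *
      (crossWigner v (∂_{h} u : 𝓢(Conf d, ℂ)) z - crossWigner (∂_{h} v : 𝓢(Conf d, ℂ)) u z) := by
  have h1 := inner_toL2_lineDeriv v (parity z u) h
  rw [lineDeriv_parity, map_sub, map_smul, inner_sub_right, inner_smul_right] at h1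
  simp only [inner_toL2_parity_eq_crossWigner] at h1
  linear_combination (-Complex.I / 2) * h1 + ((inner ℝ z.2 h : ℝ) * crossWigner v u z) * Complex.I_sq

open LineDeriv in
/-- Each power of `1 + ‖z.2‖` is traded for a derivative of one of the two functions. -/
theorem norm_crossWigner_le_aux (N k : ℕ) : ∀ v u : 𝓢(Conf d, ℂ),
    ∃ C, 0 ≤ C ∧ ∀ z : Conf d × Conf d,
      (1 + ‖z.2‖) ^ k * ((1 + ‖z.1‖) ^ N * ‖crossWigner v u z‖) ≤ C := by
  induction k with
  | zero => intro v u; simpa using norm_crossWigner_le_position N v u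
  | succ k ih =>
    intro v u
    let e := EuclideanSpace.basisFun (Fin d) ℝ
    obtain ⟨C, hC0, hC⟩ := ih v u
    choose C1 hC10 hC1 using fun i => ih v (∂_{e i} u : 𝓢(Conf d, ℂ))
    choose C2 hC20 hC2 using fun i => ih (∂_{e i} v : 𝓢(Conf d, ℂ)) u
    refine ⟨C + ∑ i, (C1 i + C2 i), add_nonneg hC0 (Finset.sum_nonneg fun i _ =>
      add_nonneg (hC10 i) (hC20 i)), fun z => ?_⟩
    have h1 : ∀ i, |(inner ℝ z.2 (e i) : ℝ)| * ‖crossWigner v u z‖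
        ≤ ‖crossWigner v (∂_{e i} u : 𝓢(Conf d, ℂ)) z‖
          + ‖crossWigner (∂_{e i} v : 𝓢(Conf d, ℂ)) u z‖ := fun i => by
      have := congrArg norm (inner_mul_crossWigner v u z (e i))
      rw [norm_mul, Complex.norm_real, Real.norm_eq_abs] at this
      rw [this, norm_mul]
      refine (mul_le_of_le_one_left (norm_nonneg _) ?_).trans (norm_sub_le _ _)
      simp; norm_num
    set w := ‖crossWigner v u z‖
    have h2 : ‖z.2‖ * w ≤ ∑ i, (‖crossWigner v (∂_{e i} u : 𝓢(Conf d, ℂ)) z‖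
          + ‖crossWigner (∂_{e i} v : 𝓢(Conf d, ℂ)) u z‖) := by
      calc ‖z.2‖ * w ≤ (∑ i, |(inner ℝ z.2 (e i) : ℝ)|) * w := by
            gcongr; exact Conf.norm_le_sum_abs_inner z.2
        _ ≤ _ := by rw [Finset.sum_mul]; exact Finset.sum_le_sum fun i _ => h1 i
    calc (1 + ‖z.2‖) ^ (k + 1) * ((1 + ‖z.1‖) ^ N * w)
        = (1 + ‖z.2‖) ^ k * (1 + ‖z.1‖) ^ N * (w + ‖z.2‖ * w) := by ring
      _ ≤ (1 + ‖z.2‖) ^ k * (1 + ‖z.1‖) ^ N * (w + ∑ i,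
          (‖crossWigner v (∂_{e i} u : 𝓢(Conf d, ℂ)) z‖
          + ‖crossWigner (∂_{e i} v : 𝓢(Conf d, ℂ)) u z‖)) := by gcongr
      _ = (1 + ‖z.2‖) ^ k * ((1 + ‖z.1‖) ^ N * w) + ∑ i, ((1 + ‖z.2‖) ^ k * ((1 + ‖z.1‖) ^ N *
          ‖crossWigner v (∂_{e i} u : 𝓢(Conf d, ℂ)) z‖)
          + (1 + ‖z.2‖) ^ k * ((1 + ‖z.1‖) ^ N *
            ‖crossWigner (∂_{e i} v : 𝓢(Conf d, ℂ)) u z‖)) := by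
        rw [mul_add, Finset.mul_sum, mul_assoc]
        congr 1
        exact Finset.sum_congr rfl fun i _ => by ring
      _ ≤ C + ∑ i, (C1 i + C2 i) :=
        add_le_add (hC z) (Finset.sum_le_sum fun i _ => add_le_add (hC1 i z) (hC2 i z))

/-- Cross-Wigner functions of Schwartz functions decay rapidly. -/
theorem norm_crossWigner_le (N : ℕ) (v u : 𝓢(Conf d, ℂ)) :
    ∃ C, 0 ≤ C ∧ ∀ z : Conf d × Conf d, ‖crossWigner v u z‖
      ≤ C * (((1 + ‖z.1‖) ^ N)⁻¹ * ((1 + ‖z.2‖) ^ N)⁻¹) := by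
  obtain ⟨C, hC0, hC⟩ := norm_crossWigner_le_aux N N v u
  refine ⟨C, hC0, fun z => ?_⟩
  rw [← mul_inv, ← div_eq_mul_inv, le_div_iff₀ (by positivity)]
  calc _ = _ := by ring
    _ ≤ C := hC z

theorem IsSymbolOfOrder.integrable_mul_crossWigner {m : ℕ} {a : Conf d → Conf d → ℝ}
    (ha : IsSymbolOfOrder m a) (v u : 𝓢(Conf d, ℂ)) :
    Integrable (fun z : Conf d × Conf d => (a z.1 z.2 : ℂ) * crossWigner v u z) := by
  obtain ⟨K, hK0, hK⟩ := ha.norm_le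
  obtain ⟨C, hC0, hC⟩ := norm_crossWigner_le (m + (d + 1)) v u
  refine (((integrable_one_add_norm_neg_pow d).mul_prod
    (integrable_one_add_norm_neg_pow d)).const_mul (K * C)).mono' ?_
    (Filter.Eventually.of_forall fun z => ?_)
  · exact ((Complex.continuous_ofReal.comp ha.continuous).stronglyMeasurable.mul
      (stronglyMeasurable_crossWigner v u)).aestronglyMeasurable
  · rw [norm_mul, Complex.norm_real]
    calc ‖a z.1 z.2‖ * ‖crossWigner v u z‖
        ≤ (K * (1 + ‖z.1‖) ^ m * (1 + ‖z.2‖) ^ m)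
          * (C * (((1 + ‖z.1‖) ^ (m + (d + 1)))⁻¹ * ((1 + ‖z.2‖) ^ (m + (d + 1)))⁻¹)) :=
          mul_le_mul (hK _ _) (hC z) (norm_nonneg _) (by positivity)
      _ = _ := by
          simp only [pow_add _ m (d + 1)]
          field_simp

/-- The substitution `y = 2p - x`, where `p` is the midpoint of `x` and `y`. -/
theorem integral_comp_two_smul_sub (g : Conf d → ℂ) (x : Conf d) :
    ∫ y, g y = (2 : ℂ) ^ d * ∫ p, g ((2 : ℝ) • p - x) := by
  have h1 := Measure.integral_comp_smul volume (fun y => g (y - x)) (2 : ℝ)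
  rw [integral_sub_right_eq_self (fun y => g y) x, finrank_euclideanSpace_fin,
    abs_of_pos (by positivity), Complex.real_smul] at h1
  rw [h1, ← mul_assoc]
  push_cast
  rw [mul_inv_cancel₀ (pow_ne_zero _ two_ne_zero), one_mul]

theorem integrable_mul_comp_two_smul_sub {f g : Conf d → ℝ} (hf : Integrable f) (hg : Integrable g)
    (hfc : Continuous f) (hgc : Continuous g) :
    Integrable (fun q : Conf d × Conf d => f q.1 * g ((2 : ℝ) • q.2 - q.1)) := by
  have hsec : ∀ x, Integrable (fun p => g ((2 : ℝ) • p - x)) := fun x =>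
    ((hg.comp_sub_right x).comp_smul (R := (2 : ℝ)) (by norm_num))
  have hm : AEStronglyMeasurable (fun q : Conf d × Conf d => f q.1 * g ((2 : ℝ) • q.2 - q.1))
      (volume.prod volume) := by
    have : Continuous (fun q : Conf d × Conf d => f q.1 * g ((2 : ℝ) • q.2 - q.1)) := by fun_prop
    exact this.aestronglyMeasurable
  refine (integrable_prod_iff hm).2 ⟨Filter.Eventually.of_forall fun x => by
    exact (hsec x).const_mul (f x), ?_⟩
  have : ∀ x, ∫ p, ‖f x * g ((2 : ℝ) • p - x)‖
      = ‖f x‖ * (|((2 : ℝ) ^ d)⁻¹| * ∫ y, ‖g y‖) := fun x => by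
    simp only [norm_mul]
    rw [integral_const_mul]
    have h1 := Measure.integral_comp_smul volume (fun y => ‖g (y - x)‖) (2 : ℝ)
    rw [integral_sub_right_eq_self (fun y => ‖g y‖) x, finrank_euclideanSpace_fin] at h1
    simp only [Real.norm_eq_abs] at h1 ⊢
    rw [h1, smul_eq_mul]
  simp only [this]
  exact hf.norm.mul_const _

/-- The sesquilinear form of a Weyl operator is the phase space average of parity operators against
its symbol. Through this formula properties of parity operators pass to Weyl operators. -/
theorem IsSymbolOfOrder.integral_conj_mul_weylOp {m : ℕ} {a : Conf d → Conf d → ℝ}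
    (ha : IsSymbolOfOrder m a) (v u : 𝓢(Conf d, ℂ)) :
    ∫ x, starRingEnd ℂ (v x) * weylOp a u x
      = ((Real.pi ^ d : ℝ) : ℂ)⁻¹ * ∫ z : Conf d × Conf d, (a z.1 z.2 : ℂ) * crossWigner v u z := by
  -- Fubini for the outer integrals
  obtain ⟨C, hC0, hC⟩ := ha.pow_mul_norm_weylInner_le u (d + 1)
  have i1 : Integrable (fun q : Conf d × Conf d => starRingEnd ℂ (v q.1) * weylInner a u q.1 q.2)
      (volume.prod volume) := by
    refine ((((v.integrable_one_add_norm_pow_mul m)).mul_prod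
      (integrable_one_add_norm_neg_pow d)).const_mul C).mono' ?_
      (Filter.Eventually.of_forall fun q => ?_)
    · refine StronglyMeasurable.aestronglyMeasurable (StronglyMeasurable.mul ?_
        (ha.stronglyMeasurable_weylInner u))
      exact (Complex.continuous_conj.comp (v.continuous.comp continuous_fst)).stronglyMeasurable
    · rw [norm_mul, RCLike.norm_conj]
      calc ‖v q.1‖ * ‖weylInner a u q.1 q.2‖
          ≤ ‖v q.1‖ * (C * (1 + ‖q.1‖) ^ m * ((1 + ‖q.2‖) ^ (d + 1))⁻¹) := by
            gcongr; exact hC _ _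
        _ = _ := by ring
  have e1 : ∫ x, starRingEnd ℂ (v x) * weylOp a u x
      = (((2 * Real.pi) ^ d : ℝ)⁻¹ : ℝ) * ∫ ξ, ∫ x, starRingEnd ℂ (v x) * weylInner a u x ξ := by
    rw [← integral_integral_swap i1, ← integral_const_mul]
    congr 1; ext x
    rw [integral_const_mul, weylOp_eq_integral_weylInner]; ring
  -- Fubini for the inner integrals, in midpoint coordinates
  have e2 : ∀ ξ, ∫ x, starRingEnd ℂ (v x) * weylInner a u x ξ
      = (2 : ℂ) ^ d * ∫ p, (a p ξ : ℂ) * crossWigner v u (p, ξ) := fun ξ => by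
    have hin : ∀ x, weylInner a u x ξ = (2 : ℂ) ^ d * ∫ p, (a p ξ : ℂ) * parity (p, ξ) u x := by
      intro x
      rw [weylInner, integral_comp_two_smul_sub _ x]
      congr 1
      refine integral_congr_ae (Filter.Eventually.of_forall fun p => ?_)
      beta_reduce
      rw [parity_apply]
      have t1 : (1 / 2 : ℝ) • (x + ((2 : ℝ) • p - x)) = p := by
        rw [add_sub_cancel, smul_smul]; norm_num
      have t2 : x - ((2 : ℝ) • p - x) = (2 : ℝ) • (x - p) := by
        rw [two_smul, two_smul]; abel
      rw [t1, t2, real_inner_smul_left]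
      ring
    have i2 : Integrable (fun q : Conf d × Conf d =>
        starRingEnd ℂ (v q.1) * ((a q.2 ξ : ℂ) * parity (q.2, ξ) u q.1)) (volume.prod volume) := by
      obtain ⟨K, hK0, hK⟩ := ha.norm_le
      refine ((integrable_mul_comp_two_smul_sub (v.integrable_one_add_norm_pow_mul m)
        (u.integrable_one_add_norm_pow_mul m) (by have := v.continuous; fun_prop)
        (by have := u.continuous; fun_prop)).const_mul (K * (1 + ‖ξ‖) ^ m)).mono' ?_
        (Filter.Eventually.of_forall fun q => ?_)
      · have c1 : Continuous (fun q : Conf d × Conf d => (a q.2 ξ : ℂ)) :=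
          Complex.continuous_ofReal.comp (ha.continuous.comp
            (f := fun q : Conf d × Conf d => (q.2, ξ)) (by fun_prop))
        have c2 := (continuous_crossWigner_integrand v u).comp
          (f := fun q : Conf d × Conf d => ((q.2, ξ), q.1)) (by fun_prop)
        refine ((c1.mul c2).congr fun q => ?_).aestronglyMeasurable
        change (a q.2 ξ : ℂ) * (starRingEnd ℂ (v q.1) * parity (q.2, ξ) u q.1) = _
        ring
      · rw [norm_mul, norm_mul, RCLike.norm_conj, norm_parity_apply, Complex.norm_real]
        calc ‖v q.1‖ * (‖a q.2 ξ‖ * ‖u ((2 : ℝ) • q.2 - q.1)‖)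
            ≤ ‖v q.1‖ * ((K * ((1 + ‖q.1‖) * (1 + ‖(2 : ℝ) • q.2 - q.1‖)) ^ m * (1 + ‖ξ‖) ^ m)
                * ‖u ((2 : ℝ) • q.2 - q.1)‖) := by
              gcongr
              refine (hK q.2 ξ).trans ?_
              gcongr
              exact one_add_norm_center_le _ _
          _ = _ := by rw [mul_pow]; ring
    calc ∫ x, starRingEnd ℂ (v x) * weylInner a u x ξ
        = ∫ x, (2 : ℂ) ^ d * ∫ p, starRingEnd ℂ (v x) * ((a p ξ : ℂ) * parity (p, ξ) u x) := by
          congr 1; ext x; rw [hin, integral_const_mul]; ring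
      _ = (2 : ℂ) ^ d * ∫ p, ∫ x, starRingEnd ℂ (v x) * ((a p ξ : ℂ) * parity (p, ξ) u x) := by
          rw [integral_const_mul, integral_integral_swap i2]
      _ = _ := by
          congr 2; ext p
          rw [crossWigner, ← integral_const_mul]
          congr 1; ext x; ring
  rw [e1]
  simp only [e2]
  rw [integral_const_mul, Measure.volume_eq_prod,
    integral_prod_symm _ (ha.integrable_mul_crossWigner v u), ← mul_assoc]
  congr 1
  push_cast
  rw [mul_pow]
  field_simp

end Parity

/-! ### Weyl operators with values in `L²` -/

section WeylL2

variable {d m : ℕ} {a b : Conf d → Conf d → ℝ}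

open Classical in
/-- The Weyl operator of a symbol as an element of `L²` (zero if `weylOp a u` is not square
integrable, which does not happen for symbols). -/
def weylLp (a : Conf d → Conf d → ℝ) (u : 𝓢(Conf d, ℂ)) : L2 d :=
  if h : MemLp (weylOp a u) 2 volume then h.toLp else 0

theorem IsSymbolOfOrder.coeFn_weylLp (ha : IsSymbolOfOrder m a) (u : 𝓢(Conf d, ℂ)) :
    weylLp a u =ᵐ[volume] weylOp a u := by
  rw [weylLp, dif_pos (ha.memLp_weylOp u)]
  exact MemLp.coeFn_toLp _

theorem IsSymbolOfOrder.weylLp_eq (ha : IsSymbolOfOrder m a) (u : 𝓢(Conf d, ℂ)) {w : L2 d}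
    (h : w =ᵐ[volume] weylOp a u) : w = weylLp a u :=
  Lp.ext (h.trans (ha.coeFn_weylLp u).symm)

/-- The matrix elements of a Weyl operator, as averages of parity operators. -/
theorem IsSymbolOfOrder.inner_weylLp (ha : IsSymbolOfOrder m a) (v u : 𝓢(Conf d, ℂ)) :
    inner ℂ (toL2 v) (weylLp a u)
      = ((Real.pi ^ d : ℝ) : ℂ)⁻¹ * ∫ z : Conf d × Conf d, (a z.1 z.2 : ℂ) * crossWigner v u z := by
  rw [inner_toL2_eq_integral v (ha.coeFn_weylLp u), ha.integral_conj_mul_weylOp]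

/-- Parity operators are self-adjoint. -/
theorem conj_crossWigner (v u : 𝓢(Conf d, ℂ)) (z : Conf d × Conf d) :
    starRingEnd ℂ (crossWigner v u z) = crossWigner u v z := by
  rw [← inner_toL2_parity_eq_crossWigner, ← inner_toL2_parity_eq_crossWigner, inner_conj_symm,
    inner_toL2_parity]

/-- Weyl operators of real symbols are symmetric. -/
theorem IsSymbolOfOrder.inner_weylLp_left (ha : IsSymbolOfOrder m a) (v u : 𝓢(Conf d, ℂ)) :
    inner ℂ (weylLp a v) (toL2 u) = inner ℂ (toL2 v) (weylLp a u) := by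
  rw [← inner_conj_symm, ha.inner_weylLp, ha.inner_weylLp, map_mul, ← integral_conj, map_inv₀,
    Complex.conj_ofReal]
  congr 2; ext z
  rw [map_mul, Complex.conj_ofReal, conj_crossWigner]

theorem denseRange_toL2 : DenseRange (toL2 : 𝓢(Conf d, ℂ) → L2 d) :=
  SchwartzMap.denseRange_toLpCLM ENNReal.ofNat_ne_top

theorem toL2_injective : Function.Injective (toL2 : 𝓢(Conf d, ℂ) → L2 d) :=
  SchwartzMap.injective_toLp 2 volume

theorem ext_inner_toL2 {w w' : L2 d}
    (h : ∀ v : 𝓢(Conf d, ℂ), inner ℂ (toL2 v) w = inner ℂ (toL2 v) w') : w = w' :=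
  ext_inner_left ℂ fun x => congrFun (DenseRange.equalizer denseRange_toL2
    (g := fun x : L2 d => inner ℂ x w) (h := fun x : L2 d => inner ℂ x w') (by fun_prop)
    (by fun_prop) (funext h)) x

theorem IsSymbolOfOrder.weylLp_add_symbol (ha : IsSymbolOfOrder m a) (hb : IsSymbolOfOrder m b)
    (u : 𝓢(Conf d, ℂ)) :
    weylLp (fun x ξ => a x ξ + b x ξ) u = weylLp a u + weylLp b u := by
  refine ((ha.add hb).weylLp_eq u ?_).symm
  filter_upwards [Lp.coeFn_add (weylLp a u) (weylLp b u), ha.coeFn_weylLp u, hb.coeFn_weylLp u]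
    with x h1 h2 h3
  rw [h1, Pi.add_apply, h2, h3]
  exact (weylOp_add_symbol ha hb u x).symm

theorem IsSymbolOfOrder.weylLp_const_mul_symbol (ha : IsSymbolOfOrder m a) (c : ℝ)
    (u : 𝓢(Conf d, ℂ)) :
    weylLp (fun x ξ => c * a x ξ) u = c • weylLp a u := by
  refine ((ha.const_mul c).weylLp_eq u ?_).symm
  filter_upwards [Lp.coeFn_smul c (weylLp a u), ha.coeFn_weylLp u] with x h1 h2
  rw [h1, Pi.smul_apply, h2, weylOp_const_mul_symbol, Complex.real_smul]

/-- Two curves of Schwartz functions that satisfy `i dφ/dκ = a^w φ` have constant scalar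
product. -/
theorem IsSymbolOfOrder.inner_eq_of_hasDerivAt (ha : IsSymbolOfOrder m a) {s : Set ℝ}
    (hs : Convex ℝ s) {φ χ : ℝ → 𝓢(Conf d, ℂ)}
    (hφ : ∀ κ ∈ s, HasDerivAt (fun κ => toL2 (φ κ)) (-Complex.I • weylLp a (φ κ)) κ)
    (hχ : ∀ κ ∈ s, HasDerivAt (fun κ => toL2 (χ κ)) (-Complex.I • weylLp a (χ κ)) κ)
    {κ κ' : ℝ} (hκ : κ ∈ s) (hκ' : κ' ∈ s) :
    inner ℂ (toL2 (φ κ)) (toL2 (χ κ)) = inner ℂ (toL2 (φ κ')) (toL2 (χ κ')) := by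
  have hd : ∀ κ ∈ s, HasDerivAt (fun κ => inner ℂ (toL2 (φ κ)) (toL2 (χ κ))) 0 κ := by
    intro κ hκ
    have := (hφ κ hκ).inner ℂ (hχ κ hκ)
    refine this.congr_deriv ?_
    rw [inner_smul_left, inner_smul_right, ha.inner_weylLp_left]
    simp
  have := hs.norm_image_sub_le_of_norm_hasDerivWithin_le
    (fun κ hκ => (hd κ hκ).hasDerivWithinAt) (C := 0) (fun κ hκ => by simp) hκ' hκ
  rw [zero_mul, norm_le_zero_iff, sub_eq_zero] at this
  exact this

/-- Uniqueness for `i dφ/dκ = a^w φ` among curves of Schwartz functions. -/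
theorem IsSymbolOfOrder.eq_of_hasDerivAt (ha : IsSymbolOfOrder m a) {s : Set ℝ}
    (hs : Convex ℝ s) {φ χ : ℝ → 𝓢(Conf d, ℂ)}
    (hφ : ∀ κ ∈ s, HasDerivAt (fun κ => toL2 (φ κ)) (-Complex.I • weylLp a (φ κ)) κ)
    (hχ : ∀ κ ∈ s, HasDerivAt (fun κ => toL2 (χ κ)) (-Complex.I • weylLp a (χ κ)) κ)
    {κ κ' : ℝ} (hκ : κ ∈ s) (hκ' : κ' ∈ s) (h : φ κ' = χ κ') : φ κ = χ κ := by
  apply toL2_injective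
  have h1 := ha.inner_eq_of_hasDerivAt hs hφ hφ hκ hκ'
  have h2 := ha.inner_eq_of_hasDerivAt hs hφ hχ hκ hκ'
  have h3 := ha.inner_eq_of_hasDerivAt hs hχ hφ hκ hκ'
  have h4 := ha.inner_eq_of_hasDerivAt hs hχ hχ hκ hκ'
  rw [← sub_eq_zero, ← inner_self_eq_zero (𝕜 := ℂ), inner_sub_sub_self, h1, h2, h3, h4, h]
  ring

end WeylL2

/-! ### Strong differentiability of operator families -/

section ProductRule

/-- Product rule for a locally bounded family of operators that is differentiable at the single
vector `v κ₀` and continuous at the single vector `v'`. The space `W` is seminormed through `e`;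
in the applications it is the Schwartz space with the norm of `L²`. -/
theorem hasDerivAt_apply_of_norm_le {W E F : Type*} [AddCommGroup W] [Module ℝ W]
    [NormedAddCommGroup E] [NormedSpace ℝ E] [NormedAddCommGroup F] [NormedSpace ℝ F]
    (e : W →ₗ[ℝ] E) {T : ℝ → W →ₗ[ℝ] F} {M κ₀ : ℝ} {v : ℝ → W} {v' : W} {D : F}
    (hT : ∀ᶠ κ in nhds κ₀, ∀ w, ‖T κ w‖ ≤ M * ‖e w‖)
    (hD : HasDerivAt (fun κ => T κ (v κ₀)) D κ₀) (hc : ContinuousAt (fun κ => T κ v') κ₀)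
    (hv : HasDerivAt (fun κ => e (v κ)) (e v') κ₀) :
    HasDerivAt (fun κ => T κ (v κ)) (D + T κ₀ v') κ₀ := by
  have h1 : HasDerivAt (fun κ => (κ - κ₀) • T κ v') (T κ₀ v') κ₀ := by
    rw [hasDerivAt_iff_tendsto_slope]
    refine (hc.tendsto.mono_left nhdsWithin_le_nhds).congr' ?_
    filter_upwards [self_mem_nhdsWithin] with κ hκ
    rw [slope_def_module, sub_self, zero_smul, sub_zero, smul_smul,
      inv_mul_cancel₀ (sub_ne_zero.2 hκ), one_smul]
  have h2 : HasDerivAt (fun κ => T κ (v κ - v κ₀ - (κ - κ₀) • v')) 0 κ₀ := by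
    rw [hasDerivAt_iff_isLittleO]
    rw [hasDerivAt_iff_isLittleO] at hv
    refine Asymptotics.IsBigO.trans_isLittleO ?_ hv
    refine Asymptotics.IsBigO.of_bound M ?_
    filter_upwards [hT] with κ hκ
    refine le_trans (le_of_eq ?_) ((hκ (v κ - v κ₀ - (κ - κ₀) • v')).trans (le_of_eq ?_))
    · simp
    · simp
  refine (((hD.add h1).add h2).congr_deriv (by simp)).congr_of_eventuallyEq
    (Filter.Eventually.of_forall fun κ => ?_)
  simp only [Pi.add_apply, map_sub, map_smul]
  abel

/-- Isometries that converge on a dense set converge strongly. -/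
theorem continuousAt_apply_of_dense {X E F W : Type*} [TopologicalSpace X]
    [NormedAddCommGroup E] [NormedSpace ℂ E] [NormedAddCommGroup F] [NormedSpace ℂ F]
    {T : X → E →ₗᵢ[ℂ] F} {x₀ : X} {e : W → E} (he : DenseRange e)
    (h : ∀ u, ContinuousAt (fun x => T x (e u)) x₀) (w : E) :
    ContinuousAt (fun x => T x w) x₀ := by
  rw [Metric.continuousAt_iff']
  intro ε hε
  obtain ⟨u, hu⟩ := he.exists_dist_lt w (ε := ε / 3) (by positivity)
  filter_upwards [Metric.continuousAt_iff'.1 (h u) (ε / 3) (by positivity)] with x hx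
  calc dist (T x w) (T x₀ w)
      ≤ dist (T x w) (T x (e u)) + dist (T x (e u)) (T x₀ (e u)) + dist (T x₀ (e u)) (T x₀ w) :=
        dist_triangle4 _ _ _ _
    _ < ε / 3 + ε / 3 + ε / 3 := by
        rw [(T x).dist_map, (T x₀).dist_map, dist_comm (e u) w]
        gcongr
    _ = ε := by ring

end ProductRule

/-! ### `L²` bounds for chirped substitutions -/

section ChirpBound

variable {d : ℕ}

theorem norm_sq_toL2 (v : 𝓢(Conf d, ℂ)) : ‖toL2 v‖ ^ 2 = ∫ x, ‖v x‖ ^ 2 := by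
  have h1 : ((‖toL2 v‖ ^ 2 : ℝ) : ℂ) = ((∫ x, ‖v x‖ ^ 2 : ℝ) : ℂ) := by
    have h2 := inner_self_eq_norm_sq_to_K (𝕜 := ℂ) (toL2 v)
    push_cast
    rw [← integral_complex_ofReal]
    refine h2.symm.trans ?_
    rw [inner_toL2_toL2]
    congr 1; ext x
    rw [RCLike.conj_mul]
    push_cast; rfl
  exact_mod_cast h1

theorem integral_comp_affine {E F : Type*} [NormedAddCommGroup E] [NormedSpace ℝ E]
    [FiniteDimensional ℝ E] [MeasurableSpace E] [BorelSpace E] (μ : Measure E) [μ.IsAddHaarMeasure]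
    [NormedAddCommGroup F] [NormedSpace ℝ F]
    {L : E →L[ℝ] E} (hL : L.det ≠ 0) (l : E) {g : E → F} (hg : StronglyMeasurable g) :
    ∫ x, g (L x + l) ∂μ = |L.det|⁻¹ • ∫ x, g x ∂μ := by
  have h1 := Measure.map_linearMap_addHaar_eq_smul_addHaar μ (f := (L : E →ₗ[ℝ] E)) hL
  have h2 : ∫ x, g (x + l) ∂(Measure.map (L : E →ₗ[ℝ] E) μ) = ∫ x, g (L x + l) ∂μ :=
    integral_map L.continuous.aemeasurable
      (hg.comp_measurable (measurable_add_const l)).aestronglyMeasurable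
  rw [← h2, h1, integral_smul_measure, integral_add_right_eq_self,
    ENNReal.toReal_ofReal (abs_nonneg _), abs_inv]

theorem BoundedBelow.det_ne_zero {L : Conf d →L[ℝ] Conf d} (h : BoundedBelow L) : L.det ≠ 0 := by
  obtain ⟨K, hK⟩ := h
  intro h0
  obtain ⟨x, hx, hx0⟩ := (Submodule.ne_bot_iff _).1
    (LinearMap.bot_lt_ker_of_det_eq_zero (f := (L : Conf d →ₗ[ℝ] Conf d)) h0).ne'
  refine hx0 (norm_le_zero_iff.1 ((hK x).trans ?_))
  have : L x = 0 := hx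
  rw [this, norm_zero, mul_zero]

/-- Up to the imaginary part of `c`, a chirped substitution changes the norm by the Jacobian only. -/
theorem norm_sq_toL2_chirpOp {θ : ChirpParam d} (hL : BoundedBelow θ.2.2.2.1) (v : 𝓢(Conf d, ℂ)) :
    ‖toL2 (chirpOp θ v)‖ ^ 2
      = Real.exp (θ.2.2.1.im) ^ 2 * |θ.2.2.2.1.det|⁻¹ * ‖toL2 v‖ ^ 2 := by
  rw [norm_sq_toL2, norm_sq_toL2]
  simp only [chirpOp_apply hL, norm_mul, norm_chirp, mul_pow]
  rw [integral_const_mul, integral_comp_affine volume hL.det_ne_zero θ.2.2.2.2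
    (g := fun x => ‖v x‖ ^ 2) (by have := v.continuous; fun_prop), smul_eq_mul, mul_assoc]

/-- Chirped substitutions are bounded in `L²`, locally uniformly in the parameters. -/
theorem eventually_norm_toL2_chirpOp_le {θ : ℝ → ChirpParam d} {κ₀ : ℝ} (hθ : ContinuousAt θ κ₀)
    (hL : BoundedBelow (θ κ₀).2.2.2.1) :
    ∃ M, ∀ᶠ κ in nhds κ₀, ∀ v, ‖toL2 (chirpOp (θ κ) v)‖ ≤ M * ‖toL2 v‖ := by
  let N : ℝ → ℝ := fun κ => Real.exp ((θ κ).2.2.1.im) ^ 2 * |(θ κ).2.2.2.1.det|⁻¹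
  have hdet : Continuous (fun L : Conf d →L[ℝ] Conf d => L.det) := ContinuousLinearMap.continuous_det
  have hN : ContinuousAt N κ₀ := by
    have h1 : ContinuousAt (fun κ => (θ κ).2.2.2.1) κ₀ := by fun_prop
    have h2 : ContinuousAt (fun κ => (θ κ).2.2.2.1.det) κ₀ := hdet.continuousAt.comp h1
    have h3 : ContinuousAt (fun κ => (θ κ).2.2.1.im) κ₀ :=
      Complex.continuous_im.continuousAt.comp (by fun_prop)
    exact ((Real.continuous_exp.continuousAt.comp h3).pow 2).mul
      (h2.abs.inv₀ (abs_ne_zero.2 hL.det_ne_zero))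
  obtain ⟨K, hK1, hK⟩ := hL.eventually
  have hcL : ContinuousAt (fun κ => (θ κ).2.2.2.1) κ₀ := by fun_prop
  refine ⟨Real.sqrt (N κ₀ + 1), ?_⟩
  filter_upwards [hN.eventually (gt_mem_nhds (lt_add_one (N κ₀))), hcL.eventually hK]
    with κ h1 h2 v
  have h3 := norm_sq_toL2_chirpOp ⟨K, h2⟩ v
  refine abs_le_of_sq_le_sq' ?_ (by positivity) |>.2
  rw [h3, mul_pow, Real.sq_sqrt (by positivity)]
  exact mul_le_mul_of_nonneg_right h1.le (by positivity)

/-- Product rule for chirped substitutions applied to a curve of Schwartz functions. -/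
theorem hasDerivAt_chirpOp_apply {θ θ' : ℝ → ChirpParam d} {κ₀ : ℝ}
    (hθ : ∀ᶠ κ in nhds κ₀, HasDerivAt θ (θ' κ) κ) (hθ' : ContinuousAt θ' κ₀)
    (hL : BoundedBelow (θ κ₀).2.2.2.1) {v : ℝ → 𝓢(Conf d, ℂ)} {v' : 𝓢(Conf d, ℂ)}
    (hv : HasDerivAt (fun κ => toL2 (v κ)) (toL2 v') κ₀) :
    HasDerivAt (fun κ => toL2 (chirpOp (θ κ) (v κ)))
      ((memLp_chirpOpDeriv hL (θ' κ₀) (v κ₀)).toLp + toL2 (chirpOp (θ κ₀) v')) κ₀ := by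
  obtain ⟨M, hM⟩ := eventually_norm_toL2_chirpOp_le hθ.self_of_nhds.continuousAt hL
  exact hasDerivAt_apply_of_norm_le (toL2 (d := d) |>.toLinearMap.restrictScalars ℝ)
    (T := fun κ => ((toL2 (d := d)).comp (chirpOp (θ κ))).toLinearMap.restrictScalars ℝ) hM
    (hasDerivAt_chirpOp hθ hθ' hL (v κ₀)) (hasDerivAt_chirpOp hθ hθ' hL v').continuousAt hv

end ChirpBound

/-! ### Short-time propagators of quadratic Hamiltonians -/

section LocalPropagator

variable {d : ℕ}

local notation "bas" => EuclideanSpace.basisFun (Fin d) ℝ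

/-- The adjoint as a real linear map. -/
def adjointCLM (d : ℕ) : (Conf d →L[ℝ] Conf d) →L[ℝ] (Conf d →L[ℝ] Conf d) :=
  LinearMap.mkContinuous
    { toFun := fun L => ContinuousLinearMap.adjoint L
      map_add' := fun _ _ => map_add _ _ _
      map_smul' := fun c L => by simp } 1 (fun L => by simp)

theorem adjointCLM_apply (L : Conf d →L[ℝ] Conf d) :
    adjointCLM d L = ContinuousLinearMap.adjoint L := rfl

/-- Parameters `(Q, q, c, L, P, p)` of the local propagators of quadratic Hamiltonians: a chirped
substitution `(Q, q, c, L, 0)` after the Fourier multiplier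
`exp(-i(4π²⟨ξ,Pξ⟩ + 2π⟨p,ξ⟩))`. -/
abbrev PropagatorParam (d : ℕ) : Type :=
  (Conf d →L[ℝ] Conf d) × Conf d × ℂ × (Conf d →L[ℝ] Conf d) × (Conf d →L[ℝ] Conf d) × Conf d

/-- The chirped substitution contained in a propagator. -/
def PropagatorParam.outer (Y : PropagatorParam d) : ChirpParam d :=
  (Y.1, Y.2.1, Y.2.2.1, Y.2.2.2.1, 0)

/-- The Fourier multiplier contained in a propagator. -/
def PropagatorParam.multiplier (Y : PropagatorParam d) : ChirpParam d :=
  ((4 * Real.pi ^ 2) • Y.2.2.2.2.1, (2 * Real.pi) • Y.2.2.2.2.2, 0,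
    ContinuousLinearMap.id ℝ (Conf d), 0)

/-- The Riccati equations for the parameters of the propagator of `quadHam A B C a b e`. The
complex terms in the component of `c` compensate the Jacobian of the substitution. -/
def riccatiField (A B C : Conf d →L[ℝ] Conf d) (a b : Conf d) (e : ℝ) (Y : PropagatorParam d) :
    PropagatorParam d :=
  let S := Y.1 + adjointCLM d Y.1
  let D := C + adjointCLM d C
  let q := Y.2.1
  let L := Y.2.2.2.1
  (A - S.comp B + S.comp (C.comp S), a - adjointCLM d B q - S b + S (D q),
    ((e - inner ℝ q b + inner ℝ q (C q) : ℝ) : ℂ)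
      - Complex.I / 2 * (∑ i, inner ℝ (B (bas i)) (bas i) : ℝ)
      + Complex.I * (∑ i, inner ℝ (S (bas i)) (C (bas i)) : ℝ),
    L.comp (D.comp S - B), L.comp (C.comp (adjointCLM d L)), L (b - D q))

theorem contDiff_riccatiField (A B C : Conf d →L[ℝ] Conf d) (a b : Conf d) (e : ℝ) :
    ContDiff ℝ 1 (riccatiField A B C a b e) := by
  have hS : ContDiff ℝ 1 (fun Y : PropagatorParam d => Y.1 + adjointCLM d Y.1) := by fun_prop
  have hL : ContDiff ℝ 1 (fun Y : PropagatorParam d => adjointCLM d Y.2.2.2.1) := by fun_prop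
  have hc : ∀ {f : PropagatorParam d → ℝ}, ContDiff ℝ 1 f → ContDiff ℝ 1 (fun Y => (f Y : ℂ)) :=
    fun hf => Complex.ofRealCLM.contDiff.comp hf
  unfold riccatiField
  refine ContDiff.prodMk ?_ (ContDiff.prodMk ?_ (ContDiff.prodMk ?_ (ContDiff.prodMk ?_
    (ContDiff.prodMk ?_ ?_))))
  · fun_prop
  · fun_prop
  · refine ContDiff.add (ContDiff.sub (hc ?_) contDiff_const) (contDiff_const.mul (hc ?_))
    · exact (contDiff_const.sub (ContDiff.inner ℝ (by fun_prop) contDiff_const)).add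
        (ContDiff.inner ℝ (by fun_prop) (by fun_prop))
    · exact ContDiff.sum fun i _ => ContDiff.inner ℝ (by fun_prop) contDiff_const
  · fun_prop
  · fun_prop
  · fun_prop

open LineDeriv in
/-- The constant coefficient operator `iΣ ∂_{eᵢ}∂_{Peᵢ} - ∂_p`. -/
def constCoeffOp (P : Conf d →L[ℝ] Conf d) (p : Conf d) (v : 𝓢(Conf d, ℂ)) : 𝓢(Conf d, ℂ) :=
  Complex.I • ∑ i, (∂_{bas i} (∂_{P (bas i)} v : 𝓢(Conf d, ℂ)) : 𝓢(Conf d, ℂ))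
    - (∂_{p} v : 𝓢(Conf d, ℂ))

open LineDeriv FourierTransform in
theorem fourier_lineDeriv_apply (v : 𝓢(Conf d, ℂ)) (h ξ : Conf d) :
    𝓕 (∂_{h} v : 𝓢(Conf d, ℂ)) ξ = 2 * Real.pi * Complex.I * (inner ℝ ξ h : ℝ) * 𝓕 v ξ := by
  rw [SchwartzMap.fourier_lineDerivOp_eq, smul_apply,
    SchwartzMap.smulLeftCLM_apply_apply (by fun_prop), Complex.real_smul, smul_eq_mul]
  ring

theorem sum_inner_mul_map (T : Conf d →ₗ[ℝ] ℂ) (g : Conf d) :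
    ∑ i, (inner ℝ g (bas i) : ℝ) * T (bas i) = T g := by
  conv_rhs => rw [← (bas).sum_repr' g, map_sum]
  refine Finset.sum_congr rfl fun i _ => ?_
  rw [map_smul, real_inner_comm, Complex.real_smul]

open FourierTransform in
/-- On the Fourier side the constant coefficient operator is multiplication by
`-i(4π²⟨ξ,Pξ⟩ + 2π⟨p,ξ⟩)`. -/
theorem fourier_constCoeffOp_apply (P : Conf d →L[ℝ] Conf d) (p : Conf d) (v : 𝓢(Conf d, ℂ))
    (ξ : Conf d) : 𝓕 (constCoeffOp P p v) ξ
      = -Complex.I * ((4 * Real.pi ^ 2 * inner ℝ ξ (P ξ) + 2 * Real.pi * inner ℝ p ξ : ℝ) : ℂ)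
        * 𝓕 v ξ := by
  have h1 : 𝓕 (constCoeffOp P p v) = FourierTransform.fourierCLM ℂ 𝓢(Conf d, ℂ) (constCoeffOp P p v) := rfl
  have h2 := sum_inner_mul_map (Complex.ofRealCLM.toLinearMap.comp
    ((innerSL ℝ ξ).comp P).toLinearMap) ξ
  simp only [LinearMap.comp_apply, ContinuousLinearMap.coe_coe, ContinuousLinearMap.comp_apply,
    innerSL_apply_apply, Complex.ofRealCLM_apply] at h2
  rw [h1, constCoeffOp, map_sub, map_smul, map_sum, sub_apply, smul_apply,
    sum_apply]
  simp only [FourierTransform.fourierCLM_apply, fourier_lineDeriv_apply]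
  push_cast
  rw [← h2, real_inner_comm ξ p, smul_eq_mul, Finset.mul_sum, mul_add, Finset.mul_sum,
    Finset.mul_sum, add_mul, Finset.sum_mul, sub_eq_add_neg]
  congr 1
  · refine Finset.sum_congr rfl fun i _ => ?_
    linear_combination (4 * Real.pi ^ 2 * Complex.I * (inner ℝ ξ (bas i) : ℝ)
      * (inner ℝ ξ (P (bas i)) : ℝ) * 𝓕 v ξ) * Complex.I_sq
  · ring

open FourierTransform in
/-- The Fourier multiplier of a propagator. -/
def fourierChirp (Y : PropagatorParam d) : 𝓢(Conf d, ℂ) →L[ℂ] 𝓢(Conf d, ℂ) :=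
  (FourierTransform.fourierInvCLM ℂ 𝓢(Conf d, ℂ)).comp
    ((chirpOp Y.multiplier).comp (FourierTransform.fourierCLM ℂ 𝓢(Conf d, ℂ)))

open FourierTransform in
theorem fourierChirp_apply (Y : PropagatorParam d) (u : 𝓢(Conf d, ℂ)) :
    fourierChirp Y u = 𝓕⁻ (chirpOp Y.multiplier (𝓕 u)) := rfl

theorem continuous_outer : Continuous (PropagatorParam.outer (d := d)) :=
  continuous_fst.prodMk (continuous_snd.fst.prodMk (continuous_snd.snd.fst.prodMk
    (continuous_snd.snd.snd.fst.prodMk continuous_const)))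

theorem hasDerivAt_outer {Y : ℝ → PropagatorParam d} {Y' : PropagatorParam d} {κ : ℝ}
    (h : HasDerivAt Y Y' κ) : HasDerivAt (fun κ => (Y κ).outer) Y'.outer κ := by
  have h1 : HasDerivAt (fun κ => (Y κ).2) Y'.2 κ := h.prod_snd
  have h2 : HasDerivAt (fun κ => (Y κ).2.2) Y'.2.2 κ := h1.prod_snd
  have h3 : HasDerivAt (fun κ => (Y κ).2.2.2) Y'.2.2.2 κ := h2.prod_snd
  have t0 : HasDerivAt (fun κ => (Y κ).1) Y'.1 κ := h.prod_fst
  have t1 : HasDerivAt (fun κ => (Y κ).2.1) Y'.2.1 κ := h1.prod_fst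
  have t2 : HasDerivAt (fun κ => (Y κ).2.2.1) Y'.2.2.1 κ := h2.prod_fst
  have t3 : HasDerivAt (fun κ => (Y κ).2.2.2.1) Y'.2.2.2.1 κ := h3.prod_fst
  exact t0.prodMk (t1.prodMk (t2.prodMk (t3.prodMk (hasDerivAt_const κ (0 : Conf d)))))

theorem boundedBelow_multiplier (Y : PropagatorParam d) : BoundedBelow Y.multiplier.2.2.2.1 :=
  ⟨1, fun x => by simp [PropagatorParam.multiplier]⟩

theorem hasDerivAt_multiplier {Y : ℝ → PropagatorParam d} {Y' : PropagatorParam d} {κ : ℝ}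
    (h : HasDerivAt Y Y' κ) :
    HasDerivAt (fun κ => (Y κ).multiplier) ((4 * Real.pi ^ 2) • Y'.2.2.2.2.1,
      (2 * Real.pi) • Y'.2.2.2.2.2, 0, 0, 0) κ := by
  have h1 : HasDerivAt (fun κ => (Y κ).2.2.2.2) Y'.2.2.2.2 κ :=
    h.prod_snd.prod_snd.prod_snd.prod_snd
  have h2 : HasDerivAt (fun κ => (Y κ).2.2.2.2.1) Y'.2.2.2.2.1 κ := h1.prod_fst
  have h3 : HasDerivAt (fun κ => (Y κ).2.2.2.2.2) Y'.2.2.2.2.2 κ := h1.prod_snd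
  have h4 := h2.const_smul (4 * Real.pi ^ 2)
  have h5 := h3.const_smul (2 * Real.pi)
  exact h4.prodMk (h5.prodMk ((hasDerivAt_const κ (0 : ℂ)).prodMk
    ((hasDerivAt_const κ (ContinuousLinearMap.id ℝ (Conf d))).prodMk
      (hasDerivAt_const κ (0 : Conf d)))))

open FourierTransform in
/-- Along a curve of parameters the Fourier multiplier solves an equation with constant coefficient
operators. By Plancherel this is `hasDerivAt_chirpOp` on the Fourier side. -/
theorem hasDerivAt_fourierChirp {Y Y' : ℝ → PropagatorParam d} {κ₀ : ℝ}
    (hY : ∀ᶠ κ in nhds κ₀, HasDerivAt Y (Y' κ) κ) (hY' : ContinuousAt Y' κ₀) (u : 𝓢(Conf d, ℂ)) :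
    HasDerivAt (fun κ => toL2 (fourierChirp (Y κ) u))
      (toL2 (constCoeffOp (Y' κ₀).2.2.2.2.1 (Y' κ₀).2.2.2.2.2 (fourierChirp (Y κ₀) u))) κ₀ := by
  have h1 := hasDerivAt_chirpOp (θ := fun κ => (Y κ).multiplier)
    (θ' := fun κ => ((4 * Real.pi ^ 2) • (Y' κ).2.2.2.2.1, (2 * Real.pi) • (Y' κ).2.2.2.2.2, 0, 0, 0))
    (hY.mono fun κ h => hasDerivAt_multiplier h) (by fun_prop) (boundedBelow_multiplier (Y κ₀)) (𝓕 u)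
  have h2 := ((MeasureTheory.Lp.fourierTransformₗᵢ (Conf d) ℂ).symm.toContinuousLinearEquiv
    : L2 d →L[ℂ] L2 d).restrictScalars ℝ |>.hasFDerivAt.comp_hasDerivAt κ₀ h1
  refine (h2.congr_deriv ?_).congr_of_eventuallyEq (Filter.Eventually.of_forall fun κ => ?_)
  · change (MeasureTheory.Lp.fourierTransformₗᵢ (Conf d) ℂ).symm _ = _
    rw [LinearIsometryEquiv.symm_apply_eq]
    change _ = 𝓕 ((constCoeffOp (Y' κ₀).2.2.2.2.1 (Y' κ₀).2.2.2.2.2 (fourierChirp (Y κ₀) u)).toLp 2)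
    rw [SchwartzMap.toLp_fourier_eq]
    refine Lp.ext ((MemLp.coeFn_toLp _).trans ((SchwartzMap.coeFn_toLp _ 2 volume).trans ?_).symm)
    refine Filter.Eventually.of_forall fun ξ => ?_
    rw [fourier_constCoeffOp_apply, fourierChirp_apply, FourierTransform.fourier_fourierInv_eq,
      chirpOp_apply (boundedBelow_multiplier (Y κ₀))]
    simp only [chirpOpDeriv, PropagatorParam.multiplier, smul_apply, inner_smul_left, inner_smul_right,
      zero_apply, add_zero, map_zero, ContinuousLinearMap.id_apply]
    simp
    ring
  · change _ = 𝓕⁻ ((chirpOp (Y κ).multiplier (𝓕 u)).toLp 2)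
    rw [SchwartzMap.toLp_fourierInv_eq]
    rfl

open LineDeriv in
theorem lineDeriv_posMul (g h : Conf d) (v : 𝓢(Conf d, ℂ)) :
    (∂_{h} (v.posMul g) : 𝓢(Conf d, ℂ))
      = (∂_{h} v : 𝓢(Conf d, ℂ)).posMul g + ((inner ℝ h g : ℝ) : ℂ) • v := by
  ext x
  rw [SchwartzMap.lineDerivOp_apply_eq_fderiv, add_apply, smul_apply,
    SchwartzMap.posMul_apply, SchwartzMap.lineDerivOp_apply_eq_fderiv]
  have h1 : HasFDerivAt (fun x : Conf d => (inner ℝ x g : ℝ)) (innerSL ℝ g) x :=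
    (innerSL ℝ g).hasFDerivAt.congr_of_eventuallyEq
      (Filter.Eventually.of_forall fun y => by simp [real_inner_comm])
  have h2 := (Complex.ofRealCLM.hasFDerivAt.comp x h1).mul (v.hasFDerivAt x)
  rw [HasFDerivAt.fderiv (h2.congr_of_eventuallyEq (f₁ := v.posMul g)
    (Filter.Eventually.of_forall fun y => by rw [SchwartzMap.posMul_apply]; rfl))]
  simp [real_inner_comm]
  ring

theorem hasFDerivAt_chirp (Q : Conf d →L[ℝ] Conf d) (q : Conf d) (c : ℂ) (x : Conf d) :
    HasFDerivAt (chirp Q q c) ((-Complex.I * chirp Q q c x) • Complex.ofRealCLM.comp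
      (innerSL ℝ ((Q + adjointCLM d Q) x + q))) x := by
  have h1 : HasFDerivAt (fun x : Conf d => (inner ℝ x (Q x) + inner ℝ q x : ℝ))
      (innerSL ℝ ((Q + adjointCLM d Q) x + q)) x := by
    have := ((hasFDerivAt_id (𝕜 := ℝ) x).inner ℝ (Q.hasFDerivAt (x := x))).add
      (innerSL ℝ q).hasFDerivAt
    refine (this.congr_fderiv ?_).congr_of_eventuallyEq (Filter.Eventually.of_forall fun y => ?_)
    · ext y
      simp [adjointCLM_apply, ContinuousLinearMap.adjoint_inner_left, real_inner_comm (Q x)]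
      ring
    · simp
  have h2 := (((Complex.ofRealCLM.hasFDerivAt.comp x h1).add_const c).const_mul (-Complex.I)).cexp
  refine (h2.congr_fderiv ?_).congr_of_eventuallyEq (Filter.Eventually.of_forall fun y => ?_)
  · ext y
    simp [chirp]
    ring
  · simp [chirp]

open LineDeriv in
/-- Commutation of derivatives with chirped linear substitutions. -/
theorem lineDeriv_chirpOp {θ : ChirpParam d} (hL : BoundedBelow θ.2.2.2.1) (v : 𝓢(Conf d, ℂ))
    (h : Conf d) :
    (∂_{h} (chirpOp θ v) : 𝓢(Conf d, ℂ)) = chirpOp θ (∂_{θ.2.2.2.1 h} v : 𝓢(Conf d, ℂ))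
      - Complex.I • ((chirpOp θ v).posMul ((θ.1 + adjointCLM d θ.1) h)
        + ((inner ℝ θ.2.1 h : ℝ) : ℂ) • chirpOp θ v) := by
  ext x
  rw [SchwartzMap.lineDerivOp_apply_eq_fderiv]
  have h1 := hasFDerivAt_chirp θ.1 θ.2.1 θ.2.2.1 x
  have h2 := (v.hasFDerivAt (θ.2.2.2.1 x + θ.2.2.2.2)).comp x
    ((θ.2.2.2.1.hasFDerivAt (x := x)).add_const θ.2.2.2.2)
  rw [HasFDerivAt.fderiv ((h1.mul h2).congr_of_eventuallyEq (f₁ := chirpOp θ v)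
    (Filter.Eventually.of_forall fun y => by rw [chirpOp_apply hL]; rfl))]
  have hS : (inner ℝ x ((θ.1 + adjointCLM d θ.1) h) : ℝ)
      = inner ℝ ((θ.1 + adjointCLM d θ.1) x) h := by
    simp only [adjointCLM_apply, add_apply, inner_add_left, inner_add_right,
      ContinuousLinearMap.adjoint_inner_left, ContinuousLinearMap.adjoint_inner_right]
    ring
  generalize θ.1 + adjointCLM d θ.1 = S at *
  simp only [add_apply, sub_apply, smul_apply, ContinuousLinearMap.comp_apply,
    Complex.ofRealCLM_apply, innerSL_apply_apply, inner_add_left, smul_eq_mul,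
    SchwartzMap.posMul_apply, hS, chirpOp_apply hL, SchwartzMap.lineDerivOp_apply_eq_fderiv]
  push_cast
  simp only [Function.comp_apply]
  ring

open LineDeriv in
/-- Change of basis in a sum of second derivatives. -/
theorem sum_lineDeriv_comp (L M : Conf d →L[ℝ] Conf d) (v : 𝓢(Conf d, ℂ)) (y : Conf d) :
    ∑ i, (∂_{L (bas i)} (∂_{M (bas i)} v : 𝓢(Conf d, ℂ)) : 𝓢(Conf d, ℂ)) y
      = ∑ i, (∂_{bas i} (∂_{M (adjointCLM d L (bas i))} v : 𝓢(Conf d, ℂ)) : 𝓢(Conf d, ℂ)) y := by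
  have h1 : ∀ i, (∂_{L (bas i)} (∂_{M (bas i)} v : 𝓢(Conf d, ℂ)) : 𝓢(Conf d, ℂ)) y
      = ∑ j, (inner ℝ (L (bas i)) (bas j) : ℝ) *
        (∂_{bas j} (∂_{M (bas i)} v : 𝓢(Conf d, ℂ)) : 𝓢(Conf d, ℂ)) y := fun i => by
    simp only [SchwartzMap.lineDerivOp_apply_eq_fderiv _ (∂_{M (bas i)} v : 𝓢(Conf d, ℂ)) y]
    exact (sum_inner_mul_map (fderiv ℝ (∂_{M (bas i)} v : 𝓢(Conf d, ℂ)) y).toLinearMap _).symm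
  have h2 : ∀ j, (∂_{bas j} (∂_{M (adjointCLM d L (bas j))} v : 𝓢(Conf d, ℂ)) : 𝓢(Conf d, ℂ)) y
      = ∑ i, (inner ℝ (L (bas i)) (bas j) : ℝ) *
        (∂_{bas j} (∂_{M (bas i)} v : 𝓢(Conf d, ℂ)) : 𝓢(Conf d, ℂ)) y := fun j => by
    have := sum_inner_mul_map (d := d)
      { toFun := fun h => (∂_{bas j} (∂_{M h} v : 𝓢(Conf d, ℂ)) : 𝓢(Conf d, ℂ)) y
        map_add' := fun h k => by
          rw [map_add, lineDerivOp_left_add, lineDerivOp_add, add_apply]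
        map_smul' := fun c h => by
          rw [map_smul, lineDerivOp_left_smul, lineDerivOp_smul, smul_apply]; rfl }
      (adjointCLM d L (bas j))
    refine this.symm.trans (Finset.sum_congr rfl fun i _ => ?_)
    rw [adjointCLM_apply, ContinuousLinearMap.adjoint_inner_left, real_inner_comm]
    rfl
  simp only [h1, h2]
  exact Finset.sum_comm

open LineDeriv in
theorem lineDeriv_chirpOp_apply {θ : ChirpParam d} (hL : BoundedBelow θ.2.2.2.1)
    (v : 𝓢(Conf d, ℂ)) (h x : Conf d) :
    (∂_{h} (chirpOp θ v) : 𝓢(Conf d, ℂ)) x = chirp θ.1 θ.2.1 θ.2.2.1 x *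
      ((∂_{θ.2.2.2.1 h} v : 𝓢(Conf d, ℂ)) (θ.2.2.2.1 x + θ.2.2.2.2)
        - Complex.I * (inner ℝ ((θ.1 + adjointCLM d θ.1) x + θ.2.1) h : ℝ)
          * v (θ.2.2.2.1 x + θ.2.2.2.2)) := by
  have hS : (inner ℝ x ((θ.1 + adjointCLM d θ.1) h) : ℝ)
      = inner ℝ ((θ.1 + adjointCLM d θ.1) x) h := by
    simp only [adjointCLM_apply, add_apply, inner_add_left, inner_add_right,
      ContinuousLinearMap.adjoint_inner_left, ContinuousLinearMap.adjoint_inner_right]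
    ring
  rw [lineDeriv_chirpOp hL]
  generalize θ.1 + adjointCLM d θ.1 = S at *
  simp only [add_apply, sub_apply, smul_apply, inner_add_left, smul_eq_mul,
    SchwartzMap.posMul_apply, hS, chirpOp_apply hL]
  push_cast
  ring

open LineDeriv in
theorem lineDeriv_lineDeriv_chirpOp_apply {θ : ChirpParam d} (hL : BoundedBelow θ.2.2.2.1)
    (v : 𝓢(Conf d, ℂ)) (k h x : Conf d) :
    (∂_{k} (∂_{h} (chirpOp θ v) : 𝓢(Conf d, ℂ)) : 𝓢(Conf d, ℂ)) x
      = chirp θ.1 θ.2.1 θ.2.2.1 x *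
      ((∂_{θ.2.2.2.1 k} (∂_{θ.2.2.2.1 h} v : 𝓢(Conf d, ℂ)) : 𝓢(Conf d, ℂ))
          (θ.2.2.2.1 x + θ.2.2.2.2)
        - Complex.I * (inner ℝ ((θ.1 + adjointCLM d θ.1) x + θ.2.1) k : ℝ)
          * (∂_{θ.2.2.2.1 h} v : 𝓢(Conf d, ℂ)) (θ.2.2.2.1 x + θ.2.2.2.2)
        - Complex.I * (inner ℝ ((θ.1 + adjointCLM d θ.1) x + θ.2.1) h : ℝ)
          * (∂_{θ.2.2.2.1 k} v : 𝓢(Conf d, ℂ)) (θ.2.2.2.1 x + θ.2.2.2.2)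
        - Complex.I * (inner ℝ k ((θ.1 + adjointCLM d θ.1) h) : ℝ) * v (θ.2.2.2.1 x + θ.2.2.2.2)
        - (inner ℝ ((θ.1 + adjointCLM d θ.1) x + θ.2.1) k : ℝ)
          * (inner ℝ ((θ.1 + adjointCLM d θ.1) x + θ.2.1) h : ℝ)
          * v (θ.2.2.2.1 x + θ.2.2.2.2)) := by
  have hS : (inner ℝ x ((θ.1 + adjointCLM d θ.1) h) : ℝ)
      = inner ℝ ((θ.1 + adjointCLM d θ.1) x) h := by
    simp only [adjointCLM_apply, add_apply, inner_add_left, inner_add_right,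
      ContinuousLinearMap.adjoint_inner_left, ContinuousLinearMap.adjoint_inner_right]
    ring
  rw [lineDeriv_chirpOp hL, sub_eq_add_neg, ← neg_smul, lineDerivOp_add, lineDerivOp_smul,
    lineDerivOp_add, lineDerivOp_smul, lineDeriv_posMul, add_apply, smul_apply, add_apply,
    add_apply, smul_apply, smul_apply, SchwartzMap.posMul_apply]
  simp only [lineDeriv_chirpOp_apply hL, chirpOp_apply hL]
  generalize θ.1 + adjointCLM d θ.1 = S at *
  rw [hS]
  simp only [inner_add_left, smul_eq_mul]
  push_cast
  linear_combination (chirp θ.1 θ.2.1 θ.2.2.1 x * ((inner ℝ (S x) k : ℝ) + (inner ℝ θ.2.1 k : ℝ))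
    * ((inner ℝ (S x) h : ℝ) + (inner ℝ θ.2.1 h : ℝ))
    * v (θ.2.2.2.1 x + θ.2.2.2.2)) * Complex.I_sq

open LineDeriv in
/-- The Riccati equations make the ansatz `chirpOp θ w` solve the Schrödinger equation of a
quadratic Hamiltonian. -/
theorem chirpOpDeriv_riccati (A B C : Conf d →L[ℝ] Conf d) (a b : Conf d) (e : ℝ)
    (Y : PropagatorParam d) (hL : BoundedBelow Y.2.2.2.1) (w : 𝓢(Conf d, ℂ)) (x : Conf d) :
    chirpOpDeriv Y.outer (riccatiField A B C a b e Y).outer w x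
      + chirpOp Y.outer (constCoeffOp (riccatiField A B C a b e Y).2.2.2.2.1
        (riccatiField A B C a b e Y).2.2.2.2.2 w) x
      = -Complex.I * weylOp (quadHam A B C a b e) (chirpOp Y.outer w) x := by
  obtain ⟨Q, q, c, L, P, p⟩ := Y
  set θ : ChirpParam d := PropagatorParam.outer (Q, q, c, L, P, p) with hθ
  have hL' : BoundedBelow θ.2.2.2.1 := hL
  set S := Q + adjointCLM d Q with hS
  set D := C + adjointCLM d C with hD
  set g := S x + q with hg
  have hSym : ∀ z z' : Conf d, (inner ℝ z (S z') : ℝ) = inner ℝ (S z) z' := fun z z' => by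
    simp only [hS, adjointCLM_apply, add_apply, inner_add_left, inner_add_right,
      ContinuousLinearMap.adjoint_inner_left, ContinuousLinearMap.adjoint_inner_right]
    ring
  let T : Conf d →L[ℝ] ℂ := fderiv ℝ w (L x)
  have hT : ∀ h, (∂_{h} w : 𝓢(Conf d, ℂ)) (L x) = T h := fun h =>
    SchwartzMap.lineDerivOp_apply_eq_fderiv h w (L x)
  -- the first and second order terms of the conjugated operator
  have h1 : ∀ h, (∂_{h} (chirpOp θ w) : 𝓢(Conf d, ℂ)) x = chirp Q q c x
      * (T (L h) - Complex.I * (inner ℝ g h : ℝ) * w (L x)) := fun h => by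
    rw [lineDeriv_chirpOp_apply hL']
    simp only [hθ, PropagatorParam.outer, add_zero, hT, ← hS, ← hg]
  have h2 : ∀ k h, (∂_{k} (∂_{h} (chirpOp θ w) : 𝓢(Conf d, ℂ)) : 𝓢(Conf d, ℂ)) x
      = chirp Q q c x * ((∂_{L k} (∂_{L h} w : 𝓢(Conf d, ℂ)) : 𝓢(Conf d, ℂ)) (L x)
        - Complex.I * (inner ℝ g k : ℝ) * T (L h) - Complex.I * (inner ℝ g h : ℝ) * T (L k)
        - Complex.I * (inner ℝ (S k) h : ℝ) * w (L x)
        - (inner ℝ g k : ℝ) * (inner ℝ g h : ℝ) * w (L x)) := fun k h => by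
    rw [lineDeriv_lineDeriv_chirpOp_apply hL']
    simp only [hθ, PropagatorParam.outer, add_zero, hT, ← hS, ← hg, hSym]
  have s1 : ∑ i, (∂_{L (bas i)} (∂_{L (C (bas i))} w : 𝓢(Conf d, ℂ)) : 𝓢(Conf d, ℂ)) (L x)
      = ∑ i, (∂_{bas i} (∂_{L (C (adjointCLM d L (bas i)))} w : 𝓢(Conf d, ℂ)) : 𝓢(Conf d, ℂ))
        (L x) := sum_lineDeriv_comp L (L.comp C) w (L x)
  have s2 : ∑ i, (inner ℝ g (bas i) : ℝ) * T (L (C (bas i))) = T (L (C g)) :=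
    sum_inner_mul_map (T.comp (L.comp C)).toLinearMap g
  have s3 : ∑ i, (inner ℝ g (C (bas i)) : ℝ) * T (L (bas i)) = T (L (adjointCLM d C g)) := by
    rw [← ContinuousLinearMap.comp_apply T L, ← ContinuousLinearMap.coe_coe (T.comp L),
      ← sum_inner_mul_map]
    refine Finset.sum_congr rfl fun i _ => ?_
    rw [adjointCLM_apply, ContinuousLinearMap.adjoint_inner_left]; rfl
  have s4 : ∑ i, (inner ℝ g (bas i) : ℝ) * ((inner ℝ g (C (bas i)) : ℝ) : ℂ)
      = (inner ℝ g (C g) : ℝ) :=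
    sum_inner_mul_map (Complex.ofRealCLM.toLinearMap.comp ((innerSL ℝ g).comp C).toLinearMap) g
  have h3 : ∑ i, (∂_{bas i} (∂_{C (bas i)} (chirpOp θ w) : 𝓢(Conf d, ℂ)) : 𝓢(Conf d, ℂ)) x
      = chirp Q q c x * (∑ i, (∂_{bas i} (∂_{L (C (adjointCLM d L (bas i)))} w : 𝓢(Conf d, ℂ))
          : 𝓢(Conf d, ℂ)) (L x) - Complex.I * T (L (D g))
        - Complex.I * (∑ i, inner ℝ (S (bas i)) (C (bas i)) : ℝ) * w (L x)
        - (inner ℝ g (C g) : ℝ) * w (L x)) := by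
    have t1 : T (L (D g)) = T (L (C g)) + T (L (adjointCLM d C g)) := by
      rw [hD, add_apply, map_add, map_add]
    simp only [h2]
    rw [← Finset.mul_sum, Finset.sum_sub_distrib, Finset.sum_sub_distrib, Finset.sum_sub_distrib,
      Finset.sum_sub_distrib, s1, t1, ← s2, ← s3, ← s4]
    simp only [Finset.mul_sum, Finset.sum_mul, mul_assoc, mul_add]
    push_cast
    simp only [Finset.mul_sum, Finset.sum_mul]
    ring
  -- comparison of the coefficients
  have r1 : (inner ℝ x ((A - S.comp B + S.comp (C.comp S)) x)
        + inner ℝ (a - adjointCLM d B q - S b + S (D q)) x + (e - inner ℝ q b + inner ℝ q (C q)) : ℝ)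
      = inner ℝ x (A x) + inner ℝ a x + e - inner ℝ g (B x + b) + inner ℝ g (C g) := by
    have t1 : (inner ℝ (S b) x : ℝ) = inner ℝ (S x) b := by rw [real_inner_comm, hSym]
    have t2 : (inner ℝ (S (D q)) x : ℝ) = inner ℝ (S x) (C q) + inner ℝ q (C (S x)) := by
      rw [real_inner_comm, hSym, show D q = C q + adjointCLM d C q from rfl, inner_add_right,
        adjointCLM_apply,
        ContinuousLinearMap.adjoint_inner_right, real_inner_comm q]
    simp only [hg, add_apply, sub_apply, ContinuousLinearMap.comp_apply, inner_add_left,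
      inner_add_right, inner_sub_left, inner_sub_right, hSym, t1, t2, map_add]
    rw [adjointCLM_apply, ContinuousLinearMap.adjoint_inner_left]
    ring
  have r2 : T (L.comp (D.comp S - B) x) - T (L (b - D q)) = T (L (D g)) - T (L (B x + b)) := by
    simp only [hg, ContinuousLinearMap.comp_apply, sub_apply, map_sub, map_add]
    ring
  rw [weylOp_quadHam, h3, ← SchwartzMap.lineDerivOp_apply_eq_fderiv, h1]
  have r3 : chirpOpDeriv θ (riccatiField A B C a b e (Q, q, c, L, P, p)).outer w x
      = chirp Q q c x * (-Complex.I * (((inner ℝ x ((A - S.comp B + S.comp (C.comp S)) x)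
        + inner ℝ (a - adjointCLM d B q - S b + S (D q)) x : ℝ) : ℂ)
          + (((e - inner ℝ q b + inner ℝ q (C q) : ℝ) : ℂ)
      - Complex.I / 2 * (∑ i, inner ℝ (B (bas i)) (bas i) : ℝ)
      + Complex.I * (∑ i, inner ℝ (S (bas i)) (C (bas i)) : ℝ))) * w (L x)
        + T (L.comp (D.comp S - B) x)) := by
    simp only [chirpOpDeriv, hθ, PropagatorParam.outer, riccatiField, add_zero]
    rfl
  have r4 : chirpOp θ (constCoeffOp (riccatiField A B C a b e (Q, q, c, L, P, p)).2.2.2.2.1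
        (riccatiField A B C a b e (Q, q, c, L, P, p)).2.2.2.2.2 w) x
      = chirp Q q c x * (Complex.I * ∑ i, (∂_{bas i} (∂_{L (C (adjointCLM d L (bas i)))} w
        : 𝓢(Conf d, ℂ)) : 𝓢(Conf d, ℂ)) (L x) - T (L (b - D q))) := by
    rw [chirpOp_apply hL', constCoeffOp, sub_apply, smul_apply, sum_apply]
    simp only [hθ, PropagatorParam.outer, riccatiField, add_zero, hT]
    rfl
  have r1' := congrArg (fun r : ℝ => (r : ℂ)) r1
  have hw : chirpOp θ w x = chirp Q q c x * w (L x) := by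
    rw [chirpOp_apply hL']
    simp only [hθ, PropagatorParam.outer, add_zero]
  rw [r3, r4, hw]
  simp only [Complex.ofReal_add, Complex.ofReal_sub] at r1' ⊢
  linear_combination (-Complex.I * chirp Q q c x * w (L x)) * r1' + chirp Q q c x * r2
    + chirp Q q c x * (T (L (D g)) - T (L (B x + b))
      + Complex.I * w (L x) * (inner ℝ g (B x + b) : ℝ)) * Complex.I_sq

theorem isSymbolOfOrder_quadHam (A B C : Conf d →L[ℝ] Conf d) (a b : Conf d) (e : ℝ) :
    IsSymbolOfOrder 2 (quadHam A B C a b e) := by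
  rw [← quadHamPoly_eval]; exact QuadPoly.isSymbolOfOrder _

/-- `chirpOpDeriv_riccati` as an identity in `L²`. -/
theorem toLp_chirpOpDeriv_riccati (A B C : Conf d →L[ℝ] Conf d) (a b : Conf d) (e : ℝ)
    (Y : PropagatorParam d) (hL : BoundedBelow Y.outer.2.2.2.1) (w : 𝓢(Conf d, ℂ)) :
    (memLp_chirpOpDeriv hL (riccatiField A B C a b e Y).outer w).toLp
      + toL2 (chirpOp Y.outer (constCoeffOp (riccatiField A B C a b e Y).2.2.2.2.1
        (riccatiField A B C a b e Y).2.2.2.2.2 w))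
      = -Complex.I • weylLp (quadHam A B C a b e) (chirpOp Y.outer w) := by
  have h := chirpOpDeriv_riccati A B C a b e Y hL w
  generalize riccatiField A B C a b e Y = Z at *
  refine Lp.ext ((Lp.coeFn_add _ _).trans ?_)
  filter_upwards [MemLp.coeFn_toLp (memLp_chirpOpDeriv hL Z.outer w),
    SchwartzMap.coeFn_toLp (chirpOp Y.outer (constCoeffOp Z.2.2.2.2.1 Z.2.2.2.2.2 w)) 2 volume,
    Lp.coeFn_smul (-Complex.I) (weylLp (quadHam A B C a b e) (chirpOp Y.outer w)),
    (isSymbolOfOrder_quadHam A B C a b e).coeFn_weylLp (chirpOp Y.outer w)] with x e1 e2 e3 e4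
  rw [Pi.add_apply, e3, Pi.smul_apply, e4, smul_eq_mul, ← h]
  exact congrArg₂ (· + ·) e1 e2

theorem chirpOp_identity (v : 𝓢(Conf d, ℂ)) {θ : ChirpParam d}
    (hθ : θ = (0, 0, 0, ContinuousLinearMap.id ℝ (Conf d), 0)) : chirpOp θ v = v := by
  subst hθ
  ext x
  rw [chirpOp_apply ⟨1, fun x => by simp⟩]
  simp [chirp]

/-- The Schrödinger equation of a quadratic Hamiltonian is solvable in the Schwartz space for
short times. The restriction to short times is due to the ansatz, as the solutions of the Riccati
equations may blow up. -/
theorem exists_local_propagator (A B C : Conf d →L[ℝ] Conf d) (a b : Conf d) (e : ℝ) :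
    ∃ ε > 0, ∃ U : ℝ → (𝓢(Conf d, ℂ) →ₗ[ℂ] 𝓢(Conf d, ℂ)), U 0 = LinearMap.id ∧
      ∀ κ ∈ Set.Ioo (-ε) ε, ∀ u, HasDerivAt (fun κ => toL2 (U κ u))
        (-Complex.I • weylLp (quadHam A B C a b e) (U κ u)) κ := by
  obtain ⟨(Y : ℝ → PropagatorParam d), hY0, ε, hε, hY⟩ :=
    (contDiff_riccatiField A B C a b e).contDiffAt (x := ((0, 0, 0,
      ContinuousLinearMap.id ℝ (Conf d), 0, 0) : PropagatorParam d))
      |>.exists_forall_mem_closedBall_exists_eq_forall_mem_Ioo_hasDerivAt₀ (0 : ℝ)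
  simp only [zero_sub, zero_add] at hY
  have hcY : ContinuousAt Y 0 := (hY 0 ⟨by linarith, hε⟩).continuousAt
  -- the linear part of the substitution stays invertible for short times
  obtain ⟨K, hK1, hK⟩ := BoundedBelow.eventually (L₀ := ContinuousLinearMap.id ℝ (Conf d))
    ⟨1, fun x => by simp⟩
  have hcL : Filter.Tendsto (fun κ => (Y κ).2.2.2.1) (nhds 0)
      (nhds (ContinuousLinearMap.id ℝ (Conf d))) := by
    have : ContinuousAt (fun κ => (Y κ).2.2.2.1) 0 := by fun_prop
    simpa [ContinuousAt, hY0] using this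
  obtain ⟨δ, hδ, hball⟩ := Metric.eventually_nhds_iff_ball.1 (hcL.eventually hK)
  have hL : ∀ κ ∈ Set.Ioo (-min ε δ) (min ε δ), BoundedBelow (Y κ).2.2.2.1 := fun κ hκ =>
    ⟨K, hball κ (by
      rw [Real.ball_eq_Ioo]
      exact ⟨by linarith [hκ.1, min_le_right ε δ], by linarith [hκ.2, min_le_right ε δ]⟩)⟩
  refine ⟨min ε δ, lt_min hε hδ, fun κ => ((chirpOp (Y κ).outer).comp
    (fourierChirp (Y κ))).toLinearMap, ?_, fun κ hκ u => ?_⟩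
  · ext1 u
    simp only [ContinuousLinearMap.coe_coe, ContinuousLinearMap.comp_apply, LinearMap.id_apply]
    rw [chirpOp_identity _ (by rw [hY0]; rfl), fourierChirp_apply,
      chirpOp_identity _ (by
        rw [hY0]
        exact Prod.ext (ContinuousLinearMap.ext fun x => by simp [PropagatorParam.multiplier])
          (Prod.ext (smul_zero (2 * Real.pi)) rfl)),
      FourierTransform.fourierInv_fourier_eq]
  · have hmem : Set.Ioo (-min ε δ) (min ε δ) ∈ nhds κ := Ioo_mem_nhds hκ.1 hκ.2
    have hYe : ∀ᶠ κ in nhds κ, HasDerivAt Y (riccatiField A B C a b e (Y κ)) κ := by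
      filter_upwards [hmem] with κ hκ
      exact hY κ ⟨by linarith [hκ.1, min_le_left ε δ], by linarith [hκ.2, min_le_left ε δ]⟩
    have hF : ContinuousAt (fun κ => riccatiField A B C a b e (Y κ)) κ :=
      (contDiff_riccatiField A B C a b e).continuous.continuousAt.comp
        hYe.self_of_nhds.continuousAt
    have hθ : ∀ᶠ κ in nhds κ, HasDerivAt (fun κ => (Y κ).outer)
        (riccatiField A B C a b e (Y κ)).outer κ := hYe.mono fun κ h => hasDerivAt_outer h
    have hθ' : ContinuousAt (fun κ => (riccatiField A B C a b e (Y κ)).outer) κ :=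
      continuous_outer.continuousAt.comp hF
    have hLo : BoundedBelow (Y κ).outer.2.2.2.1 := hL κ hκ
    have h := hasDerivAt_chirpOp_apply hθ hθ' hLo (hasDerivAt_fourierChirp hYe hF u)
    exact h.congr_deriv (toLp_chirpOpDeriv_riccati A B C a b e (Y κ) hLo (fourierChirp (Y κ) u))

end LocalPropagator

/-! ### One-parameter groups generated by Weyl operators -/

section Groups

/-- A one-parameter family in a group that satisfies the group law for small parameters extends
to a one-parameter group. The extension stays in each subgroup that contains the family for small
parameters. -/
theorem exists_hom_of_local_hom {G : Type*} [Group G] {E : ℝ → G} {δ : ℝ} (hδ : 0 < δ)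
    (h : ∀ κ κ', |κ| < δ → |κ'| < δ → |κ + κ'| < δ → E (κ + κ') = E κ * E κ') :
    ∃ V : ℝ → G, (∀ κ κ', V (κ + κ') = V κ * V κ') ∧ (∀ κ, |κ| < δ / 2 → V κ = E κ) ∧
      ∀ H : Subgroup G, (∀ κ, |κ| < δ → E κ ∈ H) → ∀ κ, V κ ∈ H := by
  -- `V (n τ + r) = E τ ^ n * E r` for integers `n` and `0 ≤ r < τ`; the half of `δ` makes the
  -- sum of two remainders admissible
  set τ := δ / 2 with hτ
  have hτ0 : 0 < τ := by positivity
  have hdτ : δ = 2 * τ := by rw [hτ]; ring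
  have hE : ∀ r r', 0 ≤ r → 0 ≤ r' → r + r' < δ → E (r + r') = E r * E r' := fun r r' h1 h2 h3 =>
    h r r' (abs_lt.2 ⟨by linarith, by linarith⟩) (abs_lt.2 ⟨by linarith, by linarith⟩)
      (abs_lt.2 ⟨by linarith, by linarith⟩)
  have hcomm : ∀ r, 0 ≤ r → r < τ → Commute (E τ) (E r) := fun r h1 h2 => by
    rw [commute_iff_eq, ← hE τ r hτ0.le h1 (by linarith), ← hE r τ h1 hτ0.le (by linarith), add_comm]
  let V : ℝ → G := fun κ => E τ ^ ⌊κ / τ⌋ * E (κ - τ * ⌊κ / τ⌋)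
  have hV : ∀ (n : ℤ) (r : ℝ), 0 ≤ r → r < τ → V (τ * n + r) = E τ ^ n * E r := fun n r h1 h2 => by
    have : ⌊(τ * n + r) / τ⌋ = n := by
      rw [Int.floor_eq_iff, le_div_iff₀ hτ0, div_lt_iff₀ hτ0]
      constructor <;> linarith
    simp only [V, this, add_sub_cancel_left]
  have hdec : ∀ κ, ∃ (n : ℤ) (r : ℝ), 0 ≤ r ∧ r < τ ∧ κ = τ * n + r := fun κ => by
    refine ⟨⌊κ / τ⌋, κ - τ * ⌊κ / τ⌋, ?_, ?_, by ring⟩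
    · have := Int.floor_le (κ / τ)
      rw [le_div_iff₀ hτ0] at this; linarith
    · have := Int.lt_floor_add_one (κ / τ)
      rw [div_lt_iff₀ hτ0] at this; linarith
  refine ⟨V, fun κ κ' => ?_, fun κ hκ => ?_, fun H hH κ => ?_⟩
  · obtain ⟨n, r, h1, h2, rfl⟩ := hdec κ
    obtain ⟨n', r', h1', h2', rfl⟩ := hdec κ'
    rw [hV n r h1 h2, hV n' r' h1' h2']
    have e1 : E τ ^ n * E r * (E τ ^ n' * E r') = E τ ^ (n + n') * E (r + r') := by
      rw [hE r r' h1 h1' (by linarith), zpow_add, mul_assoc, mul_assoc, ← mul_assoc (E r),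
        ((hcomm r h1 h2).zpow_left n').eq.symm, mul_assoc]
    rw [e1]
    rcases lt_or_ge (r + r') τ with hlt | hge
    · rw [← hV (n + n') (r + r') (by linarith) hlt]
      congr 1; push_cast; ring
    · have e2 : E (r + r') = E τ * E (r + r' - τ) := by
        rw [← hE τ _ hτ0.le (by linarith) (by linarith), add_sub_cancel]
      rw [e2, ← mul_assoc, ← zpow_add_one, ← hV _ _ (by linarith) (by linarith)]
      congr 1; push_cast; ring
  · rw [abs_lt] at hκ
    rcases le_or_gt 0 κ with h0 | h0
    · have := hV 0 κ h0 hκ.2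
      simpa using this
    · have h1 := hV (-1) (κ + τ) (by linarith) (by linarith)
      have h2 : E κ = (E τ)⁻¹ * E (κ + τ) := by
        rw [eq_inv_mul_iff_mul_eq, ← h τ κ (abs_lt.2 ⟨by linarith, by linarith⟩)
          (abs_lt.2 ⟨by linarith, by linarith⟩) (abs_lt.2 ⟨by linarith, by linarith⟩), add_comm]
      rw [h2, ← zpow_neg_one, ← h1]
      congr 1; push_cast; ring
  · obtain ⟨n, r, h1, h2, rfl⟩ := hdec κ
    rw [hV n r h1 h2]
    exact H.mul_mem (H.zpow_mem (hH τ (abs_lt.2 ⟨by linarith, by linarith⟩)) n)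
      (hH r (abs_lt.2 ⟨by linarith, by linarith⟩))

variable {d m : ℕ} {a : Conf d → Conf d → ℝ}

/-- `V` is a one-parameter group of `L²`-isometries of the Schwartz space whose orbits solve
`i dφ/dκ = a^w φ`. -/
structure IsSchwartzExp (a : Conf d → Conf d → ℝ) (V : ℝ → (𝓢(Conf d, ℂ) ≃ₗ[ℂ] 𝓢(Conf d, ℂ))) :
    Prop where
  map_add : ∀ κ κ', V (κ + κ') = V κ * V κ'
  norm_map : ∀ κ u, ‖toL2 (V κ u)‖ = ‖toL2 u‖
  hasDerivAt : ∀ κ u, HasDerivAt (fun κ => toL2 (V κ u)) (-Complex.I • weylLp a (V κ u)) κ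

theorem IsSchwartzExp.map_zero {V : ℝ → (𝓢(Conf d, ℂ) ≃ₗ[ℂ] 𝓢(Conf d, ℂ))}
    (hV : IsSchwartzExp a V) : V 0 = 1 := by
  have := hV.map_add 0 0
  rwa [add_zero, left_eq_mul] at this

/-- Short time solvability of `i dφ/dκ = a^w φ` in the Schwartz space implies long time
solvability by a group of isometries. -/
theorem IsSymbolOfOrder.exists_isSchwartzExp (ha : IsSymbolOfOrder m a)
    (hloc : ∃ ε > 0, ∃ U : ℝ → (𝓢(Conf d, ℂ) →ₗ[ℂ] 𝓢(Conf d, ℂ)), U 0 = LinearMap.id ∧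
      ∀ κ ∈ Set.Ioo (-ε) ε, ∀ u, HasDerivAt (fun κ => toL2 (U κ u))
        (-Complex.I • weylLp a (U κ u)) κ) :
    ∃ V : ℝ → (𝓢(Conf d, ℂ) ≃ₗ[ℂ] 𝓢(Conf d, ℂ)), IsSchwartzExp a V := by
  obtain ⟨ε, hε, U, hU0, hU⟩ := hloc
  -- the local group law, since both sides solve the equation with the same value at `κ = 0`
  have hgrp : ∀ κ κ', |κ| < ε → |κ'| < ε → |κ + κ'| < ε → ∀ u, U (κ + κ') u = U κ (U κ' u) := by
    intro κ κ' h1 h2 h3 u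
    rw [abs_lt] at h1 h2 h3
    have hs : Convex ℝ (Set.Ioo (-ε) ε ∩ Set.Ioo (-ε - κ') (ε - κ')) :=
      (convex_Ioo _ _).inter (convex_Ioo _ _)
    refine ha.eq_of_hasDerivAt hs (φ := fun κ => U (κ + κ') u) (χ := fun κ => U κ (U κ' u))
      (fun κ hκ => ?_) (fun κ hκ => hU κ hκ.1 _) (κ := κ) (κ' := 0)
      ⟨⟨h1.1, h1.2⟩, ⟨by linarith, by linarith⟩⟩
      ⟨⟨by linarith, by linarith⟩, ⟨by linarith, by linarith⟩⟩ (by simp [hU0])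
    exact (hU (κ + κ') ⟨by linarith [hκ.2.1], by linarith [hκ.2.2]⟩ u).comp_add_const κ κ'
  have hinv : ∀ κ, |κ| < ε → ∀ u, U κ (U (-κ) u) = u := fun κ hκ u => by
    rw [← hgrp κ (-κ) hκ (by rwa [abs_neg]) (by simpa using hε)]
    simp [hU0]
  let E : ℝ → (𝓢(Conf d, ℂ) ≃ₗ[ℂ] 𝓢(Conf d, ℂ)) := fun κ => by
    classical
    exact if h : |κ| < ε then LinearEquiv.ofLinearMap (U κ) (U (-κ))
      (LinearMap.ext fun u => hinv κ h u)
      (LinearMap.ext fun u => by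
        have := hinv (-κ) (by rwa [abs_neg]) u
        rwa [neg_neg] at this) else 1
  have hE : ∀ κ, |κ| < ε → ∀ u, E κ u = U κ u := fun κ hκ u => by
    simp only [E, dif_pos hκ]; rfl
  obtain ⟨V, hVadd, hVE, hVH⟩ := exists_hom_of_local_hom (E := E) hε fun κ κ' h1 h2 h3 => by
    ext1 u
    rw [hE _ h3, hgrp κ κ' h1 h2 h3, LinearEquiv.mul_apply, hE κ h1, hE κ' h2]
  refine ⟨V, hVadd, ?_, fun κ u => ?_⟩
  -- isometries form a subgroup, so isometry for short times suffices
  · let H : Subgroup (𝓢(Conf d, ℂ) ≃ₗ[ℂ] 𝓢(Conf d, ℂ)) :=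
      { carrier := {g | ∀ u, ‖toL2 (g u)‖ = ‖toL2 u‖}
        mul_mem' := fun {g g'} h1 h2 u => (h1 (g' u)).trans (h2 u)
        one_mem' := fun u => rfl
        inv_mem' := fun {g} h u => by
          rw [← h (g⁻¹ u)]
          exact congrArg (fun w => ‖toL2 w‖) (g.apply_symm_apply u) }
    refine hVH H fun κ hκ u => ?_
    rw [hE κ hκ]
    have h1 := ha.inner_eq_of_hasDerivAt (convex_Ioo (-ε) ε) (φ := fun κ => U κ u)
      (χ := fun κ => U κ u) (fun κ hκ => hU κ hκ u) (fun κ hκ => hU κ hκ u)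
      (κ := κ) (κ' := 0) (abs_lt.1 hκ) ⟨by linarith, hε⟩
    rw [norm_eq_sqrt_re_inner (𝕜 := ℂ), norm_eq_sqrt_re_inner (𝕜 := ℂ), h1, hU0]
    rfl
  · have h1 : HasDerivAt (fun s => toL2 (U s (V κ u))) (-Complex.I • weylLp a (V κ u)) 0 := by
      have := hU 0 ⟨by linarith, hε⟩ (V κ u)
      rwa [hU0] at this
    have h2 : HasDerivAt (fun s => toL2 (V (s + κ) u)) (-Complex.I • weylLp a (V κ u)) 0 := by
      refine h1.congr_of_eventuallyEq ?_
      filter_upwards [Metric.ball_mem_nhds (0 : ℝ) (half_pos hε)] with s hs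
      rw [mem_ball_zero_iff, Real.norm_eq_abs] at hs
      rw [hVadd, LinearEquiv.mul_apply, hVE s hs, hE s (by linarith)]
    rw [← sub_self κ] at h2
    simpa using h2.comp_sub_const κ κ

/-- Extension from the Schwartz space to `L²` by density. -/
theorem IsSchwartzExp.exists_isWeylExp (ha : IsSymbolOfOrder m a)
    {V : ℝ → (𝓢(Conf d, ℂ) ≃ₗ[ℂ] 𝓢(Conf d, ℂ))} (hV : IsSchwartzExp a V) :
    ∃ W : ℝ → (L2 d ≃ₗᵢ[ℂ] L2 d), IsWeylExp a W := by
  let W : ℝ → (L2 d ≃ₗᵢ[ℂ] L2 d) := fun κ => (V κ).extendOfIsometry (toL2 (d := d)).toLinearMap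
    (toL2 (d := d)).toLinearMap denseRange_toL2 denseRange_toL2 (hV.norm_map κ)
  have hW : ∀ κ u, W κ (toL2 u) = toL2 (V κ u) := fun κ u =>
    LinearEquiv.extendOfIsometry_eq _ _ _ denseRange_toL2 denseRange_toL2 (hV.norm_map κ) u
  have hc : ∀ u, Continuous fun κ => W κ (toL2 u) := fun u => by
    simp only [hW]
    exact continuous_iff_continuousAt.2 fun κ => (hV.hasDerivAt κ u).continuousAt
  refine ⟨W, fun κ κ' u => ?_, fun u => continuous_iff_continuousAt.2 fun κ => ?_, fun u => ?_⟩
  · refine congrFun (DenseRange.equalizer denseRange_toL2 (g := fun u => W (κ + κ') u)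
      (h := fun u => W κ (W κ' u)) (by fun_prop) (by fun_prop) (funext fun v => ?_)) u
    simp only [Function.comp, hW, hV.map_add, LinearEquiv.mul_apply]
  · exact continuousAt_apply_of_dense (T := fun κ => (W κ).toLinearIsometry) denseRange_toL2
      (fun v => (hc v).continuousAt) u
  · refine ⟨weylLp a u, ha.coeFn_weylLp u, ?_⟩
    have := hV.hasDerivAt 0 u
    rw [hV.map_zero] at this
    exact this.congr_of_eventuallyEq (Filter.Eventually.of_forall fun κ => hW κ u)

variable {W : ℝ → (L2 d ≃ₗᵢ[ℂ] L2 d)}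

theorem IsWeylExp.map_zero (hW : IsWeylExp a W) (u : L2 d) : W 0 u = u := by
  have := hW.1 0 0 u
  rw [add_zero] at this
  exact ((W 0).injective this).symm

theorem IsWeylExp.neg_apply (hW : IsWeylExp a W) (κ : ℝ) (u : L2 d) : W (-κ) (W κ u) = u := by
  rw [← hW.1, neg_add_cancel, hW.map_zero]

/-- The derivative at `κ` follows from the one at `0`, since `V κ` commutes with the generator. -/
theorem IsWeylExp.hasDerivAt (hW : IsWeylExp a W) (ha : IsSymbolOfOrder m a) (κ : ℝ)
    (u : 𝓢(Conf d, ℂ)) :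
    HasDerivAt (fun κ => W κ (toL2 u)) (W κ (-Complex.I • weylLp a u)) κ := by
  obtain ⟨w, hw, hd⟩ := hW.2.2 u
  rw [ha.weylLp_eq u hw] at hd
  have h1 := ((W κ).toContinuousLinearEquiv : L2 d →L[ℂ] L2 d).restrictScalars ℝ
    |>.hasFDerivAt.comp_hasDerivAt (0 : ℝ) hd
  have h2 : HasDerivAt (fun s => W (s + κ) (toL2 u)) (W κ (-Complex.I • weylLp a u)) (κ - κ) := by
    rw [sub_self]
    refine h1.congr_of_eventuallyEq (Filter.Eventually.of_forall fun s => ?_)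
    change W (s + κ) (toL2 u) = W κ (W s (toL2 u))
    rw [add_comm, hW.1]
  simpa using h2.comp_sub_const κ κ

/-- Product rule for a unitary group applied to a differentiable curve. -/
theorem hasDerivAt_isometry_apply {T : ℝ → (L2 d ≃ₗᵢ[ℂ] L2 d)} {v : ℝ → L2 d} {v' D : L2 d} {κ : ℝ}
    (hD : HasDerivAt (fun s => T s (v κ)) D κ) (hc : ContinuousAt (fun s => T s v') κ)
    (hv : HasDerivAt v v' κ) : HasDerivAt (fun s => T s (v s)) (D + T κ v') κ :=
  hasDerivAt_apply_of_norm_le LinearMap.id (M := 1)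
    (T := fun s => ((T s).toLinearEquiv : L2 d →ₗ[ℂ] L2 d).restrictScalars ℝ)
    (Filter.Eventually.of_forall fun s w => by
      rw [one_mul]; exact ((T s).norm_map w).le) hD hc hv

/-- Uniqueness of the exponential of a Weyl operator, given a solution in the Schwartz space. -/
theorem IsWeylExp.apply_toL2 (hW : IsWeylExp a W) (ha : IsSymbolOfOrder m a)
    {V : ℝ → (𝓢(Conf d, ℂ) ≃ₗ[ℂ] 𝓢(Conf d, ℂ))} (hV : IsSchwartzExp a V) (κ : ℝ)
    (u : 𝓢(Conf d, ℂ)) : W κ (toL2 u) = toL2 (V κ u) := by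
  have hd : ∀ κ, HasDerivAt (fun s => W (-s) (toL2 (V s u))) 0 κ := fun κ => by
    have h1 := (hW.hasDerivAt ha (-κ) (V κ u)).scomp κ (hasDerivAt_neg κ)
    have h2 := hasDerivAt_isometry_apply (T := fun s => W (-s)) h1
      ((hW.2.1 _).continuousAt.comp continuous_neg.continuousAt) (hV.hasDerivAt κ u)
    simpa using h2
  have h := is_const_of_deriv_eq_zero (fun κ => (hd κ).differentiableAt) (fun κ => (hd κ).deriv) κ 0
  rw [neg_zero, hW.map_zero, hV.map_zero] at h
  have h' := congrArg (W κ) h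
  have h2 := hW.neg_apply (-κ) (toL2 (V κ u))
  rw [neg_neg] at h2
  rw [h2] at h'
  exact h'.symm

/-- A unitary group is determined by its generator on Schwartz functions as soon as these are
invariant under one group with that generator. -/
theorem IsWeylExp.unique (hW : IsWeylExp a W) (ha : IsSymbolOfOrder m a)
    {V : ℝ → (𝓢(Conf d, ℂ) ≃ₗ[ℂ] 𝓢(Conf d, ℂ))} (hV : IsSchwartzExp a V)
    {W' : ℝ → (L2 d ≃ₗᵢ[ℂ] L2 d)} (hW' : IsWeylExp a W') : W = W' := by
  funext κ
  ext1 w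
  exact congrFun (DenseRange.equalizer denseRange_toL2 (g := fun u => W κ u)
    (h := fun u => W' κ u) (by fun_prop) (by fun_prop) (funext fun u => by
      simp only [Function.comp, hW.apply_toL2 ha hV, hW'.apply_toL2 ha hV])) w

end Groups

/-! ### Quadratic Hamiltonians in coordinates -/

section QuadraticFamilies

variable {d : ℕ}

local notation "bas" => EuclideanSpace.basisFun (Fin d) ℝ

theorem exists_isSchwartzExp_quadHam (A B C : Conf d →L[ℝ] Conf d) (a b : Conf d) (e : ℝ) :
    ∃ V : ℝ → (𝓢(Conf d, ℂ) ≃ₗ[ℂ] 𝓢(Conf d, ℂ)), IsSchwartzExp (quadHam A B C a b e) V :=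
  (isSymbolOfOrder_quadHam A B C a b e).exists_isSchwartzExp
    (exists_local_propagator A B C a b e)

/-- The linear map `x ↦ Σ Mᵢⱼ xᵢ eⱼ`. -/
def matCLM (M : Fin d → Fin d → ℝ) : Conf d →L[ℝ] Conf d :=
  ∑ i, ∑ j, M i j • (innerSL ℝ (bas i)).smulRight (bas j)

/-- The vector `Σ aᵢ eᵢ`. -/
def vecOf (a : Fin d → ℝ) : Conf d := ∑ i, a i • bas i

theorem inner_matCLM (M : Fin d → Fin d → ℝ) (x ξ : Conf d) :
    (inner ℝ (matCLM M x) ξ : ℝ) = ∑ i, ∑ j, M i j * x i * ξ j := by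
  simp [matCLM, sum_inner, sum_apply, inner_smul_left, EuclideanSpace.basisFun_apply,
    EuclideanSpace.inner_single_left, mul_assoc]

theorem inner_vecOf (a : Fin d → ℝ) (x : Conf d) : (inner ℝ (vecOf a) x : ℝ) = ∑ i, a i * x i := by
  simp [vecOf, sum_inner, inner_smul_left, EuclideanSpace.basisFun_apply,
    EuclideanSpace.inner_single_left]

theorem quadHam_matCLM (A B C : Fin d → Fin d → ℝ) (a b : Fin d → ℝ) (c : ℝ) (x ξ : Conf d) :
    quadHam (matCLM A) (matCLM B) (matCLM C) (vecOf a) (vecOf b) c x ξ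
      = (∑ i, ∑ j, A i j * x i * x j) + (∑ i, ∑ j, B i j * x i * ξ j)
        + (∑ i, ∑ j, C i j * ξ i * ξ j) + (∑ i, a i * x i) + (∑ i, b i * ξ i) + c := by
  rw [quadHam, inner_vecOf, inner_vecOf, inner_matCLM, real_inner_comm, inner_matCLM,
    real_inner_comm (matCLM C ξ), inner_matCLM]

/-- Each member of a quadratic family generates a group on the Schwartz space. -/
theorem IsQuadraticFamily.exists_isSchwartzExp {f : ℝ → Conf d → Conf d → ℝ}
    (hf : IsQuadraticFamily f) (t : ℝ) :
    ∃ V : ℝ → (𝓢(Conf d, ℂ) ≃ₗ[ℂ] 𝓢(Conf d, ℂ)), IsSchwartzExp (f t) V := by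
  obtain ⟨A, B, C, a, b, c, -, -, -, -, -, -, h⟩ := hf
  have : f t = quadHam (matCLM (A t)) (matCLM (B t)) (matCLM (C t)) (vecOf (a t)) (vecOf (b t))
      (c t) := by
    funext x ξ
    rw [h, quadHam_matCLM]
  rw [this]
  exact exists_isSchwartzExp_quadHam _ _ _ _ _ _

-- Shortcut instances: without them the search unfolds the iterated product at each use.
instance : NormedAddCommGroup (QuadPoly d) := inferInstance

instance : NormedSpace ℝ (QuadPoly d) := inferInstance

/-- Evaluation of quadratic polynomials at a phase space point, as a linear map. -/
def QuadPoly.evalCLM (z : Conf d × Conf d) : QuadPoly d →L[ℝ] ℝ :=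
  ((ContinuousLinearMap.apply ℝ ℝ z).comp (ContinuousLinearMap.apply ℝ _ z)).comp
      (ContinuousLinearMap.fst ℝ _ _)
    + ((ContinuousLinearMap.apply ℝ ℝ z).comp
      ((ContinuousLinearMap.fst ℝ _ _).comp (ContinuousLinearMap.snd ℝ _ _))
    + (ContinuousLinearMap.snd ℝ _ _).comp (ContinuousLinearMap.snd ℝ _ _))

theorem QuadPoly.evalCLM_apply (z : Conf d × Conf d) (q : QuadPoly d) :
    QuadPoly.evalCLM z q = q.eval z.1 z.2 := by
  simp [QuadPoly.evalCLM, QuadPoly.eval, add_assoc]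

/-- A quadratic family is a differentiable curve in the space of quadratic polynomials. -/
theorem IsQuadraticFamily.exists_quadPoly {f : ℝ → Conf d → Conf d → ℝ}
    (hf : IsQuadraticFamily f) :
    ∃ q : ℝ → QuadPoly d, (∀ t, f t = (q t).eval) ∧ Differentiable ℝ q := by
  obtain ⟨A, B, C, a, b, c, hA, hB, hC, ha, hb, hc, h⟩ := hf
  let E : Fin d → Fin d → (Conf d →L[ℝ] Conf d) := fun i j => (innerSL ℝ (bas i)).smulRight (bas j)
  let q : ℝ → QuadPoly d := fun t =>
    (∑ i, ∑ j, A t i j • quadHamPoly (E i j) 0 0 0 0 0)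
    + (∑ i, ∑ j, B t i j • quadHamPoly 0 (E i j) 0 0 0 0)
    + (∑ i, ∑ j, C t i j • quadHamPoly 0 0 (E i j) 0 0 0)
    + (∑ i, a t i • quadHamPoly 0 0 0 (bas i) 0 0)
    + (∑ i, b t i • quadHamPoly 0 0 0 0 (bas i) 0) + c t • quadHamPoly 0 0 0 0 0 1
  refine ⟨q, fun t => ?_, ?_⟩
  · funext x ξ
    rw [h, ← QuadPoly.evalCLM_apply (x, ξ)]
    simp only [q, map_add, map_sum, map_smul, QuadPoly.evalCLM_apply, quadHamPoly_eval]
    simp [quadHam, E, inner_smul_left, inner_smul_right, EuclideanSpace.basisFun_apply,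
      EuclideanSpace.inner_single_left, EuclideanSpace.inner_single_right, mul_assoc]
  · have dA : ∀ i j, Differentiable ℝ fun t => A t i j := fun i j => (hA i j).differentiable (by simp)
    have dB : ∀ i j, Differentiable ℝ fun t => B t i j := fun i j => (hB i j).differentiable (by simp)
    have dC : ∀ i j, Differentiable ℝ fun t => C t i j := fun i j => (hC i j).differentiable (by simp)
    have da : ∀ i, Differentiable ℝ fun t => a t i := fun i => (ha i).differentiable (by simp)
    have db : ∀ i, Differentiable ℝ fun t => b t i := fun i => (hb i).differentiable (by simp)
    have dc : Differentiable ℝ c := hc.differentiable (by simp)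
    simp only [q]
    fun_prop

end QuadraticFamilies

/-! ### Reflected symbols and moving parity operators -/

section Reflections

instance (d : ℕ) : (volume : Measure (Conf d × Conf d)).IsAddHaarMeasure :=
  inferInstanceAs ((volume.prod volume : Measure (Conf d × Conf d)).IsAddHaarMeasure)

variable {d m : ℕ} {a : Conf d → Conf d → ℝ}

/-- Reflecting the centre `w` about `z`: `Π_z Π_w Π_z = Π_{2z - w}`. -/
theorem parity_parity_parity (z w : Conf d × Conf d) (u : 𝓢(Conf d, ℂ)) :
    parity z (parity w (parity z u)) = parity ((2 : ℝ) • z - w) u := by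
  ext x
  simp only [parity_apply, ← mul_assoc, ← Complex.exp_add]
  have e1 : (2 : ℝ) • z.1 - ((2 : ℝ) • w.1 - ((2 : ℝ) • z.1 - x))
      = (2 : ℝ) • ((2 : ℝ) • z - w).1 - x := by
    rw [Prod.fst_sub, Prod.smul_fst]
    simp only [two_smul]; abel
  rw [e1]
  congr 2
  rw [← mul_add, ← mul_add]
  congr 1
  rw [← Complex.ofReal_add, ← Complex.ofReal_add]
  congr 1
  have e2 : (2 : ℝ) • w.1 - ((2 : ℝ) • z.1 - x) - z.1 = x + (2 : ℝ) • w.1 - (3 : ℝ) • z.1 := by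
    rw [show (3 : ℝ) = 2 + 1 by norm_num, add_smul, one_smul, two_smul, two_smul]; abel
  rw [e2]
  simp only [Prod.fst_sub, Prod.snd_sub, Prod.smul_fst, Prod.smul_snd, inner_add_left,
    inner_sub_left, inner_sub_right, real_inner_smul_left, real_inner_smul_right]
  ring

theorem crossWigner_parity (z w : Conf d × Conf d) (v u : 𝓢(Conf d, ℂ)) :
    crossWigner v (parity z u) w = crossWigner (parity z v) u ((2 : ℝ) • z - w) := by
  rw [← inner_toL2_parity_eq_crossWigner, ← inner_toL2_parity_eq_crossWigner,
    ← parity_parity_parity, inner_toL2_parity_parity]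

/-- Conjugation by a parity operator reflects the symbol. -/
theorem IsSymbolOfOrder.inner_weylLp_parity {a' : Conf d → Conf d → ℝ} {m' : ℕ}
    (ha : IsSymbolOfOrder m a) (ha' : IsSymbolOfOrder m' a') (z : Conf d × Conf d)
    (haa' : ∀ w : Conf d × Conf d, a' w.1 w.2 = a ((2 : ℝ) • z - w).1 ((2 : ℝ) • z - w).2)
    (v u : 𝓢(Conf d, ℂ)) :
    inner ℂ (toL2 v) (weylLp a (parity z u)) = inner ℂ (toL2 (parity z v)) (weylLp a' u) := by
  rw [ha.inner_weylLp, ha'.inner_weylLp]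
  congr 1
  have hneg : (volume : Measure (Conf d × Conf d)).IsNegInvariant :=
    Measure.IsAddHaarMeasure.isNegInvariant_of_regular _
  have := integral_sub_left_eq_self (fun w : Conf d × Conf d => (a w.1 w.2 : ℂ)
    * crossWigner v (parity z u) w) volume ((2 : ℝ) • z)
  rw [← this]
  congr 1; ext w
  rw [haa', crossWigner_parity, sub_sub_cancel]

/-- The parity operator as an involution of the Schwartz space. -/
def parityEquiv (z : Conf d × Conf d) : 𝓢(Conf d, ℂ) ≃ₗ[ℂ] 𝓢(Conf d, ℂ) :=
  LinearEquiv.ofInvolutive (parity z).toLinearMap (parity_parity z)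

theorem parityEquiv_apply (z : Conf d × Conf d) (u : 𝓢(Conf d, ℂ)) :
    parityEquiv z u = parity z u := rfl

theorem norm_toL2_parityEquiv (z : Conf d × Conf d) (u : 𝓢(Conf d, ℂ)) :
    ‖(toL2 (d := d)).toLinearMap (parityEquiv z u)‖ = ‖(toL2 (d := d)).toLinearMap u‖ := by
  rw [parityEquiv_apply]; exact norm_toL2_parity z u

/-- The extension of the parity operator to `L²`. -/
def parityL2 (z : Conf d × Conf d) : L2 d ≃ₗᵢ[ℂ] L2 d :=
  (parityEquiv z).extendOfIsometry (toL2 (d := d)).toLinearMap (toL2 (d := d)).toLinearMap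
    denseRange_toL2 denseRange_toL2 (norm_toL2_parityEquiv z)

theorem parityL2_toL2 (z : Conf d × Conf d) (u : 𝓢(Conf d, ℂ)) :
    parityL2 z (toL2 u) = toL2 (parity z u) :=
  LinearEquiv.extendOfIsometry_eq (parityEquiv z) _ _ denseRange_toL2 denseRange_toL2
    (norm_toL2_parityEquiv z) u

theorem inner_parityL2 (z : Conf d × Conf d) (v : 𝓢(Conf d, ℂ)) (w : L2 d) :
    inner ℂ (toL2 v) (parityL2 z w) = inner ℂ (toL2 (parity z v)) w := by
  conv_lhs => rw [← parity_parity z v, ← parityL2_toL2, LinearIsometryEquiv.inner_map_map]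

/-- The velocity of `parityParam z` when the centre `z` moves with velocity `z'`. -/
def parityParamDeriv (z z' : Conf d × Conf d) : ChirpParam d :=
  (0, (-2 : ℝ) • z'.2, ((2 * (inner ℝ z.1 z'.2 + inner ℝ z'.1 z.2) : ℝ) : ℂ), 0, (2 : ℝ) • z'.1)

open LineDeriv in
/-- The velocity of `Π_z` as its centre moves with velocity `z'`: the product of `Π_z` with an
affine Weyl operator. The affine symbol is the one of `QuadPoly.eval_reflect` if `z'` is the
Hamiltonian field at `z`. -/
theorem toLp_chirpOpDeriv_parity (z z' : Conf d × Conf d) (v : 𝓢(Conf d, ℂ)) :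
    (memLp_chirpOpDeriv (boundedBelow_parityParam z) (parityParamDeriv z z') v).toLp
      = parityL2 z (-Complex.I • weylLp (quadHam 0 0 0 ((2 : ℝ) • z'.2) (-(2 : ℝ) • z'.1)
        (-2 * inner ℝ z'.2 z.1 + 2 * inner ℝ z'.1 z.2)) v) := by
  set c : ℝ := -2 * inner ℝ z'.2 z.1 + 2 * inner ℝ z'.1 z.2 with hc
  let s : 𝓢(Conf d, ℂ) := -Complex.I • (v.posMul ((2 : ℝ) • z'.2) + (c : ℂ) • v)
    + (2 : ℂ) • (∂_{z'.1} v : 𝓢(Conf d, ℂ))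
  have hsx : ∀ x, s x = -Complex.I * ((2 * inner ℝ x z'.2 : ℝ) + (c : ℂ)) * v x
      + 2 * fderiv ℝ v x z'.1 := fun x => by
    simp only [s, add_apply, smul_apply, SchwartzMap.posMul_apply, real_inner_smul_right,
      SchwartzMap.lineDerivOp_apply_eq_fderiv, smul_eq_mul]
    ring
  have hs : toL2 s = -Complex.I • weylLp (quadHam 0 0 0 ((2 : ℝ) • z'.2) (-(2 : ℝ) • z'.1) c) v := by
    refine Lp.ext ((SchwartzMap.coeFn_toLp _ 2 volume).trans ?_)
    filter_upwards [Lp.coeFn_smul (-Complex.I) (weylLp (quadHam 0 0 0 ((2 : ℝ) • z'.2)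
      (-(2 : ℝ) • z'.1) c) v), (isSymbolOfOrder_quadHam 0 0 0 ((2 : ℝ) • z'.2) (-(2 : ℝ) • z'.1)
        c).coeFn_weylLp v] with x e1 e2
    rw [e1, Pi.smul_apply, e2, weylOp_quadHam, hsx]
    simp only [zero_apply, inner_zero_right, inner_zero_left, zero_add, map_neg, map_smul, neg_smul,
      lineDerivOp_left_zero, lineDerivOp_zero, Finset.sum_const_zero, real_inner_smul_right,
      smul_eq_mul, Complex.real_smul, real_inner_comm x]
    push_cast
    linear_combination (2 * fderiv ℝ v x z'.1) * Complex.I_sq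
  rw [← hs, parityL2_toL2]
  refine Lp.ext ((MemLp.coeFn_toLp _).trans ((SchwartzMap.coeFn_toLp _ 2 volume).trans ?_).symm)
  refine Filter.Eventually.of_forall fun x => ?_
  rw [parity, chirpOp_apply (boundedBelow_parityParam z), chirpOpDeriv]
  congr 1
  rw [hsx]
  simp only [parityParam, parityParamDeriv, zero_apply, neg_apply, ContinuousLinearMap.id_apply,
    inner_zero_right, zero_add, map_smul, Complex.real_smul, inner_add_left, inner_neg_left,
    real_inner_smul_left, real_inner_smul_right, hc, real_inner_comm x, real_inner_comm z.1]
  push_cast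
  ring

/-- Moving the centre of a parity operator amounts to the action of a Weyl operator with affine
symbol. -/
theorem hasDerivAt_parity {z z' : ℝ → Conf d × Conf d} {κ₀ : ℝ}
    (hz : ∀ᶠ κ in nhds κ₀, HasDerivAt z (z' κ) κ) (hz' : ContinuousAt z' κ₀) (v : 𝓢(Conf d, ℂ)) :
    HasDerivAt (fun κ => toL2 (parity (z κ) v)) (parityL2 (z κ₀) (-Complex.I •
      weylLp (quadHam 0 0 0 ((2 : ℝ) • (z' κ₀).2) (-(2 : ℝ) • (z' κ₀).1)
        (-2 * inner ℝ (z' κ₀).2 (z κ₀).1 + 2 * inner ℝ (z' κ₀).1 (z κ₀).2)) v)) κ₀ := by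
  have hzc : ContinuousAt z κ₀ := hz.self_of_nhds.continuousAt
  have hθ : ∀ᶠ κ in nhds κ₀, HasDerivAt (fun κ => parityParam (z κ)) (parityParamDeriv (z κ) (z' κ)) κ :=
    hz.mono fun κ h => by
      have h1 : HasDerivAt (fun κ => (z κ).1) (z' κ).1 κ := h.prod_fst
      have h2 : HasDerivAt (fun κ => (z κ).2) (z' κ).2 κ := h.prod_snd
      have h3 := ((h1.inner ℝ h2).const_mul 2).ofReal_comp
      have h4 := h2.const_smul (-2 : ℝ)
      have h5 := h1.const_smul (2 : ℝ)
      exact (hasDerivAt_const κ (0 : Conf d →L[ℝ] Conf d)).prodMk (h4.prodMk (h3.prodMk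
        ((hasDerivAt_const κ (-ContinuousLinearMap.id ℝ (Conf d))).prodMk h5)))
  have hθ' : ContinuousAt (fun κ => parityParamDeriv (z κ) (z' κ)) κ₀ := by
    have h1 : ContinuousAt (fun κ => (2 * (inner ℝ (z κ).1 (z' κ).2 + inner ℝ (z' κ).1 (z κ).2) : ℝ))
      κ₀ := by fun_prop
    have h2 : ContinuousAt (fun κ => (-2 : ℝ) • (z' κ).2) κ₀ := by fun_prop
    have h3 : ContinuousAt (fun κ => (2 : ℝ) • (z' κ).1) κ₀ := by fun_prop
    exact continuousAt_const.prodMk (h2.prodMk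
      ((Complex.continuous_ofReal.continuousAt.comp h1).prodMk (continuousAt_const.prodMk h3)))
  exact (hasDerivAt_chirpOp hθ hθ' (boundedBelow_parityParam (z κ₀)) v).congr_deriv
    (toLp_chirpOpDeriv_parity (z κ₀) (z' κ₀) v)

end Reflections

/-! ### Hamiltonian vector fields of quadratic polynomials -/

section HamiltonianFields

variable {d : ℕ}

local notation "bas" => EuclideanSpace.basisFun (Fin d) ℝ

/-- The vector that represents a linear form. -/
def sharp (d : ℕ) : (Conf d →L[ℝ] ℝ) →L[ℝ] Conf d :=
  ∑ i, (ContinuousLinearMap.apply ℝ ℝ (EuclideanSpace.basisFun (Fin d) ℝ i)).smulRight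
    (EuclideanSpace.basisFun (Fin d) ℝ i)

theorem inner_sharp (l : Conf d →L[ℝ] ℝ) (h : Conf d) : (inner ℝ (sharp d l) h : ℝ) = l h := by
  conv_rhs => rw [← (bas).sum_repr' h, map_sum]
  simp only [sharp, sum_apply, sum_inner, ContinuousLinearMap.smulRight_apply,
    ContinuousLinearMap.apply_apply, inner_smul_left, map_smul, smul_eq_mul, conj_trivial]
  exact Finset.sum_congr rfl fun i _ => mul_comm _ _

/-- The Hamiltonian vector `(∂_ξ, -∂_x)` of a linear form on phase space. -/
def symplGrad (d : ℕ) : ((Conf d × Conf d) →L[ℝ] ℝ) →L[ℝ] (Conf d × Conf d) :=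
  ((sharp d).comp ((ContinuousLinearMap.compL ℝ (Conf d) (Conf d × Conf d) ℝ).flip
    (ContinuousLinearMap.inr ℝ (Conf d) (Conf d)))).prod
  (-((sharp d).comp ((ContinuousLinearMap.compL ℝ (Conf d) (Conf d × Conf d) ℝ).flip
    (ContinuousLinearMap.inl ℝ (Conf d) (Conf d)))))

theorem inner_symplGrad_fst (l : (Conf d × Conf d) →L[ℝ] ℝ) (h : Conf d) :
    (inner ℝ (symplGrad d l).1 h : ℝ) = l (0, h) := by
  simp [symplGrad, inner_sharp]

theorem inner_symplGrad_snd (l : (Conf d × Conf d) →L[ℝ] ℝ) (h : Conf d) :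
    (inner ℝ (symplGrad d l).2 h : ℝ) = - l (h, 0) := by
  simp [symplGrad, inner_sharp]

/-- The linear part of the Hamiltonian vector field of a quadratic polynomial. -/
def QuadPoly.hamLin (q : QuadPoly d) : (Conf d × Conf d) →L[ℝ] (Conf d × Conf d) :=
  (symplGrad d).comp (q.1 + q.1.flip)

/-- The Hamiltonian vector field of a quadratic polynomial. -/
def QuadPoly.hamField (q : QuadPoly d) (z : Conf d × Conf d) : Conf d × Conf d :=
  q.hamLin z + symplGrad d q.2.1

/-- The Hamiltonian field is the Hamiltonian vector of the differential of the polynomial. -/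
theorem QuadPoly.hamField_eq (q : QuadPoly d) (z : Conf d × Conf d) :
    q.hamField z = symplGrad d ((q.1 + q.1.flip) z + q.2.1) := by
  rw [QuadPoly.hamField, QuadPoly.hamLin, map_add]; rfl

/-- Reflection of a quadratic polynomial about `z` changes it by an affine function, which is
exactly the one that moves `Π_z` along the Hamiltonian field. This coincidence is what makes
quadratic Hamiltonians transport parity operators without error. -/
theorem QuadPoly.eval_reflect (q : QuadPoly d) (z w : Conf d × Conf d) :
    q.eval ((2 : ℝ) • z - w).1 ((2 : ℝ) • z - w).2 = q.eval w.1 w.2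
      + quadHam 0 0 0 ((2 : ℝ) • (q.hamField z).2) (-(2 : ℝ) • (q.hamField z).1)
        (-2 * inner ℝ (q.hamField z).2 z.1 + 2 * inner ℝ (q.hamField z).1 z.2) w.1 w.2 := by
  have hv := q.hamField_eq z
  rw [hv]
  generalize hl : (q.1 + q.1.flip) z + q.2.1 = l
  have hl' : ∀ h, l h = q.1 z h + q.1 h z + q.2.1 h := fun h => by rw [← hl]; simp
  have hsplit : ∀ h : Conf d × Conf d, l (h.1, 0) + l (0, h.2) = l h := fun h => by
    rw [← map_add]; simp
  simp only [QuadPoly.eval, quadHam, real_inner_smul_left, inner_symplGrad_fst,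
    inner_symplGrad_snd, zero_apply, inner_zero_left, inner_zero_right]
  have h1 := hsplit z
  have h2 := hsplit w
  rw [hl' z] at h1
  rw [hl' w] at h2
  simp only [Prod.mk.eta, map_sub, map_smul, sub_apply, smul_apply, smul_eq_mul]
  linear_combination (-2) * h1 + 2 * h2

end HamiltonianFields

/-! ### Exact conjugation of Weyl operators by quadratic propagators -/

section Egorov

variable {d : ℕ}

/-- Cross-Wigner functions are transported by the Hamiltonian flow. In the derivative of
`⟨φ, Π_z χ⟩` the commutator of `q^w` with `Π_z` cancels against the motion of the centre. -/
theorem crossWigner_flow {q : QuadPoly d} {φ χ : ℝ → 𝓢(Conf d, ℂ)}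
    (hφ : ∀ κ, HasDerivAt (fun κ => toL2 (φ κ)) (-Complex.I • weylLp q.eval (φ κ)) κ)
    (hχ : ∀ κ, HasDerivAt (fun κ => toL2 (χ κ)) (-Complex.I • weylLp q.eval (χ κ)) κ)
    {z : ℝ → Conf d × Conf d} (hz : ∀ κ, HasDerivAt z (q.hamField (z κ)) κ) (κ : ℝ) :
    crossWigner (φ κ) (χ κ) (z κ) = crossWigner (φ 0) (χ 0) (z 0) := by
  have hzc : Continuous z := continuous_iff_continuousAt.2 fun κ => (hz κ).continuousAt
  have hfc : Continuous fun κ => q.hamField (z κ) :=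
    (q.hamLin.continuous.comp hzc).add continuous_const
  have hd : ∀ κ, HasDerivAt (fun κ => crossWigner (φ κ) (χ κ) (z κ)) 0 κ := fun κ => by
    have h1 := hasDerivAt_parity (κ₀ := κ) (Filter.Eventually.of_forall hz) hfc.continuousAt (χ κ)
    have h2 := hasDerivAt_isometry_apply (T := fun s => parityL2 (z s)) (κ := κ)
      (v := fun s => toL2 (χ s)) (v' := -Complex.I • weylLp q.eval (χ κ))
      (h1.congr_of_eventuallyEq (Filter.Eventually.of_forall fun s => parityL2_toL2 _ _))
      (continuousAt_apply_of_dense (T := fun s => (parityL2 (z s)).toLinearIsometry)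
        denseRange_toL2 (fun u => by
          refine (hasDerivAt_parity (κ₀ := κ) (Filter.Eventually.of_forall hz) hfc.continuousAt u
            ).continuousAt.congr (Filter.Eventually.of_forall fun s => ?_)
          exact (parityL2_toL2 _ _).symm) _) (hχ κ)
    have h3 := (hφ κ).inner ℂ h2
    refine (h3.congr_of_eventuallyEq (Filter.Eventually.of_forall fun s => ?_)).congr_deriv ?_
    · simp only [parityL2_toL2]
      exact (inner_toL2_parity_eq_crossWigner _ _ _).symm
    · set l := quadHam 0 0 0 ((2 : ℝ) • (q.hamField (z κ)).2) (-(2 : ℝ) • (q.hamField (z κ)).1)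
        (-2 * inner ℝ (q.hamField (z κ)).2 (z κ).1 + 2 * inner ℝ (q.hamField (z κ)).1 (z κ).2)
        with hl
      have hls : IsSymbolOfOrder 2 l := isSymbolOfOrder_quadHam _ _ _ _ _ _
      have e1 : inner ℂ (weylLp q.eval (φ κ)) (toL2 (parity (z κ) (χ κ)))
          = inner ℂ (toL2 (parity (z κ) (φ κ))) (weylLp q.eval (χ κ))
            + inner ℂ (toL2 (parity (z κ) (φ κ))) (weylLp l (χ κ)) := by
        rw [q.isSymbolOfOrder.inner_weylLp_left,
          q.isSymbolOfOrder.inner_weylLp_parity (q.isSymbolOfOrder.add hls) (z κ)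
            (fun w => (q.eval_reflect (z κ) w).symm), q.isSymbolOfOrder.weylLp_add_symbol hls,
          inner_add_right]
      rw [inner_add_right, inner_parityL2, inner_parityL2, parityL2_toL2, inner_smul_left,
        inner_smul_right, inner_smul_right, e1]
      simp only [map_neg, Complex.conj_I]
      ring
  exact is_const_of_deriv_eq_zero (fun κ => (hd κ).differentiableAt) (fun κ => (hd κ).deriv) κ 0

/-- `X` is the Hamiltonian flow of the quadratic polynomial `q`. -/
structure QuadPoly.IsFlow (q : QuadPoly d) (X : ℝ → Conf d × Conf d → Conf d × Conf d) : Prop where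
  map_zero : ∀ z, X 0 z = z
  hasDerivAt : ∀ z κ, HasDerivAt (fun κ => X κ z) (q.hamField (X κ z)) κ

theorem exp_smul_mul_exp_smul_neg {E : Type*} [NormedAddCommGroup E] [NormedSpace ℝ E]
    [CompleteSpace E] (A : E →L[ℝ] E) (κ : ℝ) :
    NormedSpace.exp (κ • A) * NormedSpace.exp (κ • -A) = 1 := by
  have : NormedAlgebra ℚ (E →L[ℝ] E) := NormedAlgebra.restrictScalars ℚ ℝ _
  rw [← NormedSpace.exp_add_of_commute, smul_neg, add_neg_cancel, NormedSpace.exp_zero]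
  rw [smul_neg]
  exact (Commute.refl _).neg_right

theorem exp_zero_smul {E : Type*} [NormedAddCommGroup E] [NormedSpace ℝ E] (A : E →L[ℝ] E) :
    NormedSpace.exp ((0 : ℝ) • A) = 1 := by
  rw [zero_smul, NormedSpace.exp_zero]

/-- The linear part of the flow of `q` at time `κ`. -/
def QuadPoly.flowLin (q : QuadPoly d) (κ : ℝ) : (Conf d × Conf d) →L[ℝ] (Conf d × Conf d) :=
  NormedSpace.exp (κ • q.hamLin)

theorem QuadPoly.continuous_flowLin (q : QuadPoly d) : Continuous q.flowLin :=
  continuous_iff_continuousAt.2 fun κ => (hasDerivAt_exp_smul_const q.hamLin κ).continuousAt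

variable {q : QuadPoly d} {X : ℝ → Conf d × Conf d → Conf d × Conf d}

/-- The flow of a quadratic polynomial is affine. -/
theorem QuadPoly.IsFlow.eq (hX : q.IsFlow X) (κ : ℝ) (z : Conf d × Conf d) :
    X κ z = q.flowLin κ z + X κ 0 := by
  have hY : ∀ κ, HasDerivAt (fun κ => X κ z - X κ 0) (q.hamLin (X κ z - X κ 0)) κ := fun κ => by
    refine ((hX.hasDerivAt z κ).sub (hX.hasDerivAt 0 κ)).congr_deriv ?_
    rw [QuadPoly.hamField, QuadPoly.hamField, map_sub]; abel
  -- differences of trajectories solve the linear equation `Y' = A Y`, so `exp (-κ A) Y` is constant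
  have hd : ∀ κ, HasDerivAt (fun κ => NormedSpace.exp (κ • -q.hamLin) (X κ z - X κ 0)) 0 κ :=
    fun κ => by
      refine ((hasDerivAt_exp_smul_const (-q.hamLin) κ).clm_apply (hY κ)).congr_deriv ?_
      rw [mul_apply_eq_comp, neg_apply, map_neg, neg_add_cancel]
  have h := is_const_of_deriv_eq_zero (fun κ => (hd κ).differentiableAt) (fun κ => (hd κ).deriv) κ 0
  have h0 := exp_zero_smul (-q.hamLin)
  simp only [h0, one_apply_eq_self, hX.map_zero, sub_zero] at h
  conv_rhs => rw [QuadPoly.flowLin, ← h, ← mul_apply_eq_comp, exp_smul_mul_exp_smul_neg,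
    one_apply_eq_self, sub_add_cancel]

theorem QuadPoly.det_flowLin_ne_zero (q : QuadPoly d) (κ : ℝ) : (q.flowLin κ).det ≠ 0 := by
  have h := congrArg (fun A : (Conf d × Conf d) →L[ℝ] (Conf d × Conf d) =>
    LinearMap.det (A : (Conf d × Conf d) →ₗ[ℝ] (Conf d × Conf d)))
    (exp_smul_mul_exp_smul_neg q.hamLin κ)
  have h2 : (q.flowLin κ).det * (NormedSpace.exp (κ • -q.hamLin)).det = 1 := by
    refine Eq.trans ?_ (h.trans ?_)
    · exact (LinearMap.det_comp _ _).symm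
    · exact LinearMap.det_id
  exact left_ne_zero_of_mul_eq_one h2

/-- Symbols of order `m` are invariant under affine substitutions. -/
theorem IsSymbolOfOrder.comp_affine {m : ℕ} {a : Conf d → Conf d → ℝ} (ha : IsSymbolOfOrder m a)
    (M : (Conf d × Conf d) →L[ℝ] (Conf d × Conf d)) (b : Conf d × Conf d) :
    IsSymbolOfOrder m (fun x ξ => a (M (x, ξ) + b).1 (M (x, ξ) + b).2) := by
  have hs : ContDiff ℝ ∞ (fun z : Conf d × Conf d => a (z + b).1 (z + b).2) :=
    ha.contDiff.comp (contDiff_id.add contDiff_const)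
  refine ⟨hs.comp M.contDiff, fun k => ?_⟩
  obtain ⟨K, hK⟩ := ha.2 k
  have hK0 : 0 ≤ K := by
    have := (norm_nonneg _).trans (hK 0)
    simpa using this
  refine ⟨K * ‖M‖ ^ k * (1 + ‖M‖ + ‖b‖) ^ m, fun z => ?_⟩
  have h1 := M.iteratedFDeriv_comp_right hs z (i := k) (by exact_mod_cast le_top)
  have h2 : iteratedFDeriv ℝ k (fun z : Conf d × Conf d => a (z + b).1 (z + b).2) (M z)
      = iteratedFDeriv ℝ k (fun z : Conf d × Conf d => a z.1 z.2) (M z + b) :=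
    iteratedFDeriv_comp_add_right (f := fun z : Conf d × Conf d => a z.1 z.2) k b (M z)
  rw [h2] at h1
  have h3 : ‖iteratedFDeriv ℝ k (fun z : Conf d × Conf d => a (M z + b).1 (M z + b).2) z‖
      ≤ ‖iteratedFDeriv ℝ k (fun z : Conf d × Conf d => a z.1 z.2) (M z + b)‖ * ‖M‖ ^ k := by
    refine (le_of_eq (congrArg norm h1)).trans ?_
    refine (ContinuousMultilinearMap.norm_compContinuousLinearMap_le _ _).trans (le_of_eq ?_)
    simp
  have h4 : 1 + ‖M z + b‖ ≤ (1 + ‖M‖ + ‖b‖) * (1 + ‖z‖) := by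
    have t1 := norm_add_le (M z) b
    have t2 := M.le_opNorm z
    nlinarith [norm_nonneg z, norm_nonneg M, norm_nonneg b, mul_nonneg (norm_nonneg b) (norm_nonneg z)]
  calc _ ≤ _ := h3
    _ ≤ K * (1 + ‖M z + b‖) ^ m * ‖M‖ ^ k := by gcongr; exact hK _
    _ ≤ K * ((1 + ‖M‖ + ‖b‖) * (1 + ‖z‖)) ^ m * ‖M‖ ^ k := by gcongr
    _ = _ := by rw [mul_pow]; ring

theorem IsSymbolOfOrder.comp_flow {m : ℕ} {a : Conf d → Conf d → ℝ} (ha : IsSymbolOfOrder m a)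
    (hX : q.IsFlow X) (κ : ℝ) : IsSymbolOfOrder m (fun x ξ => a (X κ (x, ξ)).1 (X κ (x, ξ)).2) := by
  have := ha.comp_affine (q.flowLin κ) (X κ 0)
  simpa only [← hX.eq] using this

/-- The constant symbol `1` quantizes to the identity. -/
theorem weylLp_one (u : 𝓢(Conf d, ℂ)) : weylLp (quadHam 0 0 0 0 0 1) u = toL2 u := by
  refine Lp.ext ?_
  filter_upwards [(isSymbolOfOrder_quadHam (d := d) 0 0 0 0 0 1).coeFn_weylLp u,
    SchwartzMap.coeFn_toLp u 2 volume] with x h1 h2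
  refine h1.trans (Eq.trans ?_ h2.symm)
  rw [weylOp_quadHam]
  simp [LineDeriv.lineDerivOp_left_zero, LineDeriv.lineDerivOp_zero]

theorem exists_schwartz_ne_zero (d : ℕ) : ∃ u : 𝓢(Conf d, ℂ), toL2 u ≠ 0 := by
  by_contra! h
  have h0 : ∀ w : L2 d, w = 0 := fun w =>
    congrFun (DenseRange.equalizer denseRange_toL2 (g := fun w : L2 d => w) (h := fun _ => 0)
      continuous_id continuous_const (funext h)) w
  have h1 := h0 (indicatorConstLp 2 (measurableSet_ball (x := (0 : Conf d)) (ε := 1))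
    measure_ball_lt_top.ne (1 : ℂ))
  have h2 := congrArg norm h1
  rw [norm_indicatorConstLp (by simp) (by simp), norm_zero, norm_one, one_mul] at h2
  have h3 : 0 < (volume : Measure (Conf d)).real (Metric.ball 0 1) :=
    ENNReal.toReal_pos (Metric.measure_ball_pos _ _ one_pos).ne' measure_ball_lt_top.ne
  exact (Real.rpow_pos_of_pos h3 _).ne' h2

/-- **Egorov's theorem** for quadratic Hamiltonians, where it is exact. -/
theorem IsSchwartzExp.inner_weylLp {V : ℝ → (𝓢(Conf d, ℂ) ≃ₗ[ℂ] 𝓢(Conf d, ℂ))}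
    (hV : IsSchwartzExp q.eval V) (hX : q.IsFlow X) {m : ℕ} {a : Conf d → Conf d → ℝ}
    (ha : IsSymbolOfOrder m a) (κ : ℝ) (v u : 𝓢(Conf d, ℂ)) :
    inner ℂ (toL2 (V κ v)) (weylLp a (V κ u))
      = inner ℂ (toL2 v) (weylLp (fun x ξ => a (X κ (x, ξ)).1 (X κ (x, ξ)).2) u) := by
  -- the identity up to the Jacobian of the flow
  have key : ∀ {m : ℕ} {a : Conf d → Conf d → ℝ} (ha : IsSymbolOfOrder m a)
      (v u : 𝓢(Conf d, ℂ)),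
      inner ℂ (toL2 v) (weylLp (fun x ξ => a (X κ (x, ξ)).1 (X κ (x, ξ)).2) u)
        = |(q.flowLin κ).det|⁻¹ * inner ℂ (toL2 (V κ v)) (weylLp a (V κ u)) := by
    intro m a ha v u
    rw [(ha.comp_flow hX κ).inner_weylLp, ha.inner_weylLp]
    have h1 : ∀ z, crossWigner v u z = crossWigner (V κ v) (V κ u) (X κ z) := fun z => by
      have := crossWigner_flow (hV.hasDerivAt · v) (hV.hasDerivAt · u) (hX.hasDerivAt z) κ
      rw [this, hV.map_zero, hX.map_zero]; rfl
    have h2 := integral_comp_affine (volume : Measure (Conf d × Conf d)) (q.det_flowLin_ne_zero κ)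
      (X κ 0) (g := fun z => (a z.1 z.2 : ℂ) * crossWigner (V κ v) (V κ u) z)
      ((Complex.continuous_ofReal.comp ha.continuous).stronglyMeasurable.mul
        (stronglyMeasurable_crossWigner _ _))
    simp only [← hX.eq] at h2
    simp only [h1, Prod.mk.eta]
    rw [h2, Complex.real_smul]
    ring
  -- the Jacobian is one, as the constant symbol shows
  have hdet : |(q.flowLin κ).det|⁻¹ = 1 := by
    obtain ⟨w, hw⟩ := exists_schwartz_ne_zero d
    have h1 := key (isSymbolOfOrder_quadHam 0 0 0 0 0 1) w w
    have h2 : (fun x ξ => quadHam (0 : Conf d →L[ℝ] Conf d) 0 0 0 0 1 (X κ (x, ξ)).1 (X κ (x, ξ)).2)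
      = quadHam 0 0 0 0 0 1 := by funext x ξ; simp [quadHam]
    rw [h2, weylLp_one, weylLp_one, inner_self_eq_norm_sq_to_K, inner_self_eq_norm_sq_to_K,
      hV.norm_map] at h1
    have h3 : ((‖toL2 w‖ : ℂ) ^ 2) ≠ 0 := by simpa using hw
    have h4 : ((|(q.flowLin κ).det|⁻¹ : ℝ) : ℂ) = 1 := mul_right_cancel₀ h3 (by
      rw [one_mul]; exact h1.symm)
    exact_mod_cast h4
  rw [key ha, hdet, Complex.ofReal_one, one_mul]

/-- Egorov's theorem as an operator identity on Schwartz functions. -/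
theorem IsWeylExp.apply_weylLp {W : ℝ → (L2 d ≃ₗᵢ[ℂ] L2 d)} (hW : IsWeylExp q.eval W)
    {V : ℝ → (𝓢(Conf d, ℂ) ≃ₗ[ℂ] 𝓢(Conf d, ℂ))} (hV : IsSchwartzExp q.eval V) (hX : q.IsFlow X)
    {m : ℕ} {a : Conf d → Conf d → ℝ} (ha : IsSymbolOfOrder m a) (κ : ℝ) (u : 𝓢(Conf d, ℂ)) :
    W κ (weylLp (fun x ξ => a (X κ (x, ξ)).1 (X κ (x, ξ)).2) u) = weylLp a (V κ u) := by
  refine ext_inner_toL2 fun v => ?_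
  obtain ⟨v, rfl⟩ := (V κ).surjective v
  rw [hV.inner_weylLp hX ha, ← hW.apply_toL2 q.isSymbolOfOrder hV, LinearIsometryEquiv.inner_map_map]

end Egorov

/-! ### Quantization as a linear map on quadratic polynomials -/

section QuadraticQuantization

variable {d : ℕ}

instance : AddCommGroup (QuadPoly d) := NormedAddCommGroup.toAddCommGroup

instance : Module ℝ (QuadPoly d) := NormedSpace.toModule

instance : SMulZeroClass ℝ (QuadPoly d) :=
  (Module.toDistribMulAction (R := ℝ) (M := QuadPoly d)).toDistribSMul.toSMulZeroClass

instance : FiniteDimensional ℝ (QuadPoly d) := by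
  have prod : ∀ (E F : Type) [NormedAddCommGroup E] [NormedSpace ℝ E] [NormedAddCommGroup F]
      [NormedSpace ℝ F] [FiniteDimensional ℝ E] [FiniteDimensional ℝ F],
      FiniteDimensional ℝ (E × F) := fun _ _ => inferInstance
  have h1 : FiniteDimensional ℝ ((Conf d × Conf d) →L[ℝ] ℝ) := inferInstance
  have h2 : FiniteDimensional ℝ ((Conf d × Conf d) →L[ℝ] (Conf d × Conf d) →L[ℝ] ℝ) :=
    inferInstance
  have h3 := prod ((Conf d × Conf d) →L[ℝ] ℝ) ℝ
  exact prod ((Conf d × Conf d) →L[ℝ] (Conf d × Conf d) →L[ℝ] ℝ)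
    (((Conf d × Conf d) →L[ℝ] ℝ) × ℝ)

instance : ProperSpace (QuadPoly d) := FiniteDimensional.proper ℝ _

theorem QuadPoly.eval_add (q p : QuadPoly d) :
    (q + p).eval = fun x ξ => q.eval x ξ + p.eval x ξ := by
  funext x ξ
  simp only [← QuadPoly.evalCLM_apply (x, ξ), map_add]

theorem QuadPoly.eval_smul (c : ℝ) (q : QuadPoly d) :
    (c • q).eval = fun x ξ => c * q.eval x ξ := by
  funext x ξ
  simp only [← QuadPoly.evalCLM_apply (x, ξ), map_smul, smul_eq_mul]

/-- The Weyl quantization of quadratic polynomials, applied to a fixed Schwartz function. -/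
def quadWeyl (u : 𝓢(Conf d, ℂ)) : QuadPoly d →L[ℝ] L2 d :=
  LinearMap.toContinuousLinearMap
    { toFun := fun q => weylLp q.eval u
      map_add' := fun q p => by
        rw [QuadPoly.eval_add]
        exact q.isSymbolOfOrder.weylLp_add_symbol p.isSymbolOfOrder u
      map_smul' := fun c q => by
        rw [QuadPoly.eval_smul]
        exact q.isSymbolOfOrder.weylLp_const_mul_symbol c u }

theorem quadWeyl_apply (u : 𝓢(Conf d, ℂ)) (q : QuadPoly d) : quadWeyl u q = weylLp q.eval u := rfl

/-- The quadratic polynomial `z ↦ q (M z + b)`. -/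
def QuadPoly.compAffine (M : (Conf d × Conf d) →L[ℝ] (Conf d × Conf d)) (b : Conf d × Conf d)
    (q : QuadPoly d) : QuadPoly d :=
  (((ContinuousLinearMap.compL ℝ (Conf d × Conf d) (Conf d × Conf d) ℝ).flip M).comp (q.1.comp M),
    (q.1 b + q.1.flip b + q.2.1).comp M, q.1 b b + q.2.1 b + q.2.2)

theorem QuadPoly.eval_compAffine (M : (Conf d × Conf d) →L[ℝ] (Conf d × Conf d))
    (b : Conf d × Conf d) (q : QuadPoly d) (x ξ : Conf d) :
    (q.compAffine M b).eval x ξ = q.eval (M (x, ξ) + b).1 (M (x, ξ) + b).2 := by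
  simp only [QuadPoly.eval, QuadPoly.compAffine, ContinuousLinearMap.comp_apply,
    ContinuousLinearMap.flip_apply, ContinuousLinearMap.compL_apply, add_apply, Prod.mk.eta,
    map_add]
  ring

theorem QuadPoly.continuous_compAffine {T : Type*} [TopologicalSpace T]
    {M : T → (Conf d × Conf d) →L[ℝ] (Conf d × Conf d)} {b : T → Conf d × Conf d}
    {q : T → QuadPoly d} (hM : Continuous M) (hb : Continuous b) (hq : Continuous q) :
    Continuous fun t => (q t).compAffine (M t) (b t) := by
  have h1 : Continuous fun t => (q t).1 := continuous_fst.comp hq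
  have h2 : Continuous fun t => (q t).2.1 := (continuous_fst.comp continuous_snd).comp hq
  have h3 : Continuous fun t => (q t).2.2 := (continuous_snd.comp continuous_snd).comp hq
  have h4 : Continuous fun t => (q t).1.flip :=
    (ContinuousLinearMap.flipₗᵢ ℝ (Conf d × Conf d) (Conf d × Conf d) ℝ).continuous.comp h1
  have h5 : Continuous fun t =>
      (ContinuousLinearMap.compL ℝ (Conf d × Conf d) (Conf d × Conf d) ℝ).flip (M t) :=
    (ContinuousLinearMap.continuous _).comp hM
  refine (h5.clm_comp (h1.clm_comp hM)).prodMk (Continuous.prodMk ?_ ?_)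
  · exact (((h1.clm_apply hb).add (h4.clm_apply hb)).add h2).clm_comp hM
  · exact (((h1.clm_apply hb).clm_apply hb).add (h2.clm_apply hb)).add h3

end QuadraticQuantization

/-! ### Comparison of two quadratic propagators -/

section Duhamel

variable {d : ℕ} {q : QuadPoly d} {X : ℝ → Conf d × Conf d → Conf d × Conf d}

/-- The quadratic polynomial `r ∘ X κ`, for the affine flow `X` of `q`. -/
def QuadPoly.compFlow (q : QuadPoly d) (X : ℝ → Conf d × Conf d → Conf d × Conf d) (κ : ℝ)
    (r : QuadPoly d) : QuadPoly d :=
  r.compAffine (q.flowLin κ) (X κ 0)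

theorem QuadPoly.IsFlow.eval_compFlow (hX : q.IsFlow X) (κ : ℝ) (r : QuadPoly d) :
    (q.compFlow X κ r).eval = fun x ξ => r.eval (X κ (x, ξ)).1 (X κ (x, ξ)).2 := by
  funext x ξ
  rw [QuadPoly.compFlow, QuadPoly.eval_compAffine, ← hX.eq]

theorem QuadPoly.IsFlow.continuous_compFlow (hX : q.IsFlow X) :
    Continuous fun z : ℝ × QuadPoly d => q.compFlow X z.1 z.2 :=
  QuadPoly.continuous_compAffine (q.continuous_flowLin.comp continuous_fst)
    ((continuous_iff_continuousAt.2 fun κ => (hX.hasDerivAt 0 κ).continuousAt).comp continuous_fst)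
    continuous_snd

theorem QuadPoly.IsFlow.continuous_compFlow_left (hX : q.IsFlow X)
    (r : QuadPoly d) : Continuous fun κ => q.compFlow X κ r :=
  hX.continuous_compFlow.comp (Continuous.prodMk_left r)

theorem QuadPoly.IsFlow.continuous_quadWeyl_compFlow (hX : q.IsFlow X) (v : 𝓢(Conf d, ℂ))
    (r : QuadPoly d) : Continuous fun κ => quadWeyl v (q.compFlow X κ r) :=
  (quadWeyl v).continuous.comp (hX.continuous_compFlow_left r)

theorem QuadPoly.IsFlow.quadWeyl_compFlow_smul (hX : q.IsFlow X) (v : 𝓢(Conf d, ℂ)) (κ c : ℝ)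
    (r : QuadPoly d) :
    quadWeyl v (q.compFlow X κ (c • r)) = c • quadWeyl v (q.compFlow X κ r) := by
  have h : (q.compFlow X κ (c • r)).eval = (c • q.compFlow X κ r).eval := by
    rw [QuadPoly.eval_smul, hX.eval_compFlow, hX.eval_compFlow, QuadPoly.eval_smul]
  rw [← map_smul, quadWeyl_apply, h, quadWeyl_apply]

/-- The bound holds on the unit ball of the finite-dimensional space of quadratic polynomials by
compactness, and everywhere by homogeneity. -/
theorem QuadPoly.IsFlow.exists_norm_quadWeyl_compFlow_le (hX : q.IsFlow X) (v : 𝓢(Conf d, ℂ)) :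
    ∃ C, ∀ κ ∈ Set.Icc (0 : ℝ) 1, ∀ r, ‖quadWeyl v (q.compFlow X κ r)‖ ≤ C * ‖r‖ := by
  obtain ⟨C, hC⟩ := (isCompact_Icc.prod (isCompact_closedBall (0 : QuadPoly d) 1)
    |>.exists_bound_of_continuousOn (s := Set.Icc (0 : ℝ) 1 ×ˢ Metric.closedBall (0 : QuadPoly d) 1)
      (((quadWeyl v).continuous.comp hX.continuous_compFlow).continuousOn))
  refine ⟨C, fun κ hκ r => ?_⟩
  rcases eq_or_ne r 0 with rfl | hr
  · have := hX.quadWeyl_compFlow_smul v κ 0 0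
    rw [smul_zero, zero_smul] at this
    rw [this, norm_zero, norm_zero, mul_zero]
  · have h1 := hC (κ, ‖r‖⁻¹ • r) ⟨hκ, by
      rw [mem_closedBall_zero_iff, norm_smul, norm_inv, norm_norm,
        inv_mul_cancel₀ (norm_ne_zero_iff.2 hr)]⟩
    rw [Function.comp_apply, hX.quadWeyl_compFlow_smul, norm_smul, norm_inv, norm_norm] at h1
    rwa [← div_le_iff₀ (norm_pos_iff.2 hr), div_eq_inv_mul]

variable {p : QuadPoly d} {W W' : ℝ → (L2 d ≃ₗᵢ[ℂ] L2 d)} {V : ℝ → (𝓢(Conf d, ℂ) ≃ₗ[ℂ] 𝓢(Conf d, ℂ))}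

/-- The derivative behind Duhamel's formula. By Egorov's theorem `(p - q)^w V κ v` equals
`W κ ((p - q) ∘ X κ)^w v`, where the Schwartz function `v` no longer depends on `κ`. -/
theorem IsWeylExp.hasDerivAt_duhamel (hW : IsWeylExp q.eval W) (hW' : IsWeylExp p.eval W')
    (hV : IsSchwartzExp q.eval V) (hX : q.IsFlow X) (v : 𝓢(Conf d, ℂ)) (τ κ : ℝ) :
    HasDerivAt (fun κ => W' (τ - κ) (W κ (toL2 v)))
      (W' (τ - κ) (W κ (Complex.I • quadWeyl v (q.compFlow X κ (p - q))))) κ := by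
  simp only [hW.apply_toL2 q.isSymbolOfOrder hV]
  have h1 := (hW'.hasDerivAt p.isSymbolOfOrder (τ - κ) (V κ v)).scomp κ
    ((hasDerivAt_id κ).const_sub τ)
  refine (hasDerivAt_isometry_apply (T := fun s => W' (τ - s)) h1
    ((hW'.2.1 _).comp (continuous_const.sub continuous_id)).continuousAt
    (hV.hasDerivAt κ v)).congr_deriv ?_
  rw [map_smul (W κ), quadWeyl_apply, hX.eval_compFlow,
    hW.apply_weylLp hV hX (p - q).isSymbolOfOrder, ← quadWeyl_apply _ (p - q),
    (quadWeyl (V κ v)).map_sub, quadWeyl_apply, quadWeyl_apply, neg_smul, one_smul, ← map_neg,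
    ← map_add]
  congr 1
  rw [smul_sub, neg_smul, neg_smul, neg_neg, sub_eq_add_neg]

/-- Strong convergence of isometries at the limit of a convergent family of vectors suffices for
convergence of the values. -/
theorem tendsto_isometry_apply {T : Type*} {l : Filter T} {W : T → (L2 d ≃ₗᵢ[ℂ] L2 d)}
    {w : T → L2 d} {w₀ z : L2 d} (hw : Filter.Tendsto w l (nhds w₀))
    (hW : Filter.Tendsto (fun t => W t w₀) l (nhds z)) :
    Filter.Tendsto (fun t => W t (w t)) l (nhds z) := by
  rw [tendsto_iff_norm_sub_tendsto_zero] at hw hW ⊢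
  refine squeeze_zero (fun _ => norm_nonneg _) (fun t => ?_) (by simpa using hw.add hW)
  rw [← (W t).norm_map (w t - w₀), map_sub]
  exact norm_sub_le_norm_sub_add_norm_sub _ _ _

theorem continuous_isometry_apply {T : Type*} [TopologicalSpace T] {W : T → (L2 d ≃ₗᵢ[ℂ] L2 d)}
    {w : T → L2 d} (hW : ∀ u, Continuous fun t => W t u) (hw : Continuous w) :
    Continuous fun t => W t (w t) :=
  continuous_iff_continuousAt.2 fun t₀ =>
    tendsto_isometry_apply (hw.tendsto t₀) ((hW (w t₀)).tendsto t₀)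

/-- The unitary groups generated by quadratic Hamiltonians depend Lipschitz continuously on the
Hamiltonian, on each Schwartz function. -/
theorem IsWeylExp.exists_norm_sub_le (hW : IsWeylExp q.eval W) (hV : IsSchwartzExp q.eval V)
    (hX : q.IsFlow X) (v : 𝓢(Conf d, ℂ)) :
    ∃ C, ∀ (p : QuadPoly d) (W' : ℝ → (L2 d ≃ₗᵢ[ℂ] L2 d)), IsWeylExp p.eval W' →
      ∀ τ ∈ Set.Icc (0 : ℝ) 1, ‖W' τ (toL2 v) - W τ (toL2 v)‖ ≤ C * ‖p - q‖ := by
  obtain ⟨C, hC⟩ := hX.exists_norm_quadWeyl_compFlow_le v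
  refine ⟨C, fun p W' hW' τ hτ => ?_⟩
  have hC0 : 0 ≤ C * ‖p - q‖ := (norm_nonneg _).trans (hC τ hτ (p - q))
  have h1 := norm_image_sub_le_of_norm_deriv_le_segment'
    (fun κ _ => (hW.hasDerivAt_duhamel hW' hV hX v τ κ).hasDerivWithinAt) (C := C * ‖p - q‖)
    (fun κ hκ => by
      rw [(W' _).norm_map, (W _).norm_map, norm_smul, Complex.norm_I, one_mul]
      exact hC κ ⟨hκ.1, hκ.2.le.trans hτ.2⟩ _) τ ⟨hτ.1, le_rfl⟩
  rw [sub_self, hW'.map_zero, sub_zero, hW.map_zero, norm_sub_rev] at h1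
  exact h1.trans (mul_le_of_le_one_right hC0 (by linarith [hτ.2]))

/-- Duhamel's formula. -/
theorem IsWeylExp.sub_eq_integral (hW : IsWeylExp q.eval W) (hW' : IsWeylExp p.eval W')
    (hV : IsSchwartzExp q.eval V) (hX : q.IsFlow X) (v : 𝓢(Conf d, ℂ)) :
    W' 1 (toL2 v) - W 1 (toL2 v) = ∫ κ in (0 : ℝ)..1,
      W' (1 - κ) (W κ (-Complex.I • quadWeyl v (q.compFlow X κ (p - q)))) := by
  have hc : Continuous fun κ =>
      W' (1 - κ) (W κ (Complex.I • quadWeyl v (q.compFlow X κ (p - q)))) :=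
    continuous_isometry_apply (W := fun κ => W' (1 - κ))
      (fun u => (hW'.2.1 u).comp (continuous_const.sub continuous_id))
      (continuous_isometry_apply hW.2.1
        ((hX.continuous_quadWeyl_compFlow v (p - q)).const_smul Complex.I))
  have h := intervalIntegral.integral_eq_sub_of_hasDerivAt
    (fun κ _ => hW.hasDerivAt_duhamel hW' hV hX v 1 κ) (hc.intervalIntegrable 0 1)
  rw [sub_self, hW'.map_zero, sub_zero, hW.map_zero] at h
  rw [← neg_sub, ← h, ← intervalIntegral.integral_neg]
  simp only [neg_smul, map_neg]

end Duhamel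

/-! ### Dependence of the propagator on a parameter -/

section ParameterDerivative

variable {d : ℕ} {q : ℝ → QuadPoly d} {q' : QuadPoly d} {t : ℝ}
  {X : ℝ → Conf d × Conf d → Conf d × Conf d} {W : ℝ → ℝ → (L2 d ≃ₗᵢ[ℂ] L2 d)}
  {V : ℝ → (𝓢(Conf d, ℂ) ≃ₗ[ℂ] 𝓢(Conf d, ℂ))}

/-- The average `∫₀¹ r ∘ X κ dκ` of a quadratic polynomial along the flow of `q`. -/
def QuadPoly.flowAverage (q : QuadPoly d) (X : ℝ → Conf d × Conf d → Conf d × Conf d)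
    (r : QuadPoly d) : QuadPoly d :=
  ∫ κ in (0 : ℝ)..1, q.compFlow X κ r

theorem QuadPoly.IsFlow.eval_flowAverage {q : QuadPoly d} (hX : q.IsFlow X) (r : QuadPoly d)
    (x ξ : Conf d) :
    (q.flowAverage X r).eval x ξ
      = ∫ κ in (0 : ℝ)..1, r.eval (X κ (x, ξ)).1 (X κ (x, ξ)).2 := by
  rw [← QuadPoly.evalCLM_apply (x, ξ), QuadPoly.flowAverage,
    ← ContinuousLinearMap.intervalIntegral_comp_comm _
      ((hX.continuous_compFlow_left r).intervalIntegrable 0 1)]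
  simp only [QuadPoly.evalCLM_apply, hX.eval_compFlow]

/-- Strong continuity in the parameter. -/
theorem continuousAt_weylExp (hq : ContinuousAt q t) (hW : ∀ t, IsWeylExp (q t).eval (W t))
    (hV : IsSchwartzExp (q t).eval V) (hX : (q t).IsFlow X) {τ : ℝ} (hτ : τ ∈ Set.Icc (0 : ℝ) 1)
    (w : L2 d) : ContinuousAt (fun s => W s τ w) t := by
  refine continuousAt_apply_of_dense (T := fun s => (W s τ).toLinearIsometry) denseRange_toL2
    (fun v => ?_) w
  obtain ⟨C, hC⟩ := (hW t).exists_norm_sub_le hV hX v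
  rw [ContinuousAt, tendsto_iff_norm_sub_tendsto_zero]
  refine squeeze_zero (fun _ => norm_nonneg _) (fun s => hC (q s) (W s) (hW s) τ hτ) ?_
  have := tendsto_iff_norm_sub_tendsto_zero.1 hq
  simpa using this.const_mul C

/-- The derivative of `t ↦ exp (-i q_t^w) v` is `-i exp (-i q_t^w) (∫₀¹ q' ∘ X κ dκ)^w v`, where `q'`
is the derivative of `t ↦ q_t`. -/
theorem hasDerivAt_weylExp (hq : HasDerivAt q q' t) (hW : ∀ t, IsWeylExp (q t).eval (W t))
    (hV : IsSchwartzExp (q t).eval V) (hX : (q t).IsFlow X) (v : 𝓢(Conf d, ℂ)) :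
    HasDerivAt (fun s => W s 1 (toL2 v))
      (W t 1 (-Complex.I • weylLp ((q t).flowAverage X q').eval v)) t := by
  obtain ⟨C, hC⟩ := hX.exists_norm_quadWeyl_compFlow_le v
  have hqc := hq.continuousAt
  rw [hasDerivAt_iff_tendsto_slope] at hq ⊢
  -- difference quotients are Duhamel integrals of difference quotients of `q`
  have hslope : ∀ s, slope (fun s => W s 1 (toL2 v)) t s = ∫ κ in (0 : ℝ)..1,
      W s (1 - κ) (W t κ (-Complex.I • quadWeyl v ((q t).compFlow X κ (slope q t s)))) := fun s => by
    rw [slope_def_module, (hW t).sub_eq_integral (hW s) hV hX v,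
      ← intervalIntegral.integral_smul]
    refine intervalIntegral.integral_congr fun κ _ => ?_
    simp only [slope_def_module, hX.quadWeyl_compFlow_smul]
    rw [smul_comm (-Complex.I) ((s - t)⁻¹ : ℝ), map_real_smul (W t κ) (W t κ).continuous,
      map_real_smul (W s (1 - κ)) (W s (1 - κ)).continuous]
  -- in the limit the two propagators combine to `W t 1`, which leaves the integral
  have hlim : W t 1 (-Complex.I • weylLp ((q t).flowAverage X q').eval v) = ∫ κ in (0 : ℝ)..1,
      W t (1 - κ) (W t κ (-Complex.I • quadWeyl v ((q t).compFlow X κ q'))) := by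
    have h1 : ∀ κ, W t (1 - κ) (W t κ (-Complex.I • quadWeyl v ((q t).compFlow X κ q')))
        = (W t 1).toContinuousLinearEquiv.toContinuousLinearMap
          (-Complex.I • quadWeyl v ((q t).compFlow X κ q')) := fun κ => by
      rw [← (hW t).1, sub_add_cancel]; rfl
    have hi : Continuous fun κ => -Complex.I • quadWeyl v ((q t).compFlow X κ q') :=
      (hX.continuous_quadWeyl_compFlow v q').const_smul (-Complex.I)
    simp only [h1]
    rw [ContinuousLinearMap.intervalIntegral_comp_comm _ (hi.intervalIntegrable 0 1), intervalIntegral.integral_smul,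
      ContinuousLinearMap.intervalIntegral_comp_comm _
      ((hX.continuous_compFlow_left q').intervalIntegrable 0 1)]
    rfl
  rw [hlim]
  refine Filter.Tendsto.congr (fun s => (hslope s).symm) ?_
  have hb : ∀ᶠ s in nhdsWithin t {t}ᶜ, ‖slope q t s‖ ≤ ‖q'‖ + 1 :=
    (hq.norm.eventually (gt_mem_nhds (lt_add_one ‖q'‖))).mono fun s hs => le_of_lt hs
  refine intervalIntegral.tendsto_integral_filter_of_dominated_convergence
    (fun _ => |C| * (‖q'‖ + 1)) ?_ ?_ intervalIntegrable_const ?_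
  · refine Filter.Eventually.of_forall fun s => Continuous.aestronglyMeasurable ?_
    exact continuous_isometry_apply (W := fun κ => W s (1 - κ))
      (fun u => ((hW s).2.1 u).comp (continuous_const.sub continuous_id))
      (continuous_isometry_apply (hW t).2.1
        ((hX.continuous_quadWeyl_compFlow v _).const_smul (-Complex.I)))
  · filter_upwards [hb] with s hs
    refine Filter.Eventually.of_forall fun κ hκ => ?_
    rw [Set.uIoc_of_le zero_le_one] at hκ
    rw [(W s _).norm_map, (W t _).norm_map, norm_smul, norm_neg, Complex.norm_I, one_mul]
    calc _ ≤ C * ‖slope q t s‖ := hC κ ⟨hκ.1.le, hκ.2⟩ _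
      _ ≤ |C| * ‖slope q t s‖ := by gcongr; exact le_abs_self C
      _ ≤ _ := by gcongr
  · refine Filter.Eventually.of_forall fun κ hκ => ?_
    rw [Set.uIoc_of_le zero_le_one] at hκ
    set y : QuadPoly d → L2 d := fun r => W t κ (-Complex.I • quadWeyl v ((q t).compFlow X κ r))
      with hy
    have hyc : Continuous y := (W t κ).continuous.comp (((quadWeyl v).continuous.comp
      (hX.continuous_compFlow.comp (Continuous.prodMk_right κ))).const_smul (-Complex.I))
    exact tendsto_isometry_apply (W := fun s => W s (1 - κ)) ((hyc.tendsto q').comp hq)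
      ((continuousAt_weylExp (τ := 1 - κ) hqc hW hV hX
        ⟨by linarith [hκ.2], by linarith [hκ.1]⟩ (y q')).tendsto.mono_left
          (nhdsWithin_le_nhds (s := {t}ᶜ)))

end ParameterDerivative

/-! ### Weak differentiability of curves in `L²` -/

section HilbertSpaceCurves

variable {d : ℕ}

theorem continuous_isometry_symm {X : Type*} [TopologicalSpace X] {T : X → (L2 d ≃ₗᵢ[ℂ] L2 d)}
    (h : ∀ u, Continuous fun s => T s u) (u : L2 d) : Continuous fun s => (T s).symm u := by
  refine continuous_iff_continuousAt.2 fun t => ?_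
  have h1 := tendsto_iff_norm_sub_tendsto_zero.1 ((h ((T t).symm u)).tendsto t)
  rw [ContinuousAt, tendsto_iff_norm_sub_tendsto_zero]
  refine h1.congr fun s => ?_
  rw [LinearIsometryEquiv.apply_symm_apply, ← (T s).norm_map ((T s).symm u - _), map_sub,
    LinearIsometryEquiv.apply_symm_apply, norm_sub_rev]

/-- Differentiation of the inverse of a family of unitary operators, at a vector `T t v`. -/
theorem hasDerivAt_isometry_symm {T : ℝ → (L2 d ≃ₗᵢ[ℂ] L2 d)} (h : ∀ u, Continuous fun s => T s u)
    {v D : L2 d} {t : ℝ} (hD : HasDerivAt (fun s => T s v) (T t D) t) :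
    HasDerivAt (fun s => (T s).symm (T t v)) (-D) t := by
  rw [hasDerivAt_iff_tendsto_slope] at hD ⊢
  have h1 : ∀ s, slope (fun s => (T s).symm (T t v)) t s
      = -(T s).symm (slope (fun s => T s v) t s) := fun s => by
    rw [slope_def_module, slope_def_module, map_real_smul (T s).symm (T s).symm.continuous, map_sub,
      LinearIsometryEquiv.symm_apply_apply, LinearIsometryEquiv.symm_apply_apply, ← smul_neg,
      neg_sub]
  refine Filter.Tendsto.congr (fun s => (h1 s).symm) (Filter.Tendsto.neg ?_)
  have h2 := ((continuous_isometry_symm h (T t D)).tendsto t).mono_left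
    (nhdsWithin_le_nhds (s := {t}ᶜ))
  rw [LinearIsometryEquiv.symm_apply_apply] at h2
  exact tendsto_isometry_apply (W := fun s => (T s).symm) hD h2

/-- The product rule for a scalar product with one factor only weakly differentiable. -/
theorem hasDerivAt_inner_of_weak {x y : ℝ → L2 d} {x' : L2 d} {c : ℂ} {t : ℝ}
    (hx : HasDerivAt x x' t) (hy : ContinuousAt y t)
    (hxy : HasDerivAt (fun s => inner ℂ (x t) (y s)) c t) :
    HasDerivAt (fun s => inner ℂ (x s) (y s)) (inner ℂ x' (y t) + c) t := by
  have h1 : HasDerivAt (fun s => inner ℂ (x s - x t) (y s)) (inner ℂ x' (y t)) t := by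
    rw [hasDerivAt_iff_tendsto_slope] at hx ⊢
    refine Filter.Tendsto.congr (fun s => ?_)
      (hx.inner (hy.tendsto.mono_left (nhdsWithin_le_nhds (s := {t}ᶜ))) (𝕜 := ℂ))
    rw [slope_def_module, slope_def_module, sub_self, inner_zero_left, sub_zero,
      inner_smul_left_eq_smul]
  refine (h1.add hxy).congr_of_eventuallyEq (Filter.Eventually.of_forall fun s => ?_)
  simp only [Pi.add_apply, inner_sub_left, sub_add_cancel]

theorem IsSymbolOfOrder.inner_weylLp_eq_integral {m : ℕ} {a : Conf d → Conf d → ℝ}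
    (ha : IsSymbolOfOrder m a) (v : 𝓢(Conf d, ℂ)) (w : L2 d) :
    inner ℂ (weylLp a v) w = ∫ x, starRingEnd ℂ (weylOp a v x) * w x := by
  rw [L2.inner_def]
  refine integral_congr_ae ?_
  filter_upwards [ha.coeFn_weylLp v] with x h1
  rw [h1, RCLike.inner_apply, mul_comm]

/-- Weak solutions in terms of the scalar product of `L²`. -/
theorem isSchrodingerSolution_iff {h : ℝ → Conf d → Conf d → ℝ}
    (hh : ∀ t, ∃ m, IsSymbolOfOrder m (h t)) {ψ : ℝ → L2 d} :
    IsSchrodingerSolution h ψ ↔ Continuous ψ ∧ ∀ (v : 𝓢(Conf d, ℂ)) (t : ℝ),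
      HasDerivAt (fun s => inner ℂ (toL2 v) (ψ s))
        (-Complex.I * inner ℂ (weylLp (h t) v) (ψ t)) t := by
  have h1 : ∀ (v : 𝓢(Conf d, ℂ)) s,
      inner ℂ (toL2 v) (ψ s) = ∫ x, starRingEnd ℂ (v x) * ψ s x := fun v s =>
    inner_toL2_eq_integral v Filter.EventuallyEq.rfl
  have h2 : ∀ (v : 𝓢(Conf d, ℂ)) t, inner ℂ (weylLp (h t) v) (ψ t)
      = ∫ x, starRingEnd ℂ (weylOp (h t) v x) * ψ t x := fun v t =>
    (hh t).choose_spec.inner_weylLp_eq_integral v (ψ t)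
  simp only [IsSchrodingerSolution, h1, h2]

end HilbertSpaceCurves

/-! ### The canonical transformation and the transformed Hamiltonian -/

section CanonicalTransformation

variable {d : ℕ} {f h h' : ℝ → Conf d → Conf d → ℝ} {q : ℝ → QuadPoly d}
  {X : ℝ → ℝ → Conf d × Conf d → Conf d × Conf d}

theorem QuadPoly.gradient_eval_right (q : QuadPoly d) (x ξ : Conf d) :
    gradient (fun ξ => q.eval x ξ) ξ = (q.hamField (x, ξ)).1 := by
  have h1 : HasFDerivAt (fun ξ : Conf d => (x, ξ)) (ContinuousLinearMap.inr ℝ (Conf d) (Conf d)) ξ :=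
    hasFDerivAt_prodMk_right x ξ
  have h2 : HasFDerivAt (fun ξ => q.eval x ξ) _ ξ := (q.hasFDerivAt_eval (x, ξ)).comp ξ h1
  refine HasGradientAt.gradient (hasGradientAt_iff_hasFDerivAt.2 (h2.congr_fderiv ?_))
  ext h
  rw [InnerProductSpace.toDual_apply_apply, q.hamField_eq, inner_symplGrad_fst]
  simp

theorem QuadPoly.gradient_eval_left (q : QuadPoly d) (x ξ : Conf d) :
    -gradient (fun x => q.eval x ξ) x = (q.hamField (x, ξ)).2 := by
  have h1 : HasFDerivAt (fun x : Conf d => (x, ξ)) (ContinuousLinearMap.inl ℝ (Conf d) (Conf d)) x :=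
    hasFDerivAt_prodMk_left x ξ
  rw [neg_eq_iff_eq_neg]
  have h2 : HasFDerivAt (fun x => q.eval x ξ) _ x :=
    HasFDerivAt.comp (g := fun z : Conf d × Conf d => q.eval z.1 z.2) x
      (q.hasFDerivAt_eval (x, ξ)) h1
  refine HasGradientAt.gradient (hasGradientAt_iff_hasFDerivAt.2 (h2.congr_fderiv ?_))
  ext h
  rw [InnerProductSpace.toDual_apply_apply, q.hamField_eq, inner_neg_left, inner_symplGrad_snd]
  simp

/-- Hamilton's equations in coordinates are the equations of the Hamiltonian vector field. -/
theorem IsHamiltonianFlow.isFlow (hX : IsHamiltonianFlow f X) (hq : ∀ t, f t = (q t).eval) (t : ℝ) :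
    (q t).IsFlow (X t) where
  map_zero z := (hX t z).1
  hasDerivAt z κ := by
    obtain ⟨h1, h2⟩ := (hX t z).2 κ
    rw [hq t, QuadPoly.gradient_eval_right] at h1
    rw [hq t, QuadPoly.gradient_eval_left] at h2
    exact h1.prodMk h2

/-- The transformed Hamiltonian is `h ∘ φ` minus a quadratic polynomial. -/
theorem IsHamiltonianFlow.transformed_eq (hX : IsHamiltonianFlow f X)
    (hq : ∀ t, f t = (q t).eval) (hd : Differentiable ℝ q)
    (hh' : ∀ t x ξ, h' t x ξ = h t (X t 1 (x, ξ)).1 (X t 1 (x, ξ)).2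
      - ∫ κ in (0 : ℝ)..1, deriv (fun s => f s (X t κ (x, ξ)).1 (X t κ (x, ξ)).2) t) (t : ℝ) :
    h' t = fun x ξ => h t (X t 1 (x, ξ)).1 (X t 1 (x, ξ)).2
      + (-1) * ((q t).flowAverage (X t) (deriv q t)).eval x ξ := by
  funext x ξ
  have h1 : ∀ z : Conf d × Conf d, deriv (fun s => f s z.1 z.2) t = (deriv q t).eval z.1 z.2 :=
    fun z => by
      have := (QuadPoly.evalCLM z).hasFDerivAt.comp_hasDerivAt t (hd t).hasDerivAt
      rw [← QuadPoly.evalCLM_apply, ← this.deriv]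
      congr 1
      funext s
      rw [hq s, Function.comp_apply, QuadPoly.evalCLM_apply]
  rw [hh', (hX.isFlow hq t).eval_flowAverage]
  simp only [h1]
  ring

end CanonicalTransformation
end

theorem proposition2p3 (d : ℕ) (f h h' : ℝ → Conf d → Conf d → ℝ)
    (hf : IsQuadraticFamily f) (hh : ∀ t, IsSymbol (h t))
    (hh' : ClassicalTransforms f h h') :
    (∀ t, ∃! V : ℝ → (L2 d ≃ₗᵢ[ℂ] L2 d), IsWeylExp (f t) V) ∧
    ∀ V : ℝ → ℝ → (L2 d ≃ₗᵢ[ℂ] L2 d), (∀ t, IsWeylExp (f t) (V t)) →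
      ∀ ψ ψ' : ℝ → L2 d, (∀ t, ψ t = V t 1 (ψ' t)) →
        (IsSchrodingerSolution h ψ ↔ IsSchrodingerSolution h' ψ') := by
  obtain ⟨q, hq, hqd⟩ := hf.exists_quadPoly
  choose U hU using hf.exists_isSchwartzExp
  have hsym : ∀ t, IsSymbolOfOrder 2 (f t) := fun t => by
    rw [hq t]; exact (q t).isSymbolOfOrder
  refine ⟨fun t => ?_, fun W hW ψ ψ' hψ => ?_⟩
  · obtain ⟨W, hW⟩ := (hU t).exists_isWeylExp (hsym t)
    exact ⟨W, hW, fun W' hW' => hW'.unique (hsym t) (hU t) hW⟩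
  obtain ⟨X, hX, hX'⟩ := hh'
  have hXf := hX.isFlow hq
  have htr := hX.transformed_eq hq hqd hX'
  choose m hm using fun t => isSymbol_iff_exists_order.1 (hh t)
  -- the transformed Hamiltonian is `a - g`, with `a = h ∘ φ` and `g` the average of `∂f/∂t`
  set a : ℝ → Conf d → Conf d → ℝ := fun t x ξ => h t (X t 1 (x, ξ)).1 (X t 1 (x, ξ)).2 with ha_def
  set g : ℝ → QuadPoly d := fun t => (q t).flowAverage (X t) (deriv q t) with hg_def
  have ha : ∀ t, IsSymbolOfOrder (max (m t) 2) (a t) := fun t =>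
    ((hm t).comp_flow (hXf t) 1).mono (le_max_left _ _)
  have hg : ∀ t, IsSymbolOfOrder (max (m t) 2) (g t).eval := fun t =>
    (g t).isSymbolOfOrder.mono (le_max_right _ _)
  have hsym' : ∀ t, IsSymbolOfOrder (max (m t) 2) (h' t) := fun t => by
    rw [htr t]; exact (ha t).add ((hg t).const_mul (-1))
  have hwh' : ∀ t u, weylLp (h' t) u = weylLp (a t) u - weylLp (g t).eval u := fun t u => by
    rw [htr t, (ha t).weylLp_add_symbol ((hg t).const_mul (-1)),
      (hg t).weylLp_const_mul_symbol, neg_one_smul, sub_eq_add_neg]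
  have hWq : ∀ t, IsWeylExp (q t).eval (W t) := fun t => hq t ▸ hW t
  have hUq : ∀ t, IsSchwartzExp (q t).eval (U t) := fun t => hq t ▸ hU t
  -- the family `t ↦ exp (-i f_t^w)` is strongly continuous and differentiable on Schwartz functions
  have hR : ∀ t v, HasDerivAt (fun s => W s 1 (toL2 v))
      (W t 1 (-Complex.I • weylLp (g t).eval v)) t := fun t v =>
    hasDerivAt_weylExp (hqd t).hasDerivAt hWq (hUq t) (hXf t) v
  have hRc : ∀ u, Continuous fun s => W s 1 u := fun u => continuous_iff_continuousAt.2 fun t =>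
    continuousAt_weylExp (hqd t).continuousAt hWq (hUq t) (hXf t) ⟨zero_le_one, le_rfl⟩ u
  have happly : ∀ t v, W t 1 (toL2 v) = toL2 (U t 1 v) := fun t v =>
    (hW t).apply_toL2 (hsym t) (hU t) 1 v
  have hegorov : ∀ t v, weylLp (h t) (U t 1 v) = W t 1 (weylLp (a t) v) := fun t v =>
    ((hWq t).apply_weylLp (hUq t) (hXf t) (hm t) 1 v).symm
  have hψ' : ∀ t, ψ' t = (W t 1).symm (ψ t) := fun t => by
    rw [hψ, LinearIsometryEquiv.symm_apply_apply]
  rw [isSchrodingerSolution_iff fun t => ⟨_, hm t⟩, isSchrodingerSolution_iff fun t => ⟨_, hsym' t⟩]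
  constructor
  · rintro ⟨hc, hs⟩
    refine ⟨?_, fun v t => ?_⟩
    · rw [funext hψ']
      exact continuous_isometry_apply (continuous_isometry_symm hRc) hc
    -- `⟨v, ψ' s⟩ = ⟨W s 1 v, ψ s⟩`, where the left factor is strongly and the right one weakly
    -- differentiable
    · have h1 := hs (U t 1 v) t
      rw [← happly] at h1
      have h2 := hasDerivAt_inner_of_weak (hR t v) hc.continuousAt h1
      refine (h2.congr_deriv ?_).congr_of_eventuallyEq (Filter.Eventually.of_forall fun s => ?_)
      · rw [hegorov, hψ t, LinearIsometryEquiv.inner_map_map, LinearIsometryEquiv.inner_map_map,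
          hwh', inner_sub_left, inner_smul_left, map_neg, Complex.conj_I]
        ring
      · simp only [hψ s, LinearIsometryEquiv.inner_map_map]
  · rintro ⟨hc, hs⟩
    refine ⟨?_, fun v t => ?_⟩
    · rw [funext hψ]
      exact continuous_isometry_apply hRc hc
    -- `⟨v, ψ s⟩ = ⟨(W s 1)⁻¹ v, ψ' s⟩`; writing `v = U t 1 w` makes `(W t 1)⁻¹ v = w` a Schwartz
    -- function
    · obtain ⟨w, rfl⟩ := (U t 1).surjective v
      have h1 := hasDerivAt_isometry_symm hRc (hR t w)
      have h0 : (W t 1).symm (W t 1 (toL2 w)) = toL2 w := LinearIsometryEquiv.symm_apply_apply _ _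
      have h2 := hasDerivAt_inner_of_weak h1 hc.continuousAt (by rw [h0]; exact hs w t)
      refine (h2.congr_deriv ?_).congr_of_eventuallyEq (Filter.Eventually.of_forall fun s => ?_)
      · rw [hegorov, hψ t, LinearIsometryEquiv.inner_map_map, hwh', inner_sub_left, neg_smul,
          neg_neg, inner_smul_left, Complex.conj_I]
        ring
      · simp only [← happly, hψ s]
        rw [← LinearIsometryEquiv.inner_map_map (W s 1) ((W s 1).symm _),
          LinearIsometryEquiv.apply_symm_apply]
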